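/- Let $\mathbb F_q$ be a finite field with $q$ elements, $\mathbf k$ an algebraic closure of it, $C$ a field of characteristic $0$ (for instance $\overline{\mathbb Q}_l$), and $\varepsilon\in C$ with $\varepsilon^2=q$. A representation $V$ of the Kronecker quiver over a field consists of finite-dimensional vector spaces $V_0,V_1$ and two linear maps $x_1,x_2\colon V_0\to V_1$; its dimension vector is $(\dim V_0,\dim V_1)$, and the representations on fixed $(V_0,V_1)$ form the space $E_V=\mathrm{Hom}(V_0,V_1)^{2}$, of dimension $2\dim V_0\dim V_1$, on which $G_V=GL(V_0)\times GL(V_1)$ acts. The (twisted) Hall algebra is the $C$-vector space of $C$-valued functions of finite-dimensional representations over $\mathbb F_q$ that are constant on isomorphism classes and nonzero for only finitely many dimension vectors, with the product $$(f*g)(V)=\sum_{W\subseteq V}\varepsilon^{-m(\dim V/W,\ \dim W)}f(V/W)\,g(W),\qquad m(b,c)=2b_0c_1+b_0c_0+b_1c_1,$$ the sum being over all subrepresentations $W$ of $V$. It is an associative unital $C$-algebra. A representation over $\mathbb F_q$ is called regular if, over $\mathbf k$, the map $\lambda x_1+\mu x_2$ is an isomorphism for all but finitely many $[\lambda:\mu]\in\mathbb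 P^1(\mathbf k)$. For a function $f$ let $r(f)$ be its restriction to the regular representations, extended by zero. Consider the following elements: * $\theta_1$ is the indicator function of the dimension vector $(0,1)$; * for $n\ge 0$, $\gamma_n=\varepsilon^{-2n(n+1)}$ times the indicator function of those representations of dimension vector $(n+1,n)$ whose extension to $\mathbf k$ lies in the open dense $G_V$-orbit of $E_V$; * for $n\ge 0$, $\rho_n=\varepsilon^{-2n^2}$ times the indicator function of the regular representations of dimension vector $(n,n)$; * for $k\ge 1$, $\phi_k=\gamma_{k-1}\theta_1-\varepsilon^{-2}\theta_1\gamma_{k-1}$. Put $[n]=(\varepsilon^n-\varepsilon^{-n})/(\varepsilon-\varepsilon^{-1})$, $\wp(u)=\sum_{k\ge0}\rho_ku^k$ and $\Phi(u)=\sum_{k\ge1}\phi_ku^k$. Then: 1. $\phi_k=r(\gamma_{k-1}\theta_1)$ for all $k\ge1$. 2. $\displaystyle [n]\rho_n=\sum_{i=1}^n\varepsilon^{i-n}\phi_i\rho_{n-i}$ for all $n\ge 0$. 3. In the ring of formal power series in $u$ over the Hall algebra, $\wp(\varepsilon^{-1}u)$ is invertible, and $$\frac{\wp(\varepsilon u)}{\wp(\varepsilon^{-1}u)}=1+(\varepsilon-\varepsilon^{-1})\Phi(u),$$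 where the quotient may be read as $\wp(\varepsilon u)\,\wp(\varepsilon^{-1}u)^{-1}$ or as $\wp(\varepsilon^{-1}u)^{-1}\,\wp(\varepsilon u)$. -/

import Mathlib

open scoped TensorProduct LinearAlgebra.Projectivization PowerSeries

universe u v

noncomputable section

/-- A finite-dimensional representation over `K` of the Kronecker quiver: two vertices `0`, `1`
and two arrows from `0` to `1`, acting by `x 0` and `x 1`. -/
structure KRep (K : Type u) [Field K] where
  V₀ : Type u
  V₁ : Type u
  [acg₀ : AddCommGroup V₀]
  [acg₁ : AddCommGroup V₁]
  [mod₀ : Module K V₀]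
  [mod₁ : Module K V₁]
  [fin₀ : FiniteDimensional K V₀]
  [fin₁ : FiniteDimensional K V₁]
  x : Fin 2 → (V₀ →ₗ[K] V₁)

namespace KRep

attribute [instance] acg₀ acg₁ mod₀ mod₁ fin₀ fin₁

variable {K : Type u} [Field K]

/-- The dimension vector `(dim V₀, dim V₁)`. -/
def dim (M : KRep K) : ℕ × ℕ := (Module.finrank K M.V₀, Module.finrank K M.V₁)

/-- Two representations are isomorphic. -/
def Iso (M N : KRep K) : Prop :=
  ∃ (a : M.V₀ ≃ₗ[K] N.V₀) (b : M.V₁ ≃ₗ[K] N.V₁), ∀ j v, b (M.x j v) = N.x j (a v)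

theorem Iso.symm {M N : KRep K} (h : Iso M N) : Iso N M := by
  obtain ⟨a, b, h⟩ := h
  refine ⟨a.symm, b.symm, fun j v => ?_⟩
  rw [LinearEquiv.symm_apply_eq, h, LinearEquiv.apply_symm_apply]

theorem Iso.dim_eq {M N : KRep K} (h : Iso M N) : M.dim = N.dim := by
  obtain ⟨a, b, -⟩ := h
  simp only [dim, a.finrank_eq, b.finrank_eq]

/-- Extension of scalars along a field extension. -/
def baseChange (L : Type u) [Field L] [Algebra K L] (M : KRep K) : KRep L where
  V₀ := L ⊗[K] M.V₀
  V₁ := L ⊗[K] M.V₁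
  x := fun j => (M.x j).baseChange L

theorem Iso.baseChange (L : Type u) [Field L] [Algebra K L] {M N : KRep K} (h : Iso M N) :
    Iso (M.baseChange L) (N.baseChange L) := by
  obtain ⟨a, b, h⟩ := h
  have key : ∀ j, (b.toLinearMap.baseChange L) ∘ₗ (M.x j).baseChange L =
      (N.x j).baseChange L ∘ₗ (a.toLinearMap.baseChange L) := by
    intro j
    rw [← LinearMap.baseChange_comp, ← LinearMap.baseChange_comp]
    congr 1
    ext v
    exact h j v
  exact ⟨a.baseChange K L _ _, b.baseChange K L _ _, fun j v => LinearMap.congr_fun (key j) v⟩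

/-- The representation obtained by extending scalars to an algebraic closure. -/
def geom (M : KRep K) : KRep (AlgebraicClosure K) := M.baseChange (AlgebraicClosure K)

/-! ### Regular representations -/

/-- The map `z₀ x₀ + z₁ x₁` is bijective for all but finitely many points `[z₀ : z₁]` of the
projective line over `K` (bijectivity does not depend on the representative of the point). -/
def PencilRegular (M : KRep K) : Prop :=
  {z : ℙ K (Fin 2 → K) |
    ¬ Function.Bijective (z.rep 0 • M.x 0 + z.rep 1 • M.x 1)}.Finite

/-- A representation over `K` is regular when, over the algebraic closure of `K`, it is a regular
pencil. -/
def IsRegular (M : KRep K) : Prop := M.geom.PencilRegular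

theorem Iso.pencilRegular {M N : KRep K} (h : Iso M N) (hM : M.PencilRegular) :
    N.PencilRegular := by
  obtain ⟨a, b, h⟩ := h
  refine Set.Finite.subset hM fun z hz hb => hz ?_
  have : (⇑(z.rep 0 • N.x 0 + z.rep 1 • N.x 1)) =
      b ∘ (z.rep 0 • M.x 0 + z.rep 1 • M.x 1) ∘ a.symm := by
    funext v
    simp [h]
  rw [this]
  exact b.bijective.comp (hb.comp a.symm.bijective)

theorem Iso.isRegular {M N : KRep K} (h : Iso M N) : M.IsRegular ↔ N.IsRegular :=
  ⟨(h.baseChange _).pencilRegular, (h.symm.baseChange _).pencilRegular⟩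

/-! ### The open dense orbit -/

/-- The algebra of polynomial functions on a vector space: it is generated by the linear forms. -/
def polyFun (K : Type u) [Field K] (E : Type u) [AddCommGroup E] [Module K E] :
    Subalgebra K (E → K) :=
  Algebra.adjoin K (Set.range fun l : Module.Dual K E => (l : E → K))

theorem polyFun_comp {E E' : Type u} [AddCommGroup E] [Module K E] [AddCommGroup E'] [Module K E']
    (l : E →ₗ[K] E') {p : E' → K} (hp : p ∈ polyFun K E') : p ∘ l ∈ polyFun K E := by
  induction hp using Algebra.adjoin_induction with
  | mem p hp =>
    obtain ⟨d, rfl⟩ := hp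
    exact Algebra.subset_adjoin ⟨d ∘ₗ l, rfl⟩
  | algebraMap c => exact (polyFun K E).algebraMap_mem c
  | add p q _ _ hp hq => exact (polyFun K E).add_mem hp hq
  | mul p q _ _ hp hq => exact (polyFun K E).mul_mem hp hq

/-- A subset of a vector space is Zariski open: it is the locus where some polynomial of a given
set of polynomials does not vanish. -/
def ZariskiOpen (K : Type u) [Field K] {E : Type u} [AddCommGroup E] [Module K E]
    (S : Set E) : Prop :=
  ∃ P : Set (E → K), P ⊆ polyFun K E ∧ S = {e | ∃ p ∈ P, p e ≠ 0}

/-- A subset of a vector space is Zariski dense: a polynomial function that vanishes on it is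
zero. -/
def ZariskiDense (K : Type u) [Field K] {E : Type u} [AddCommGroup E] [Module K E]
    (S : Set E) : Prop :=
  ∀ p ∈ polyFun K E, (∀ e ∈ S, p e = 0) → ∀ e, p e = 0

/-- The orbit of `M` under `GL(V₀) × GL(V₁)` in `Hom(V₀, V₁) ⊕ Hom(V₀, V₁)`. -/
def orbit (M : KRep K) : Set (Fin 2 → (M.V₀ →ₗ[K] M.V₁)) :=
  {y | ∃ (a : M.V₀ ≃ₗ[K] M.V₀) (b : M.V₁ ≃ₗ[K] M.V₁), ∀ j v, b (M.x j v) = y j (a v)}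

/-- The orbit of `M` is open and dense in its representation space. -/
def OrbitOpenDense (M : KRep K) : Prop := ZariskiOpen K M.orbit ∧ ZariskiDense K M.orbit

/-- `M` represents a rational point of the open dense orbit, taken over the algebraic closure, of
its representation space. -/
def IsGeneric (M : KRep K) : Prop := M.geom.OrbitOpenDense

theorem Iso.orbitOpenDense {M N : KRep K} (h : Iso M N) (hM : M.OrbitOpenDense) :
    N.OrbitOpenDense := by
  obtain ⟨a, b, h⟩ := h
  let e : (Fin 2 → (M.V₀ →ₗ[K] M.V₁)) ≃ₗ[K] (Fin 2 → (N.V₀ →ₗ[K] N.V₁)) :=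
    LinearEquiv.piCongrRight fun _ => LinearEquiv.arrowCongr a b
  have he : ∀ y j v, e y j v = b (y j (a.symm v)) := fun y j v => rfl
  have horb : ∀ y, e y ∈ N.orbit ↔ y ∈ M.orbit := by
    intro y
    constructor
    · rintro ⟨a', b', h'⟩
      refine ⟨a.trans (a'.trans a.symm), b.trans (b'.trans b.symm), fun j v => ?_⟩
      have h1 := h' j (a v)
      rw [he, ← h] at h1
      simp only [LinearEquiv.trans_apply, h1, LinearEquiv.symm_apply_apply]
    · rintro ⟨a', b', h'⟩
      refine ⟨a.symm.trans (a'.trans a), b.symm.trans (b'.trans b), fun j v => ?_⟩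
      have h1 := h j (a.symm v)
      rw [LinearEquiv.apply_symm_apply] at h1
      simp only [he, LinearEquiv.trans_apply, ← h1, LinearEquiv.symm_apply_apply, h']
  refine ⟨?_, ?_⟩
  · obtain ⟨P, hP, hS⟩ := hM.1
    refine ⟨(fun p => p ∘ e.symm) '' P, ?_, ?_⟩
    · rintro _ ⟨p, hp, rfl⟩
      exact polyFun_comp e.symm.toLinearMap (hP hp)
    · ext y
      obtain ⟨y, rfl⟩ := e.surjective y
      rw [horb, hS]
      simp
  · intro p hp h0 y
    obtain ⟨y, rfl⟩ := e.surjective y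
    exact hM.2 _ (polyFun_comp e.toLinearMap hp) (fun y hy => h0 _ ((horb y).2 hy)) y

theorem Iso.isGeneric {M N : KRep K} (h : Iso M N) : M.IsGeneric ↔ N.IsGeneric :=
  ⟨(h.baseChange _).orbitOpenDense, (h.symm.baseChange _).orbitOpenDense⟩

/-! ### Subrepresentations -/

/-- A subrepresentation. -/
@[ext]
structure Sub (M : KRep K) where
  W₀ : Submodule K M.V₀
  W₁ : Submodule K M.V₁
  stable : ∀ j, W₀ ≤ W₁.comap (M.x j)

/-- A subrepresentation, as a representation. -/
def Sub.rep {M : KRep K} (W : Sub M) : KRep K where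
  V₀ := W.W₀
  V₁ := W.W₁
  x := fun j => (M.x j).restrict (W.stable j)

/-- The quotient by a subrepresentation. -/
def Sub.quot {M : KRep K} (W : Sub M) : KRep K where
  V₀ := M.V₀ ⧸ W.W₀
  V₁ := M.V₁ ⧸ W.W₁
  x := fun j => W.W₀.mapQ W.W₁ (M.x j) (W.stable j)

instance (M : KRep K) [Finite K] : Finite (Sub M) := by
  have := Module.finite_of_finite K (M := M.V₀)
  have := Module.finite_of_finite K (M := M.V₁)
  refine Finite.of_injective (β := Set M.V₀ × Set M.V₁)
    (fun W => ((W.W₀ : Set M.V₀), (W.W₁ : Set M.V₁))) fun W W' h => ?_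
  simp only [Prod.mk.injEq, SetLike.coe_set_eq] at h
  exact Sub.ext h.1 h.2

instance (M : KRep K) [Finite K] : Fintype (Sub M) := Fintype.ofFinite _

theorem Sub.dim_add {M : KRep K} (W : Sub M) : W.quot.dim + W.rep.dim = M.dim := by
  ext
  · exact Submodule.finrank_quotient_add_finrank W.W₀
  · exact Submodule.finrank_quotient_add_finrank W.W₁

/-- Transport of a subrepresentation along an isomorphism. -/
def Sub.congr {M N : KRep K} (a : M.V₀ ≃ₗ[K] N.V₀) (b : M.V₁ ≃ₗ[K] N.V₁)
    (h : ∀ j v, b (M.x j v) = N.x j (a v)) : Sub M ≃ Sub N where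
  toFun W := ⟨W.W₀.map a.toLinearMap, W.W₁.map b.toLinearMap, by
    rintro j _ ⟨v, hv, rfl⟩
    exact ⟨M.x j v, W.stable j hv, h j v⟩⟩
  invFun W := ⟨W.W₀.comap a.toLinearMap, W.W₁.comap b.toLinearMap, by
    intro j v hv
    have := W.stable j hv
    simpa [h] using this⟩
  left_inv W := by
    ext v
    · simp
    · simp
  right_inv W := by
    ext v
    · simp [Submodule.map_comap_eq]
    · simp [Submodule.map_comap_eq]

theorem Sub.congr_rep {M N : KRep K} (a : M.V₀ ≃ₗ[K] N.V₀) (b : M.V₁ ≃ₗ[K] N.V₁)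
    (h : ∀ j v, b (M.x j v) = N.x j (a v)) (W : Sub M) : Iso W.rep (Sub.congr a b h W).rep :=
  ⟨a.submoduleMap W.W₀, b.submoduleMap W.W₁, fun j v => Subtype.ext (h j v.1)⟩

theorem Sub.congr_quot {M N : KRep K} (a : M.V₀ ≃ₗ[K] N.V₀) (b : M.V₁ ≃ₗ[K] N.V₁)
    (h : ∀ j v, b (M.x j v) = N.x j (a v)) (W : Sub M) : Iso W.quot (Sub.congr a b h W).quot := by
  refine ⟨Submodule.Quotient.equiv _ _ a rfl, Submodule.Quotient.equiv _ _ b rfl, fun j v => ?_⟩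
  obtain ⟨v, rfl⟩ := Submodule.mkQ_surjective _ v
  exact congrArg (Submodule.mkQ _) (h j v)

instance (M : KRep K) : LE (Sub M) := ⟨fun U W => U.W₀ ≤ W.W₀ ∧ U.W₁ ≤ W.W₁⟩

/-- Subrepresentations of a quotient. -/
def Sub.quotEquiv {M : KRep K} (U : Sub M) : Sub U.quot ≃ {W : Sub M // U ≤ W} where
  toFun X := ⟨⟨X.W₀.comap U.W₀.mkQ, X.W₁.comap U.W₁.mkQ, fun j _ hv => X.stable j hv⟩,
    Submodule.le_comap_mkQ _ _, Submodule.le_comap_mkQ _ _⟩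
  invFun W := ⟨W.1.W₀.map U.W₀.mkQ, W.1.W₁.map U.W₁.mkQ, by
    rintro j _ ⟨v, hv, rfl⟩
    exact ⟨M.x j v, W.1.stable j hv, rfl⟩⟩
  left_inv X := Sub.ext
    (Submodule.map_comap_eq_of_surjective (Submodule.mkQ_surjective _) _)
    (Submodule.map_comap_eq_of_surjective (Submodule.mkQ_surjective _) _)
  right_inv W := by
    apply Subtype.ext
    refine Sub.ext ?_ ?_
    · exact (Submodule.comap_map_mkQ _ _).trans (sup_eq_right.2 W.2.1)
    · exact (Submodule.comap_map_mkQ _ _).trans (sup_eq_right.2 W.2.2)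

/-- Subrepresentations of a subrepresentation. -/
def Sub.repEquiv {M : KRep K} (W : Sub M) : Sub W.rep ≃ {U : Sub M // U ≤ W} where
  toFun X := ⟨⟨X.W₀.map W.W₀.subtype, X.W₁.map W.W₁.subtype, by
    rintro j _ ⟨v, hv, rfl⟩
    exact ⟨W.rep.x j v, X.stable j hv, rfl⟩⟩,
    Submodule.map_subtype_le _ _, Submodule.map_subtype_le _ _⟩
  invFun U := ⟨U.1.W₀.comap W.W₀.subtype, U.1.W₁.comap W.W₁.subtype,
    fun j v hv => U.1.stable j hv⟩
  left_inv X := Sub.ext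
    (Submodule.comap_map_eq_of_injective W.W₀.injective_subtype _)
    (Submodule.comap_map_eq_of_injective W.W₁.injective_subtype _)
  right_inv U := by
    apply Subtype.ext
    refine Sub.ext ?_ ?_
    · exact (Submodule.map_comap_subtype _ _).trans (inf_eq_right.2 U.2.1)
    · exact (Submodule.map_comap_subtype _ _).trans (inf_eq_right.2 U.2.2)

theorem Sub.quotEquiv_quot {M : KRep K} (U : Sub M) (W : {W : Sub M // U ≤ W}) :
    Iso (U.quotEquiv.symm W).quot W.1.quot := by
  refine ⟨Submodule.quotientQuotientEquivQuotient _ _ W.2.1,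
    Submodule.quotientQuotientEquivQuotient _ _ W.2.2, fun j v => ?_⟩
  obtain ⟨v, rfl⟩ := Submodule.mkQ_surjective _ v
  obtain ⟨v, rfl⟩ := Submodule.mkQ_surjective _ v
  rfl

theorem Sub.repEquiv_rep {M : KRep K} (W : Sub M) (U : {U : Sub M // U ≤ W}) :
    Iso (W.repEquiv.symm U).rep U.1.rep :=
  ⟨Submodule.submoduleOfEquivOfLe U.2.1, Submodule.submoduleOfEquivOfLe U.2.2, fun _ _ => rfl⟩

theorem Sub.mid {M : KRep K} (U W : Sub M) (h : U ≤ W) :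
    Iso (W.repEquiv.symm ⟨U, h⟩).quot (U.quotEquiv.symm ⟨W, h⟩).rep := by
  have aux : ∀ {V : Type u} [AddCommGroup V] [Module K V] (A B : Submodule K V),
      ∃ e : (B ⧸ A.comap B.subtype) ≃ₗ[K] (B.map A.mkQ),
        ∀ v : B, ((e (Submodule.Quotient.mk v) : B.map A.mkQ) : V ⧸ A) =
          Submodule.Quotient.mk v.1 := by
    intro V _ _ A B
    let f : B →ₗ[K] (B.map A.mkQ) := A.mkQ.submoduleMap B
    have hk : A.comap B.subtype = LinearMap.ker f := by
      ext v
      rw [LinearMap.mem_ker, Submodule.mem_comap, ← Subtype.coe_inj]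
      exact (Submodule.Quotient.mk_eq_zero A).symm
    refine ⟨(Submodule.quotEquivOfEq _ _ hk).trans
      (f.quotKerEquivOfSurjective (LinearMap.submoduleMap_surjective _ _)), fun v => rfl⟩
  obtain ⟨a, ha⟩ := aux U.W₀ W.W₀
  obtain ⟨b, hb⟩ := aux U.W₁ W.W₁
  refine ⟨a, b, fun j v => ?_⟩
  obtain ⟨v, rfl⟩ := Submodule.mkQ_surjective _ v
  apply Subtype.ext
  refine (hb (W.rep.x j v)).trans ?_
  exact (congrArg (U.quot.x j) (ha v)).symm

/-- The exponent of the twist: `m(b, c) = 2 b₀ c₁ + b₀ c₀ + b₁ c₁`. -/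
def twist (b c : ℕ × ℕ) : ℕ := 2 * b.1 * c.2 + b.1 * c.1 + b.2 * c.2

end KRep

open KRep

/-! ### The Hall algebra -/

section

variable (K : Type u) [Field K] {C : Type v} [Field C]

/-- Families of functions on the representation spaces `E_V` over `K` (that is, functions of a
representation) that are compatible with all isomorphisms, and are non-zero for only finitely many
dimension vectors. -/
def hallSubmodule (C : Type v) [Field C] : Submodule C (KRep K → C) where
  carrier := {f | (∀ M N, Iso M N → f M = f N) ∧
    ∃ n : ℕ, ∀ M, n < M.dim.1 + M.dim.2 → f M = 0}
  add_mem' := by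
    rintro f g ⟨hf, a, ha⟩ ⟨hg, b, hb⟩
    refine ⟨fun M N h => ?_, max a b, fun M hM => ?_⟩
    · simp [hf M N h, hg M N h]
    · simp [ha M (lt_of_le_of_lt (le_max_left _ _) hM),
        hb M (lt_of_le_of_lt (le_max_right _ _) hM)]
  zero_mem' := ⟨fun _ _ _ => rfl, 0, fun _ _ => rfl⟩
  smul_mem' := by
    rintro c f ⟨hf, a, ha⟩
    refine ⟨fun M N h => ?_, a, fun M hM => ?_⟩
    · simp [hf M N h]
    · simp [ha M hM]

/-- The underlying space of the Hall algebra, with product twisted by powers of `ε`. -/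
def Hall (_ε : C) : Type max (u + 1) v := hallSubmodule K C

variable {K} {ε : C}

namespace Hall

instance : AddCommGroup (Hall K ε) := inferInstanceAs (AddCommGroup (hallSubmodule K C))

instance : Module C (Hall K ε) := inferInstanceAs (Module C (hallSubmodule K C))

instance : CoeFun (Hall K ε) (fun _ => KRep K → C) := ⟨fun f => f.1⟩

@[ext]
theorem ext {f g : Hall K ε} (h : ∀ M, f M = g M) : f = g := Subtype.ext (funext h)

theorem iso (f : Hall K ε) {M N : KRep K} (h : Iso M N) : f M = f N := f.2.1 M N h

@[simp]
theorem add_apply (f g : Hall K ε) (M : KRep K) : (f + g) M = f M + g M := rfl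

@[simp]
theorem zero_apply (M : KRep K) : (0 : Hall K ε) M = 0 := rfl

@[simp]
theorem smul_apply (c : C) (f : Hall K ε) (M : KRep K) : (c • f) M = c * f M := rfl

open Classical in
/-- The function equal to `1` on the representations of dimension vector `d` with the
isomorphism-invariant property `P`, and to `0` elsewhere. -/
def char (ε : C) (d : ℕ × ℕ) (P : KRep K → Prop) (hP : ∀ M N, Iso M N → (P M ↔ P N)) :
    Hall K ε :=
  ⟨fun M => if M.dim = d ∧ P M then 1 else 0, fun M N h => by simp only [h.dim_eq, hP M N h],
    d.1 + d.2, fun M hM => by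
      refine if_neg ?_
      rintro ⟨rfl, -⟩
      exact lt_irrefl _ hM⟩

open Classical in
theorem char_apply (d : ℕ × ℕ) (P : KRep K → Prop) (hP : ∀ M N, Iso M N → (P M ↔ P N))
    (M : KRep K) : char ε d P hP M = if M.dim = d ∧ P M then 1 else 0 := rfl

open Classical in
/-- The restriction of a function to the regular locus, extended by zero. -/
def r (f : Hall K ε) : Hall K ε :=
  ⟨fun M => if M.IsRegular then f M else 0,
    fun M N h => by simp only [h.isRegular, f.iso h], by
      obtain ⟨n, hn⟩ := f.2.2
      exact ⟨n, fun M hM => by simp [hn M hM]⟩⟩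

/-- The unit: the function `1` on the zero representation. -/
instance : One (Hall K ε) := ⟨char ε (0, 0) (fun _ => True) fun _ _ _ => Iff.rfl⟩

open Classical in
theorem one_apply (M : KRep K) : (1 : Hall K ε) M = if M.dim = (0, 0) then 1 else 0 := by
  have h : (1 : Hall K ε) M = (char ε (0, 0) (fun _ => True) fun _ _ _ => Iff.rfl : Hall K ε) M :=
    rfl
  rw [h, char_apply]
  simp only [and_true]

variable [Finite K]

/-- The Hall product: `(f * g)(M)` is the sum over all subrepresentations `W` of `M` of
`ε ^ (-m(dim M/W, dim W)) f(M/W) g(W)`. -/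
instance : Mul (Hall K ε) := ⟨fun f g =>
  ⟨fun M => ∑ W : Sub M, ε⁻¹ ^ twist W.quot.dim W.rep.dim * f W.quot * g W.rep, by
    refine ⟨fun M N h => ?_, ?_⟩
    · obtain ⟨a, b, h⟩ := h
      refine Fintype.sum_equiv (Sub.congr a b h) _ _ fun W => ?_
      have h1 := Sub.congr_quot a b h W
      have h2 := Sub.congr_rep a b h W
      rw [h1.dim_eq, h2.dim_eq, f.iso h1, g.iso h2]
    · obtain ⟨n, hn⟩ := f.2.2
      obtain ⟨m, hm⟩ := g.2.2
      refine ⟨n + m, fun M hM => Finset.sum_eq_zero fun W _ => ?_⟩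
      have hW := W.dim_add
      rcases lt_or_ge n (W.quot.dim.1 + W.quot.dim.2) with h1 | h1
      · rw [hn _ h1, mul_zero, zero_mul]
      · have h2 : m < W.rep.dim.1 + W.rep.dim.2 := by
          rw [← hW] at hM
          simp only [Prod.fst_add, Prod.snd_add] at hM
          omega
        rw [hm _ h2, mul_zero]⟩⟩

theorem mul_apply (f g : Hall K ε) (M : KRep K) : (f * g) M =
    ∑ W : Sub M, ε⁻¹ ^ twist W.quot.dim W.rep.dim * f W.quot * g W.rep := rfl

protected theorem one_mul (f : Hall K ε) : 1 * f = f := by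
  ext M
  rw [mul_apply, Fintype.sum_eq_single (⟨⊤, ⊤, fun _ => le_top⟩ : Sub M)]
  · set W : Sub M := ⟨⊤, ⊤, fun _ => le_top⟩
    have hi : Iso W.rep M := ⟨Submodule.topEquiv, Submodule.topEquiv, fun _ _ => rfl⟩
    have hd : W.quot.dim = (0, 0) := by
      have := W.dim_add
      rw [hi.dim_eq] at this
      exact add_eq_right.1 this
    rw [one_apply, hd, if_pos rfl, f.iso hi]
    simp [twist]
  · intro W hW
    rw [one_apply, if_neg]
    · simp
    · intro hd
      apply hW
      have h0 : Module.finrank K (M.V₀ ⧸ W.W₀) = 0 := congrArg Prod.fst hd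
      have h1 : Module.finrank K (M.V₁ ⧸ W.W₁) = 0 := congrArg Prod.snd hd
      have e0 := Submodule.finrank_quotient_add_finrank W.W₀
      have e1 := Submodule.finrank_quotient_add_finrank W.W₁
      exact Sub.ext (Submodule.eq_top_of_finrank_eq (by omega))
        (Submodule.eq_top_of_finrank_eq (by omega))

protected theorem mul_one (f : Hall K ε) : f * 1 = f := by
  ext M
  rw [mul_apply, Fintype.sum_eq_single (⟨⊥, ⊥, fun _ => bot_le⟩ : Sub M)]
  · set W : Sub M := ⟨⊥, ⊥, fun _ => bot_le⟩
    have hi : Iso W.quot M := by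
      refine ⟨Submodule.quotEquivOfEqBot _ rfl, Submodule.quotEquivOfEqBot _ rfl, fun j v => ?_⟩
      obtain ⟨v, rfl⟩ := Submodule.mkQ_surjective _ v
      rfl
    have hd : W.rep.dim = (0, 0) := by
      have := W.dim_add
      rw [hi.dim_eq] at this
      exact add_eq_left.1 this
    rw [one_apply, hd, if_pos rfl, f.iso hi]
    simp [twist]
  · intro W hW
    rw [one_apply, if_neg]
    · simp
    · intro hd
      apply hW
      have h0 : Module.finrank K W.W₀ = 0 := congrArg Prod.fst hd
      have h1 : Module.finrank K W.W₁ = 0 := congrArg Prod.snd hd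
      exact Sub.ext (Submodule.finrank_eq_zero.1 h0) (Submodule.finrank_eq_zero.1 h1)

protected theorem mul_assoc (f g h : Hall K ε) : f * g * h = f * (g * h) := by
  classical
  ext M
  let T : Sub M → Sub M → C := fun U W => if hUW : U ≤ W then
      ε⁻¹ ^ (twist U.quot.dim U.rep.dim +
        twist W.quot.dim (U.quotEquiv.symm ⟨W, hUW⟩).rep.dim) *
      (f W.quot * g (U.quotEquiv.symm ⟨W, hUW⟩).rep * h U.rep) else 0
  have hl : (f * g * h) M = ∑ U : Sub M, ∑ W : Sub M, T U W := by
    rw [mul_apply]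
    refine Finset.sum_congr rfl fun U _ => ?_
    rw [mul_apply, Finset.mul_sum, Finset.sum_mul]
    rw [← Equiv.sum_comp U.quotEquiv.symm]
    rw [← Finset.sum_subset (Finset.subset_univ (Finset.univ.filter fun W => U ≤ W))
      (fun W _ hW => dif_neg (by simpa using hW))]
    rw [Finset.sum_subtype (p := fun W => U ≤ W) _ (by simp)]
    refine Finset.sum_congr rfl fun W _ => ?_
    have hi := U.quotEquiv_quot W
    simp only [T, dif_pos W.2, hi.dim_eq, f.iso hi, pow_add]
    ring
  have hr : (f * (g * h)) M = ∑ W : Sub M, ∑ U : Sub M, T U W := by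
    rw [mul_apply]
    refine Finset.sum_congr rfl fun W _ => ?_
    rw [mul_apply, Finset.mul_sum]
    rw [← Equiv.sum_comp W.repEquiv.symm]
    rw [← Finset.sum_subset (Finset.subset_univ (Finset.univ.filter fun U => U ≤ W))
      (fun U _ hU => dif_neg (by simpa using hU))]
    rw [Finset.sum_subtype (p := fun U => U ≤ W) _ (by simp)]
    refine Finset.sum_congr rfl fun U _ => ?_
    have hi := W.repEquiv_rep U
    have hm := Sub.mid U.1 W U.2
    have hW := (W.repEquiv.symm U).dim_add
    have hU := (U.1.quotEquiv.symm ⟨W, U.2⟩).dim_add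
    have hi' := U.1.quotEquiv_quot ⟨W, U.2⟩
    have hexp : twist W.quot.dim W.rep.dim +
        twist (W.repEquiv.symm U).quot.dim (W.repEquiv.symm U).rep.dim =
        twist U.1.quot.dim U.1.rep.dim +
        twist W.quot.dim (U.1.quotEquiv.symm ⟨W, U.2⟩).rep.dim := by
      rw [← hW, ← hU, hi'.dim_eq, hi.dim_eq, hm.dim_eq]
      simp only [twist, Prod.fst_add, Prod.snd_add]
      ring
    simp only [T, dif_pos U.2]
    rw [← hexp, h.iso hi, g.iso hm, pow_add]
    ring
  rw [hl, hr, Finset.sum_comm]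

instance : Ring (Hall K ε) where
  __ := (inferInstance : AddCommGroup (Hall K ε))
  left_distrib f g h := by
    ext M
    simp only [mul_apply, add_apply, mul_add, Finset.sum_add_distrib]
  right_distrib f g h := by
    ext M
    simp only [mul_apply, add_apply, mul_add, add_mul, Finset.sum_add_distrib]
  zero_mul f := by
    ext M
    simp [mul_apply]
  mul_zero f := by
    ext M
    simp [mul_apply]
  mul_assoc := Hall.mul_assoc
  one_mul := Hall.one_mul
  mul_one := Hall.mul_one

instance : Algebra C (Hall K ε) := Algebra.ofModule
  (fun c f g => by
    ext M
    simp only [mul_apply, smul_apply, Finset.mul_sum]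
    exact Finset.sum_congr rfl fun W _ => by ring)
  (fun c f g => by
    ext M
    simp only [mul_apply, smul_apply, Finset.mul_sum]
    exact Finset.sum_congr rfl fun W _ => by ring)

end Hall

end

/-! ### The distinguished elements -/

section

variable (K : Type u) [Field K] {C : Type v} [Field C] (ε : C)

/-- The quantum integer `[n] = (ε ^ n - ε ^ (-n)) / (ε - ε ^ (-1))`. -/
def qInt (ε : C) (n : ℕ) : C := (ε ^ n - ε⁻¹ ^ n) / (ε - ε⁻¹)

/-- The dimension of the representation space `Hom(V₀, V₁) ⊕ Hom(V₀, V₁)`. -/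
def dimE (d : ℕ × ℕ) : ℕ := 2 * d.1 * d.2

/-- The function `1` on the (one-point) representation space of dimension vector `(0, 1)`. -/
def theta₁ : Hall K ε := Hall.char ε (0, 1) (fun _ => True) fun _ _ _ => Iff.rfl

/-- The normalized indicator function of the open dense orbit in dimension `(n + 1, n)`. -/
def gam (n : ℕ) : Hall K ε :=
  ε⁻¹ ^ dimE (n + 1, n) • Hall.char ε (n + 1, n) KRep.IsGeneric fun _ _ h => h.isGeneric

/-- The normalized indicator function of the regular locus in dimension `(n, n)`. -/
def rho (n : ℕ) : Hall K ε :=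
  ε⁻¹ ^ dimE (n, n) • Hall.char ε (n, n) KRep.IsRegular fun _ _ h => h.isRegular

variable [Finite K]

/-- The element `γ_{k-1} θ₁ - ε⁻² θ₁ γ_{k-1}`, for `k ≥ 1`. -/
def phi (k : ℕ) : Hall K ε :=
  gam K ε (k - 1) * theta₁ K ε - ε⁻¹ ^ 2 • (theta₁ K ε * gam K ε (k - 1))

/-- The power series `℘(c u) = ∑_{k ≥ 0} c ^ k ρ_k u ^ k`. -/
def wp (c : C) : (Hall K ε)⟦X⟧ := PowerSeries.mk fun k => c ^ k • rho K ε k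

/-- The power series `Φ(u) = ∑_{k ≥ 1} φ_k u ^ k`. -/
def Phi : (Hall K ε)⟦X⟧ := PowerSeries.mk fun k => if k = 0 then 0 else phi K ε k

end

end

/-! Everything reduces to counting vectors. For a representation V of dimension (n, n), call l in V₁
cyclic (`Good`) when V modulo the line of l lies in the open orbit of dimension (n, n - 1). By
Kronecker's argument on kernel vectors of minimal degree, the open orbit in dimension (m + 1, m)
consists of the pencils that kill no non-zero polynomial vector of degree less than m (`NoChain`,
`isGeneric_iff`). So γ_{k-1} θ₁ counts, up to a power of ε, the lines of cyclic vectors, and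
`goodCard` is q - 1 times their number.

Assertion 1. A regular V has no subrepresentation of dimension (k, k - 1), because a pencil with
non-zero determinant embeds W₀[X] into W₁[X]; there the second term of φ_k vanishes. On a singular V
a generic subrepresentation W of that dimension is unique, it exists as soon as there is a cyclic
vector, and the cyclic vectors are then the complement of W₁. So there are q^(k-1) times as many
lines as such W, and the twists make the two terms of φ_k cancel (`goodCard_of_det_eq_zero`,
`phi_eq_r`).

Assertion 2. At a regular V of dimension (n, n) the powers of ε depend on n only, and the identity
says that the numbers of cyclic vectors of the quotients of V with equal dimensions add up to q^n -
1. For subrepresentations in place of quotients this holds because each non-zero l is cyclic in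
exactly one of them, namely the one generated by the coefficients of adj(x 0 + X x 1) l (`genSub`,
`Sub.good_iff`). Orthogonal complements turn quotients into subrepresentations of the transposed
pencil, and a regular pencil has as many cyclic vectors as its transpose: both numbers count the
pairs (l, f) with f · adj(x 0 + X x 1) l = H, for a fixed H prime to the determinant
(`card_goodVec_transpose`).

Assertion 3 is assertion 2 read as an identity of series. The count over subrepresentations gives
the same recursion with the factors φ and ρ exchanged, hence both forms of the quotient; ρ_0 = 1
gives invertibility. -/

noncomputable section

/-! ### Chains of a pencil -/

section Chains

variable {K : Type*} [Field K] {U W : Type*} [AddCommGroup U] [Module K U]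
  [AddCommGroup W] [Module K W]

/-- The coefficients of a formal power series `∑ v k t ^ k` killed by `y 0 + t y 1`. -/
def PencilChain (y : Fin 2 → (U →ₗ[K] W)) (v : ℕ → U) : Prop :=
  y 0 (v 0) = 0 ∧ ∀ k, y 0 (v (k + 1)) + y 1 (v k) = 0

/-- The pencil `y 0 + t y 1` kills no non-zero polynomial of degree less than `d`. -/
def NoChain (y : Fin 2 → (U →ₗ[K] W)) (d : ℕ) : Prop :=
  ∀ v, PencilChain y v → (∀ k, d ≤ k → v k = 0) → ∀ k, v k = 0

/-- Kronecker's argument: v has minimal degree among the chains, so v 0 and v m are non-zero, and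
any relation among the y 0 (v (j + 1)) would produce a chain of smaller degree. -/
theorem PencilChain.independent {y : Fin 2 → (U →ₗ[K] W)} {m : ℕ} (hy : NoChain y m) {v : ℕ → U}
    (hv : PencilChain y v) (hm : ∀ k, m < k → v k = 0) (h0 : ∃ k, v k ≠ 0) :
    LinearIndependent K (fun j : Fin (m + 1) => v j) ∧
      LinearIndependent K (fun j : Fin m => y 0 (v (j + 1))) := by
  obtain ⟨k₀, hk₀⟩ := h0
  have hvm : v m ≠ 0 := by
    intro h
    refine hk₀ (hy v hv (fun k hk => ?_) k₀)
    rcases hk.eq_or_lt with rfl | hk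
    · exact h
    · exact hm k hk
  have hv0 : v 0 ≠ 0 := by
    intro h
    have h1 := hy (fun k => v (k + 1)) ⟨by simpa [h] using hv.2 0, fun k => hv.2 (k + 1)⟩
      (fun k hk => hm _ (by omega))
    cases k₀ with
    | zero => exact hk₀ h
    | succ k => exact hk₀ (h1 k)
  have hind : LinearIndependent K (fun j : Fin m => y 0 (v (j + 1))) := by
    rw [Fintype.linearIndependent_iff]
    intro α hα
    -- A combination of truncated shifts of v. Its coefficient of degree m - 1 - n is α n • v m once
    -- all α j with j < n vanish.
    have hw := hy (fun k => ∑ j : Fin m, α j • v (j + 1 + k)) ⟨by simpa using hα, fun k => by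
        simp only [map_sum, map_smul, ← Finset.sum_add_distrib, ← smul_add]
        exact Finset.sum_eq_zero fun j _ => by rw [← add_assoc, hv.2, smul_zero]⟩
      (fun k hk => Finset.sum_eq_zero fun j _ => by rw [hm _ (by omega), smul_zero])
    have key : ∀ n : ℕ, ∀ hn : n < m, α ⟨n, hn⟩ = 0 := by
      intro n
      induction n using Nat.strong_induction_on with
      | _ n ih =>
        intro hn
        have h1 := hw (m - 1 - n)
        rw [Finset.sum_eq_single ⟨n, hn⟩] at h1
        · have e : n + 1 + (m - 1 - n) = m := by omega
          simp only [e] at h1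
          exact (smul_eq_zero.1 h1).resolve_right hvm
        · intro j _ hj
          have hj' : (j : ℕ) ≠ n := fun h => hj (Fin.ext h)
          rcases lt_or_gt_of_ne hj' with h | h
          · rw [ih j h j.2, zero_smul]
          · rw [hm _ (by omega), smul_zero]
        · simp
    exact fun j => key j j.2
  refine ⟨?_, hind⟩
  rw [Fintype.linearIndependent_iff]
  intro β hβ
  rw [Fin.sum_univ_succ] at hβ
  have h1 := congrArg (y 0) hβ
  simp only [map_add, map_smul, map_sum, map_zero, Fin.val_zero, hv.1, smul_zero, zero_add,
    Fin.val_succ] at h1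
  have h2 := Fintype.linearIndependent_iff.1 hind _ h1
  simp only [h2, zero_smul, Finset.sum_const_zero, add_zero, Fin.val_zero] at hβ
  intro j
  refine Fin.cases ((smul_eq_zero.1 hβ).resolve_right hv0) h2 j

/-- The pencil `y 0 + t y 1`, from polynomials of degree less than `d` to polynomials of degree
less than `d + 1`. -/
def kronMap (d : ℕ) : (Fin 2 → (U →ₗ[K] W)) →ₗ[K] ((Fin d → U) →ₗ[K] (Fin (d + 1) → W)) where
  toFun y := LinearMap.pi fun k =>
    (if h : (k : ℕ) < d then y 0 ∘ₗ LinearMap.proj (⟨k, h⟩ : Fin d) else 0) +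
    (if h : 0 < (k : ℕ) then y 1 ∘ₗ LinearMap.proj (⟨k - 1, by omega⟩ : Fin d) else 0)
  map_add' y y' := by
    ext v k
    simp only [LinearMap.pi_apply, LinearMap.add_apply, LinearMap.comp_apply, Pi.add_apply]
    split_ifs <;> simp
    abel
  map_smul' c y := by
    ext v k
    simp only [LinearMap.pi_apply, LinearMap.add_apply, LinearMap.comp_apply, Pi.smul_apply,
      LinearMap.smul_apply, RingHom.id_apply, smul_add]
    split_ifs <;> simp

theorem kronMap_apply (d : ℕ) (y : Fin 2 → (U →ₗ[K] W)) (v : ℕ → U) (hv : ∀ k, d ≤ k → v k = 0)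
    (k : Fin (d + 1)) : kronMap d y (fun i => v i) k =
      y 0 (v k) + if 0 < (k : ℕ) then y 1 (v (k - 1)) else 0 := by
  simp only [kronMap, LinearMap.coe_mk, AddHom.coe_mk, LinearMap.pi_apply, LinearMap.add_apply]
  congr 1
  · split_ifs with h
    · rfl
    · simp [hv k (by omega)]
  · split_ifs <;> rfl

theorem kronMap_eq_zero_iff (d : ℕ) (y : Fin 2 → (U →ₗ[K] W)) (v : ℕ → U)
    (hv : ∀ k, d ≤ k → v k = 0) : kronMap d y (fun i => v i) = 0 ↔ PencilChain y v := by
  constructor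
  · intro h
    refine ⟨by simpa [kronMap_apply d y v hv] using congrFun h 0, fun k => ?_⟩
    by_cases hk : k < d
    · simpa [kronMap_apply d y v hv] using congrFun h ⟨k + 1, by omega⟩
    · rw [hv k (by omega), hv (k + 1) (by omega), map_zero, map_zero, add_zero]
  · rintro ⟨h0, h⟩
    funext k
    rw [kronMap_apply d y v hv]
    obtain ⟨k, hk⟩ := k
    cases k with
    | zero => simpa using h0
    | succ k => simpa using h k

/-- This turns the condition into one on the rank of a linear map: it opens the way to dimension
counts and, for square sizes, to determinants. -/
theorem noChain_iff_injective (d : ℕ) (y : Fin 2 → (U →ₗ[K] W)) :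
    NoChain y d ↔ Function.Injective (kronMap d y) := by
  rw [injective_iff_map_eq_zero]
  constructor
  · intro h w hw
    set v : ℕ → U := fun k => if h : k < d then w ⟨k, h⟩ else 0
    have hv : ∀ k, d ≤ k → v k = 0 := fun k hk => dif_neg (by omega)
    have hwv : w = fun i : Fin d => v i := by
      funext i
      simp [v]
    rw [hwv, kronMap_eq_zero_iff d y v hv] at hw
    rw [hwv]
    funext i
    exact h v hw hv i
  · intro h v hv hd k
    have h1 := h _ ((kronMap_eq_zero_iff d y v hd).2 hv)
    by_cases hk : k < d
    · exact congrFun h1 ⟨k, hk⟩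
    · exact hd k (by omega)

theorem exists_pencilChain [FiniteDimensional K U] [FiniteDimensional K W] (y : Fin 2 → (U →ₗ[K] W))
    {d : ℕ} (h : (d + 1) * Module.finrank K W < d * Module.finrank K U) :
    ∃ v, PencilChain y v ∧ (∀ k, d ≤ k → v k = 0) ∧ ∃ k, v k ≠ 0 := by
  by_contra hc
  push Not at hc
  have hi : NoChain y d := hc
  rw [noChain_iff_injective] at hi
  have := LinearMap.finrank_le_finrank_of_injective hi
  simp only [Module.finrank_pi_fintype, Finset.sum_const, Finset.card_univ, Fintype.card_fin,
    smul_eq_mul] at this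
  omega

/-- The normal form of a pencil of size `m × (m + 1)` without chains of length `m`. -/
theorem NoChain.exists_bases [FiniteDimensional K U] [FiniteDimensional K W]
    {y : Fin 2 → (U →ₗ[K] W)} {m : ℕ} (hU : Module.finrank K U = m + 1)
    (hW : Module.finrank K W = m) (hy : NoChain y m) :
    ∃ v, PencilChain y v ∧ (∀ k, m < k → v k = 0) ∧
      ∃ (a : Module.Basis (Fin (m + 1)) K U) (b : Module.Basis (Fin m) K W),
        (∀ j, a j = v j) ∧ ∀ j, b j = y 0 (v (j + 1)) := by
  -- With m + 1 coefficients there are (m + 1)² unknowns against (m + 2) m equations; with m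
  -- coefficients the two numbers agree.
  obtain ⟨v, hv, hm, h0⟩ := exists_pencilChain y (d := m + 1) (by rw [hU, hW]; ring_nf; omega)
  obtain ⟨h1, h2⟩ := hv.independent hy hm h0
  refine ⟨v, hv, hm, basisOfLinearIndependentOfCardEqFinrank h1 (by simp [hU]),
    basisOfLinearIndependentOfCardEqFinrank' _ h2 (by simp [hW]), by simp, by simp⟩

variable {U' W' : Type*} [AddCommGroup U'] [Module K U'] [AddCommGroup W'] [Module K W']

/-- In the bases v j and y 0 (v (j + 1)) both pencils have the same normal form: y 0 is visible, and
the chain relation then gives y 1. -/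
theorem NoChain.exists_equiv [FiniteDimensional K U] [FiniteDimensional K W]
    [FiniteDimensional K U'] [FiniteDimensional K W']
    {y : Fin 2 → (U →ₗ[K] W)} {y' : Fin 2 → (U' →ₗ[K] W')} {m : ℕ}
    (hU : Module.finrank K U = m + 1) (hW : Module.finrank K W = m)
    (hU' : Module.finrank K U' = m + 1) (hW' : Module.finrank K W' = m)
    (hy : NoChain y m) (hy' : NoChain y' m) :
    ∃ (a : U ≃ₗ[K] U') (b : W ≃ₗ[K] W'), ∀ j u, b (y j u) = y' j (a u) := by
  obtain ⟨v, hv, hm, a, b, ha, hb⟩ := hy.exists_bases hU hW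
  obtain ⟨v', hv', hm', a', b', ha', hb'⟩ := hy'.exists_bases hU' hW'
  have h0 : ∀ k, b.equiv b' (Equiv.refl _) (y 0 (v k)) = y' 0 (v' k) := by
    intro k
    cases k with
    | zero => rw [hv.1, hv'.1, map_zero]
    | succ k =>
      by_cases hk : k < m
      · have := b.equiv_apply (b' := b') ⟨k, hk⟩ (Equiv.refl _)
        rwa [Equiv.refl_apply, hb, hb'] at this
      · rw [hm _ (by omega), hm' _ (by omega), map_zero, map_zero, map_zero]
  have h1 : ∀ k, b.equiv b' (Equiv.refl _) (y 1 (v k)) = y' 1 (v' k) := by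
    intro k
    rw [eq_neg_of_add_eq_zero_right (hv.2 k), eq_neg_of_add_eq_zero_right (hv'.2 k), map_neg, h0]
  refine ⟨a.equiv a' (Equiv.refl _), b.equiv b' (Equiv.refl _), fun j u => ?_⟩
  have : (b.equiv b' (Equiv.refl _)).toLinearMap ∘ₗ y j =
      y' j ∘ₗ (a.equiv a' (Equiv.refl _)).toLinearMap := by
    refine a.ext fun i => ?_
    have h2 : a.equiv a' (Equiv.refl _) (v i) = v' i := by
      rw [← ha, Module.Basis.equiv_apply, ha', Equiv.refl_apply]
    simp only [LinearMap.comp_apply, LinearEquiv.coe_coe, ha, h2]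
    obtain rfl | rfl : j = 0 ∨ j = 1 := by omega
    · exact h0 i
    · exact h1 i
  exact LinearMap.congr_fun this u

/-- Existence of pencils of size `m × (m + 1)` without chains of length `m`. -/
theorem exists_noChain [FiniteDimensional K U] [FiniteDimensional K W] {m : ℕ}
    (hU : Module.finrank K U = m + 1) (hW : Module.finrank K W = m) :
    ∃ y : Fin 2 → (U →ₗ[K] W), NoChain y m := by
  let a := Module.finBasisOfFinrankEq K U hU
  let b := Module.finBasisOfFinrankEq K W hW
  -- The Kronecker block: y 0 drops the first coordinate and -y 1 the last one. The coordinates of a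
  -- chain are therefore constant along diagonals.
  let y : Fin 2 → (U →ₗ[K] W) := ![b.equivFun.symm.toLinearMap ∘ₗ
      LinearMap.pi (fun i : Fin m => LinearMap.proj i.succ) ∘ₗ a.equivFun.toLinearMap,
    -(b.equivFun.symm.toLinearMap ∘ₗ
      LinearMap.pi (fun i : Fin m => LinearMap.proj i.castSucc) ∘ₗ a.equivFun.toLinearMap)]
  have hy0 : ∀ u i, b.equivFun (y 0 u) i = a.equivFun u i.succ := fun u i => by
    change b.equivFun (b.equivFun.symm _) i = _
    rw [LinearEquiv.apply_symm_apply]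
    rfl
  have hy1 : ∀ u i, b.equivFun (y 1 u) i = -a.equivFun u i.castSucc := fun u i => by
    change b.equivFun (-b.equivFun.symm _) i = _
    rw [map_neg, LinearEquiv.apply_symm_apply]
    rfl
  refine ⟨y, fun v hv hm => ?_⟩
  have h0 : ∀ i : Fin m, a.equivFun (v 0) i.succ = 0 := by
    intro i
    rw [← hy0, hv.1, map_zero, Pi.zero_apply]
  have h1 : ∀ k, ∀ i : Fin m, a.equivFun (v (k + 1)) i.succ = a.equivFun (v k) i.castSucc := by
    intro k i
    have := congrFun (congrArg b.equivFun (hv.2 k)) i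
    rw [map_add, Pi.add_apply, hy0, hy1, map_zero, Pi.zero_apply] at this
    exact add_neg_eq_zero.1 this
  -- Upwards, a diagonal with i ≤ k ends at coordinate m of some v k with k ≥ m, which is zero. The
  -- other diagonals (`h3`) come down to a coordinate of v 0 killed by y 0 (v 0) = 0.
  have h2 : ∀ n : ℕ, ∀ i : Fin (m + 1), (i : ℕ) + n = m → ∀ k, (i : ℕ) ≤ k →
      a.equivFun (v k) i = 0 := by
    intro n
    induction n with
    | zero =>
      intro i hi k hk
      rw [hm k (by omega), map_zero, Pi.zero_apply]
    | succ n ih =>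
      intro i hi k hk
      have := h1 k ⟨i, by omega⟩
      rw [show (⟨i, by omega⟩ : Fin m).castSucc = i from rfl] at this
      rw [← this]
      exact ih _ (by simp; omega) _ (by simp; omega)
  have h3 : ∀ k, ∀ i : Fin (m + 1), k < (i : ℕ) → a.equivFun (v k) i = 0 := by
    intro k
    induction k with
    | zero =>
      intro i hi
      have := h0 ⟨i - 1, by omega⟩
      rwa [show (⟨i - 1, by omega⟩ : Fin m).succ = i from Fin.ext (by simp; omega)] at this
    | succ k ih =>
      intro i hi
      have := h1 k ⟨i - 1, by omega⟩
      rw [show (⟨i - 1, by omega⟩ : Fin m).succ = i from Fin.ext (by simp; omega)] at this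
      rw [this]
      exact ih _ (by simp; omega)
  intro k
  apply a.equivFun.injective
  funext i
  rw [map_zero, Pi.zero_apply]
  rcases lt_or_ge k i with h | h
  · exact h3 k i h
  · exact h2 (m - i) i (by omega) k h

/-- Chains are pushed forward along a, so b may be any intertwining map. This freedom serves to
compare a subrepresentation with a quotient of the ambient one. -/
theorem NoChain.comp_injective {y : Fin 2 → (U →ₗ[K] W)} {y' : Fin 2 → (U' →ₗ[K] W')} {d : ℕ}
    (hy : NoChain y' d) (a : U →ₗ[K] U') (b : W →ₗ[K] W') (ha : Function.Injective a)
    (h : ∀ j u, b (y j u) = y' j (a u)) : NoChain y d := by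
  intro v hv hd k
  apply ha
  rw [map_zero]
  refine hy (fun k => a (v k)) ⟨?_, fun k => ?_⟩ (fun k hk => by rw [hd k hk, map_zero]) k
  · rw [← h, hv.1, map_zero]
  · rw [← h, ← h, ← map_add, hv.2, map_zero]

/-- The images of a square pencil problem without chains span the target. -/
theorem NoChain.range_sup_range [FiniteDimensional K U] [FiniteDimensional K W]
    {y : Fin 2 → (U →ₗ[K] W)} {m : ℕ} (hU : Module.finrank K U = m + 1)
    (hW : Module.finrank K W = m) (hy : NoChain y m) (S : Submodule K W)
    (hS : ∀ j u, y j u ∈ S) : S = ⊤ := by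
  obtain ⟨v, -, -, -, b, -, hb⟩ := hy.exists_bases hU hW
  rw [eq_top_iff, ← b.span_eq, Submodule.span_le]
  rintro _ ⟨j, rfl⟩
  rw [hb]
  exact hS _ _

end Chains

/-! ### Polynomial functions on a vector space -/

section PolyFun

variable {K : Type u} [Field K] {E : Type u} [AddCommGroup E] [Module K E]

theorem polyFun_line {p : E → K} (hp : p ∈ KRep.polyFun K E) (e d : E) :
    ∃ P : Polynomial K, ∀ t, p (e + t • d) = P.eval t := by
  induction hp using Algebra.adjoin_induction with
  | mem p hp =>
    obtain ⟨l, rfl⟩ := hp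
    exact ⟨Polynomial.C (l e) + Polynomial.X * Polynomial.C (l d), fun t => by simp; ring⟩
  | algebraMap c => exact ⟨Polynomial.C c, fun t => by simp⟩
  | add p q _ _ hp hq =>
    obtain ⟨P, hP⟩ := hp
    obtain ⟨Q, hQ⟩ := hq
    exact ⟨P + Q, fun t => by simp [hP, hQ]⟩
  | mul p q _ _ hp hq =>
    obtain ⟨P, hP⟩ := hp
    obtain ⟨Q, hQ⟩ := hq
    exact ⟨P * Q, fun t => by simp [hP, hQ]⟩

/-- On the line from e to e₀ the product of r and p vanishes at all points of an infinite field,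
while p is not identically zero there; hence r vanishes on the line, in particular at e. -/
theorem zariskiDense_of_ne_zero [Infinite K] {p : E → K} (hp : p ∈ KRep.polyFun K E) {e₀ : E}
    (h₀ : p e₀ ≠ 0) : KRep.ZariskiDense K {e | p e ≠ 0} := by
  intro r hr h e
  obtain ⟨P, hP⟩ := polyFun_line hp e (e₀ - e)
  obtain ⟨R, hR⟩ := polyFun_line hr e (e₀ - e)
  have hPR : P * R = 0 := by
    refine Polynomial.funext fun t => ?_
    rw [Polynomial.eval_mul, ← hP, ← hR, Polynomial.eval_zero]
    by_cases h0 : p (e + t • (e₀ - e)) = 0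
    · rw [h0, zero_mul]
    · rw [h _ h0, mul_zero]
  have hP0 : P ≠ 0 := by
    rintro rfl
    apply h₀
    simpa using hP 1
  rw [(mul_eq_zero.1 hPR).resolve_left hP0] at hR
  simpa using hR 0

/-- After an identification of B with A, the polynomial is the determinant, expanded by the Leibniz
formula. -/
theorem exists_polyFun_injective {A B : Type*} [AddCommGroup A] [Module K A] [AddCommGroup B]
    [Module K B] [FiniteDimensional K A] [FiniteDimensional K B]
    (hAB : Module.finrank K A = Module.finrank K B) (f : E →ₗ[K] (A →ₗ[K] B)) :
    ∃ p ∈ KRep.polyFun K E, ∀ e, p e ≠ 0 ↔ Function.Injective (f e) := by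
  classical
  let b := Module.finBasis K A
  let g : B ≃ₗ[K] A := LinearEquiv.ofFinrankEq _ _ hAB.symm
  refine ⟨fun e => LinearMap.det (g.toLinearMap ∘ₗ f e), ?_, fun e => ?_⟩
  · have : (fun e => LinearMap.det (g.toLinearMap ∘ₗ f e)) =
        ∑ σ : Equiv.Perm (Fin (Module.finrank K A)), (Equiv.Perm.sign σ : ℤ) •
          ∏ i, fun e => b.repr (g (f e (b i))) (σ i) := by
      funext e
      rw [← LinearMap.det_toMatrix b, Matrix.det_apply, Finset.sum_apply]
      refine Finset.sum_congr rfl fun σ _ => ?_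
      rw [Pi.smul_apply, Finset.prod_apply]
      simp [LinearMap.toMatrix_apply, Units.smul_def]
    rw [this]
    refine sum_mem fun σ _ => zsmul_mem (prod_mem fun i _ => ?_) _
    refine Algebra.subset_adjoin ⟨b.coord (σ i) ∘ₗ g.toLinearMap ∘ₗ
      LinearMap.applyₗ (b i) ∘ₗ f, rfl⟩
  · rw [← isUnit_iff_ne_zero, ← LinearMap.isUnit_iff_isUnit_det, LinearMap.isUnit_iff_ker_eq_bot,
      LinearMap.ker_eq_bot, LinearMap.coe_comp]
    exact g.injective.of_comp_iff _

end PolyFun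

/-! ### The open orbit in dimension (m + 1, m). -/

namespace KRep

section Generic

variable {K : Type u} [Field K]

theorem Iso.trans {M N P : KRep K} (h : Iso M N) (h' : Iso N P) : Iso M P := by
  obtain ⟨a, b, h⟩ := h
  obtain ⟨a', b', h'⟩ := h'
  exact ⟨a.trans a', b.trans b', fun j v => by simp [h, h']⟩

theorem Iso.noChain {M N : KRep K} (h : Iso M N) {d : ℕ} (hM : NoChain M.x d) : NoChain N.x d := by
  obtain ⟨a, b, h⟩ := h.symm
  exact hM.comp_injective a.toLinearMap b.toLinearMap a.injective h

theorem Iso.noChain_iff {M N : KRep K} (h : Iso M N) {d : ℕ} : NoChain M.x d ↔ NoChain N.x d :=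
  ⟨h.noChain, h.symm.noChain⟩

/-- In this dimension `kronMap` is square, so `NoChain` is the non-vanishing of one determinant, not
identically zero by `exists_noChain`. Its locus is a single orbit by the normal form, and any dense
orbit has to meet it. -/
theorem orbitOpenDense_iff [Infinite K] {M : KRep K} {m : ℕ} (hM : M.dim = (m + 1, m)) :
    M.OrbitOpenDense ↔ NoChain M.x m := by
  have h0 : Module.finrank K M.V₀ = m + 1 := congrArg Prod.fst hM
  have h1 : Module.finrank K M.V₁ = m := congrArg Prod.snd hM
  have hf : Module.finrank K (Fin m → M.V₀) = Module.finrank K (Fin (m + 1) → M.V₁) := by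
    simp only [Module.finrank_pi_fintype, Finset.sum_const, Finset.card_univ, Fintype.card_fin,
      smul_eq_mul, h0, h1, mul_comm]
  obtain ⟨p, hp, hpi⟩ := exists_polyFun_injective hf (kronMap (K := K) m)
  replace hpi : ∀ y, p y ≠ 0 ↔ NoChain y m := fun y => (hpi y).trans (noChain_iff_injective _ _).symm
  obtain ⟨y₀, hy₀⟩ := exists_noChain h0 h1
  constructor
  · rintro ⟨-, hd⟩
    by_contra hc
    refine (hpi y₀).2 hy₀ (hd p hp (fun y hy => ?_) y₀)
    by_contra hy'
    obtain ⟨a, b, hab⟩ := hy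
    exact hc (((hpi y).1 hy').comp_injective a.toLinearMap b.toLinearMap a.injective hab)
  · intro h
    have horb : M.orbit = {y | p y ≠ 0} := by
      ext y
      rw [Set.mem_ofPred_eq, hpi]
      constructor
      · rintro ⟨a, b, hab⟩
        refine h.comp_injective a.symm.toLinearMap b.symm.toLinearMap a.symm.injective fun j u => ?_
        rw [LinearEquiv.coe_coe, LinearEquiv.symm_apply_eq, LinearEquiv.coe_coe, hab,
          LinearEquiv.apply_symm_apply]
      · intro hy
        exact h.exists_equiv h0 h1 h0 h1 hy
    refine ⟨⟨{p}, by simpa using hp, by rw [horb]; simp⟩, ?_⟩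
    rw [horb]
    exact zariskiDense_of_ne_zero hp ((hpi y₀).2 hy₀)

end Generic

/-! ### Representations given by matrices -/

section MatRep

variable {K : Type u} [Field K]

/-- The representation given by a pair of matrices. -/
abbrev matRep {m n : ℕ} (x : Fin 2 → Matrix (Fin m) (Fin n) K) : KRep K where
  V₀ := Fin n → K
  V₁ := Fin m → K
  x := fun j => (x j).mulVecLin

theorem matRep_dim {m n : ℕ} (x : Fin 2 → Matrix (Fin m) (Fin n) K) : (matRep x).dim = (n, m) :=
  Prod.ext (Module.finrank_fin_fun K) (Module.finrank_fin_fun K)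

theorem exists_iso_matRep (M : KRep K) {m n : ℕ} (h : M.dim = (n, m)) :
    ∃ x : Fin 2 → Matrix (Fin m) (Fin n) K, Iso (matRep x) M := by
  let a := (Module.finBasisOfFinrankEq K M.V₀ (congrArg Prod.fst h)).equivFun
  let b := (Module.finBasisOfFinrankEq K M.V₁ (congrArg Prod.snd h)).equivFun
  refine ⟨fun j => LinearMap.toMatrix' (b.toLinearMap ∘ₗ M.x j ∘ₗ a.symm.toLinearMap),
    a.symm, b.symm, fun j v => ?_⟩
  change b.symm (Matrix.toLin' (LinearMap.toMatrix' _) v) = _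
  rw [Matrix.toLin'_toMatrix']
  exact b.symm_apply_apply _

theorem matRep_baseChange {m n : ℕ} (x : Fin 2 → Matrix (Fin m) (Fin n) K) (L : Type u) [Field L]
    [Algebra K L] : Iso ((matRep x).baseChange L) (matRep fun j => (x j).map (algebraMap K L)) := by
  refine ⟨TensorProduct.piScalarRight K L L (Fin n), TensorProduct.piScalarRight K L L (Fin m),
    fun j v => ?_⟩
  change L ⊗[K] (Fin n → K) at v
  change TensorProduct.piScalarRight K L L (Fin m) ((x j).mulVecLin.baseChange L v) =
      ((x j).map (algebraMap K L)).mulVec (TensorProduct.piScalarRight K L L (Fin n) v)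
  induction v using TensorProduct.induction_on with
  | zero => simp only [map_zero, Matrix.mulVec_zero]
  | add v w hv hw => simp only [map_add, hv, hw, Matrix.mulVec_add]
  | tmul c v =>
    funext i
    simp only [LinearMap.baseChange_tmul, TensorProduct.piScalarRight_apply,
      TensorProduct.piScalarRightHom_tmul, Matrix.mulVecLin_apply,
      Matrix.mulVec, dotProduct, Matrix.map_apply, Algebra.smul_def, map_sum,
      map_mul, Finset.sum_mul]
    exact Finset.sum_congr rfl fun k _ => by ring

/-- A chain over K is a chain over L. Conversely a K-linear functional L → K, chosen non-zero on
some coordinate, sends a non-zero chain over L to a non-zero chain over K of no larger degree. -/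
theorem noChain_map_iff {m n : ℕ} (x : Fin 2 → Matrix (Fin m) (Fin n) K) (L : Type u) [Field L]
    [Algebra K L] (d : ℕ) :
    NoChain (fun j => ((x j).map (algebraMap K L)).mulVecLin) d ↔
      NoChain (fun j => (x j).mulVecLin) d := by
  have key : ∀ (φ : L →ₗ[K] K) (j) (v : Fin n → L),
      (x j).mulVec (fun i => φ (v i)) = fun i => φ (((x j).map (algebraMap K L)).mulVec v i) := by
    intro φ j v
    funext i
    simp [Matrix.mulVec, dotProduct, map_sum, ← Algebra.smul_def]
  have key' : ∀ j (w : Fin n → K), ((x j).map (algebraMap K L)).mulVec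
      (fun i => algebraMap K L (w i)) = fun i => algebraMap K L ((x j).mulVec w i) := by
    intro j w
    funext i
    simp [Matrix.mulVec, dotProduct, map_sum]
  constructor
  · intro h v hv hd k
    have h1 := h (fun k i => algebraMap K L (v k i)) ?_ (fun k hk => ?_) k
    · funext i
      exact (algebraMap K L).injective (by simpa using congrFun h1 i)
    · simp only [PencilChain, Matrix.mulVecLin_apply] at hv ⊢
      simp only [key', hv.1]
      refine ⟨funext fun i => map_zero _, fun k => funext fun i => ?_⟩
      have := congrFun (hv.2 k) i
      rw [Pi.add_apply] at this ⊢
      rw [← map_add, this]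
      exact map_zero _
    · funext i
      rw [hd k hk]
      exact map_zero _
  · intro h v hv hd k
    funext i
    by_contra hi
    obtain ⟨φ, hφ⟩ : ∃ φ : L →ₗ[K] K, φ (v k i) ≠ 0 := by
      by_contra hc
      push Not at hc
      exact hi ((Module.forall_dual_apply_eq_zero_iff K _).1 hc)
    apply hφ
    refine congrFun (h (fun k i => φ (v k i)) ?_ (fun k hk => ?_) k) i
    · simp only [PencilChain, Matrix.mulVecLin_apply] at hv ⊢
      simp only [key, hv.1]
      refine ⟨funext fun i => map_zero _, fun k => funext fun i => ?_⟩
      have := congrFun (hv.2 k) i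
      rw [Pi.add_apply] at this ⊢
      rw [← map_add, this]
      exact map_zero _
    · funext i
      change φ (v k i) = 0
      rw [hd k hk]
      exact map_zero _

theorem isGeneric_iff {M : KRep K} {m : ℕ} (hM : M.dim = (m + 1, m)) :
    M.IsGeneric ↔ NoChain M.x m := by
  obtain ⟨x, hx⟩ := M.exists_iso_matRep hM
  have h1 := (hx.symm.baseChange (AlgebraicClosure K)).trans (matRep_baseChange x _)
  rw [← hx.noChain_iff]
  refine Iff.trans ?_ (h1.noChain_iff.trans (noChain_map_iff x (AlgebraicClosure K) m))
  exact orbitOpenDense_iff (h1.dim_eq.trans (matRep_dim _))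

end MatRep

end KRep

/-! ### Matrix pencils over a polynomial ring -/

section Pencil

open Polynomial

variable {K : Type*} [Field K] {m n : ℕ}

/-- The matrix pencil `x 0 + X x 1`. -/
def pencil (x : Fin 2 → Matrix (Fin m) (Fin n) K) : Matrix (Fin m) (Fin n) K[X] :=
  (x 0).map C + (X : K[X]) • (x 1).map C

/-- The constant polynomial vector attached to a vector. -/
def cvec (v : Fin n → K) : Fin n → K[X] := fun i => C (v i)

/-- A coefficient of a polynomial vector. -/
def vcoeff (w : Fin n → K[X]) (k : ℕ) : Fin n → K := fun i => (w i).coeff k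

/-- The polynomial vector with prescribed coefficients in degrees less than `d`. -/
def polyVec (v : ℕ → Fin n → K) (d : ℕ) : Fin n → K[X] :=
  fun i => ∑ k ∈ Finset.range d, monomial k (v k i)

theorem vcoeff_polyVec {v : ℕ → Fin n → K} {d : ℕ} (hv : ∀ k, d ≤ k → v k = 0) (k : ℕ) :
    vcoeff (polyVec v d) k = v k := by
  funext i
  simp only [vcoeff, polyVec, finsetSum_coeff, coeff_monomial]
  rw [Finset.sum_ite_eq' (Finset.range d) k]
  split_ifs with h
  · rfl
  · rw [hv k (by simpa using h), Pi.zero_apply]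

theorem vcoeff_ext {w w' : Fin n → K[X]} (h : ∀ k, vcoeff w k = vcoeff w' k) : w = w' :=
  funext fun i => Polynomial.ext fun k => congrFun (h k) i

theorem vcoeff_zero (k : ℕ) : vcoeff (0 : Fin n → K[X]) k = 0 := funext fun _ => coeff_zero k

theorem vcoeff_smul_cvec (p : K[X]) (v : Fin n → K) (k : ℕ) :
    vcoeff (p • cvec v) k = p.coeff k • v := by
  funext i
  simp [vcoeff, cvec]

theorem vcoeff_add (w w' : Fin n → K[X]) (k : ℕ) :
    vcoeff (w + w') k = vcoeff w k + vcoeff w' k := funext fun _ => coeff_add _ _ _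

theorem vcoeff_map_mulVec (a : Matrix (Fin m) (Fin n) K) (w : Fin n → K[X]) (k : ℕ) :
    vcoeff ((a.map C).mulVec w) k = a.mulVec (vcoeff w k) := by
  funext i
  simp [vcoeff, Matrix.mulVec, dotProduct, finsetSum_coeff]

theorem map_mulVec_cvec (a : Matrix (Fin m) (Fin n) K) (v : Fin n → K) :
    (a.map C).mulVec (cvec v) = cvec (a.mulVec v) := by
  funext i
  simp [cvec, Matrix.mulVec, dotProduct]

theorem pencil_mulVec (x : Fin 2 → Matrix (Fin m) (Fin n) K) (w : Fin n → K[X]) :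
    (pencil x).mulVec w = ((x 0).map C).mulVec w + (X : K[X]) • ((x 1).map C).mulVec w := by
  rw [pencil, Matrix.add_mulVec, Matrix.smul_mulVec]

theorem vcoeff_pencil_zero (x : Fin 2 → Matrix (Fin m) (Fin n) K) (w : Fin n → K[X]) :
    vcoeff ((pencil x).mulVec w) 0 = (x 0).mulVec (vcoeff w 0) := by
  rw [pencil_mulVec, vcoeff_add, vcoeff_map_mulVec, add_eq_left]
  funext i
  simp [vcoeff]

theorem vcoeff_pencil_succ (x : Fin 2 → Matrix (Fin m) (Fin n) K) (w : Fin n → K[X]) (k : ℕ) :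
    vcoeff ((pencil x).mulVec w) (k + 1) =
      (x 0).mulVec (vcoeff w (k + 1)) + (x 1).mulVec (vcoeff w k) := by
  rw [pencil_mulVec, vcoeff_add, vcoeff_map_mulVec, ← vcoeff_map_mulVec (x 1)]
  congr 1
  funext i
  simp [vcoeff]

theorem coeff_cvec_dotProduct (c : Fin n → K) (w : Fin n → K[X]) (k : ℕ) :
    (cvec c ⬝ᵥ w).coeff k = c ⬝ᵥ vcoeff w k := by
  simp [cvec, vcoeff, dotProduct, finsetSum_coeff]

theorem pencil_mulVec_eq_zero_iff (x : Fin 2 → Matrix (Fin m) (Fin n) K) (w : Fin n → K[X]) :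
    (pencil x).mulVec w = 0 ↔ PencilChain (fun j => (x j).mulVecLin) (vcoeff w) := by
  constructor
  · intro h
    refine ⟨?_, fun k => ?_⟩
    · rw [Matrix.mulVecLin_apply, ← vcoeff_pencil_zero, h, vcoeff_zero]
    · rw [Matrix.mulVecLin_apply, Matrix.mulVecLin_apply, ← vcoeff_pencil_succ, h, vcoeff_zero]
  · intro h
    refine vcoeff_ext fun k => ?_
    rw [vcoeff_zero]
    cases k with
    | zero => exact (vcoeff_pencil_zero _ _).trans h.1
    | succ k => exact (vcoeff_pencil_succ _ _ _).trans (h.2 k)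

theorem pencil_transpose (x : Fin 2 → Matrix (Fin m) (Fin n) K) :
    pencil (fun j => (x j).transpose) = (pencil x).transpose := by
  ext i j
  simp [pencil]

theorem pencil_mul_map {l : ℕ} (x : Fin 2 → Matrix (Fin m) (Fin n) K)
    (a : Matrix (Fin n) (Fin l) K) : pencil x * a.map C = pencil fun j => x j * a := by
  simp only [pencil, Matrix.add_mul, Matrix.smul_mul, Matrix.map_mul]

theorem map_mul_pencil {l : ℕ} (x : Fin 2 → Matrix (Fin m) (Fin n) K)
    (a : Matrix (Fin l) (Fin m) K) : a.map C * pencil x = pencil fun j => a * x j := by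
  simp only [pencil, Matrix.mul_add, Matrix.mul_smul, Matrix.map_mul]

theorem pencil_map {L : Type*} [Field L] (f : K →+* L) (x : Fin 2 → Matrix (Fin m) (Fin n) K) :
    pencil (fun j => (x j).map f) = (pencil x).map (Polynomial.mapRingHom f) := by
  ext i j : 2
  simp [pencil]

theorem eval_det_pencil (x : Fin 2 → Matrix (Fin n) (Fin n) K) (t : K) :
    (pencil x).det.eval t = (x 0 + t • x 1).det := by
  rw [← coe_evalRingHom, RingHom.map_det]
  congr 1
  ext i j
  simp only [pencil, RingHom.mapMatrix_apply, Matrix.map_apply, Matrix.add_apply,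
    Matrix.smul_apply, smul_eq_mul, coe_evalRingHom, eval_add, eval_mul, eval_C, eval_X]

theorem natDegree_det_pencil_le (x : Fin 2 → Matrix (Fin n) (Fin n) K) :
    (pencil x).det.natDegree ≤ n := by
  rw [pencil, add_comm]
  simpa using Polynomial.natDegree_det_X_add_C_le (x 1) (x 0)

/-- Up to sign the entries are determinants of pencils of size n. -/
theorem natDegree_adjugate_pencil_le (x : Fin 2 → Matrix (Fin (n + 1)) (Fin (n + 1)) K)
    (i j : Fin (n + 1)) : ((pencil x).adjugate i j).natDegree ≤ n := by
  rw [Matrix.adjugate_fin_succ_eq_det_submatrix]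
  have h : ((pencil x).submatrix j.succAbove i.succAbove) =
      pencil fun k => (x k).submatrix j.succAbove i.succAbove := by
    ext a b
    simp [pencil]
  rw [h]
  refine (natDegree_mul_le).trans ?_
  have h1 : ((-1 : K[X]) ^ (j + i : ℕ)).natDegree = 0 := by
    rcases neg_one_pow_eq_or K[X] (j + i : ℕ) with h | h <;> rw [h] <;> simp
  rw [h1, zero_add]
  exact natDegree_det_pencil_le _

end Pencil

namespace KRep

open Polynomial

/-! ### Regularity in terms of the determinant of the pencil -/

section Regular

theorem point_ne_zero {K : Type u} [Field K] (t : K) : (![1, t] : Fin 2 → K) ≠ 0 := fun h => by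
  simpa using congrFun h 0

theorem infinite_points {K : Type u} [Field K] [Infinite K] :
    (Set.range fun t : K => Projectivization.mk K ![1, t] (point_ne_zero t)).Infinite := by
  refine Set.infinite_range_of_injective fun t t' h => ?_
  obtain ⟨a, ha⟩ := (Projectivization.mk_eq_mk_iff' K _ _ (point_ne_zero t)
    (point_ne_zero t')).1 h
  have h0 := congrFun ha 0
  have h1 := congrFun ha 1
  simp at h0 h1
  rw [← h1, h0, one_mul]

variable {K : Type u} [Field K]

theorem pencilRegular_matRep_iff [Infinite K] {n : ℕ} (x : Fin 2 → Matrix (Fin n) (Fin n) K) :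
    (matRep x).PencilRegular ↔ (pencil x).det ≠ 0 := by
  have key : ∀ t : K, Function.Bijective
      ((Projectivization.mk K ![1, t] (point_ne_zero t)).rep 0 • (matRep x).x 0 +
        (Projectivization.mk K ![1, t] (point_ne_zero t)).rep 1 • (matRep x).x 1) ↔
      (pencil x).det.eval t ≠ 0 := by
    intro t
    obtain ⟨a, ha⟩ := Projectivization.exists_smul_eq_mk_rep K ![1, t] (point_ne_zero t)
    have e : (Projectivization.mk K ![1, t] (point_ne_zero t)).rep 0 • (x 0).mulVecLin +
        (Projectivization.mk K ![1, t] (point_ne_zero t)).rep 1 • (x 1).mulVecLin =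
        ((a : K) • (x 0 + t • x 1)).mulVecLin := by
      rw [← ha]
      ext v i
      simp [Units.smul_def, mul_smul]
    rw [e, eval_det_pencil]
    change Function.Bijective ((a : K) • (x 0 + t • x 1)).mulVec ↔ _
    rw [Function.Bijective, Matrix.mulVec_injective_iff_isUnit, Matrix.mulVec_surjective_iff_isUnit,
      and_self, Matrix.isUnit_iff_isUnit_det, Matrix.det_smul, isUnit_iff_ne_zero]
    simp
  constructor
  · intro h h0
    refine infinite_points (K := K) (h.subset ?_)
    rintro _ ⟨t, rfl⟩
    rw [Set.mem_ofPred_eq, key, h0]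
    simp
  · intro h
    have h01 : (![0, 1] : Fin 2 → K) ≠ 0 := fun h => by simpa using congrFun h 1
    -- The chart [1 : t] misses only [0 : 1], which can be added to the exceptional set whether or
    -- not it belongs there.
    refine Set.Finite.subset (Set.Finite.insert (Projectivization.mk K ![0, 1] h01)
      ((Polynomial.finite_setOfPred_isRoot h).image
        fun t : K => Projectivization.mk K ![1, t] (point_ne_zero t))) ?_
    intro z hz
    induction z using Projectivization.ind with
    | h v hv =>
      by_cases h0 : v 0 = 0
      · left
        refine (Projectivization.mk_eq_mk_iff' K _ _ _ _).2 ⟨v 1, ?_⟩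
        funext i
        fin_cases i
        · simp [h0]
        · simp
      · right
        have hz' : Projectivization.mk K v hv =
            Projectivization.mk K ![1, v 1 / v 0] (point_ne_zero _) := by
          refine (Projectivization.mk_eq_mk_iff' K _ _ _ _).2 ⟨v 0, ?_⟩
          funext i
          fin_cases i
          · simp
          · simp
            field_simp
        rw [hz'] at hz ⊢
        refine ⟨_, ?_, rfl⟩
        rw [Set.mem_ofPred_eq, key, not_not] at hz
        exact hz

theorem isRegular_matRep_iff {n : ℕ} (x : Fin 2 → Matrix (Fin n) (Fin n) K) :
    (matRep x).IsRegular ↔ (pencil x).det ≠ 0 := by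
  have h := matRep_baseChange x (AlgebraicClosure K)
  rw [IsRegular, geom, show ((matRep x).baseChange (AlgebraicClosure K)).PencilRegular ↔ _ from
    ⟨h.pencilRegular, h.symm.pencilRegular⟩, pencilRegular_matRep_iff, pencil_map,
    ← RingHom.mapMatrix_apply, ← RingHom.map_det, Polynomial.coe_mapRingHom, Ne, Ne,
    Polynomial.map_eq_zero]

theorem IsRegular.dim_eq {M : KRep K} (h : M.IsRegular) : M.dim.1 = M.dim.2 := by
  obtain ⟨z, -, hz⟩ := infinite_points.exists_notMem_finite h
  rw [Set.mem_ofPred_eq, not_not] at hz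
  have := (LinearEquiv.ofBijective _ hz).finrank_eq
  change Module.finrank (AlgebraicClosure K) (AlgebraicClosure K ⊗[K] M.V₀) =
    Module.finrank (AlgebraicClosure K) (AlgebraicClosure K ⊗[K] M.V₁) at this
  rwa [Module.finrank_baseChange, Module.finrank_baseChange] at this

end Regular

end KRep

/-! ### Cyclic vectors of a square pencil -/

section GoodVec

open Polynomial

variable {K : Type*} [Field K] {n : ℕ}

/-- The coefficients of the polynomial vector `adj (x 0 + X x 1) l` span the space. -/
def GoodVec (x : Fin 2 → Matrix (Fin n) (Fin n) K) (l : Fin n → K) : Prop :=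
  ∀ c : Fin n → K, cvec c ⬝ᵥ ((pencil x).adjugate.mulVec (cvec l)) = 0 → c = 0

theorem exists_dotProduct_eq_zero (v : ℕ → Fin (n + 1) → K) :
    ∃ c : Fin (n + 1) → K, c ≠ 0 ∧ ∀ k < n, c ⬝ᵥ v k = 0 := by
  let M : Matrix (Fin n) (Fin (n + 1)) K := Matrix.of fun k => v k
  obtain ⟨c, hc, hc0⟩ := (LinearMap.ker M.mulVecLin).exists_mem_ne_zero_of_ne_bot
    (LinearMap.ker_ne_bot_of_finrank_lt (by simp))
  refine ⟨c, hc0, fun k hk => ?_⟩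
  rw [dotProduct_comm]
  exact congrFun hc ⟨k, hk⟩

theorem cvec_eq_zero_iff {l : Fin n → K} : cvec l = 0 ↔ l = 0 := by
  simp [cvec, funext_iff]

theorem natDegree_adjugate_mulVec_le (x : Fin 2 → Matrix (Fin (n + 1)) (Fin (n + 1)) K)
    (l : Fin (n + 1) → K) (i : Fin (n + 1)) :
    ((pencil x).adjugate.mulVec (cvec l) i).natDegree ≤ n := by
  rw [Matrix.mulVec, dotProduct]
  refine natDegree_sum_le_of_forall_le _ _ fun j _ => ?_
  exact (natDegree_mul_C_le _ _).trans (natDegree_adjugate_pencil_le x i j)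

/-- All coefficients of the pencil applied to v lie on the line of l, so this polynomial vector is a
scalar polynomial times l. The scalar is read off at a coordinate where l does not vanish. -/
theorem exists_poly_smul_of_chain_mod (x : Fin 2 → Matrix (Fin n) (Fin n) K) {l : Fin n → K}
    (hl : l ≠ 0) {v : ℕ → Fin n → K} {d : ℕ} (hd : ∀ k, d ≤ k → v k = 0)
    (hv : PencilChain (fun j => (Submodule.span K {l}).mkQ ∘ₗ (x j).mulVecLin) v) :
    ∃ P' : K[X], P'.degree < (d + 1 : ℕ) ∧ (pencil x).mulVec (polyVec v d) = P' • cvec l := by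
  obtain ⟨i, hi⟩ := Function.ne_iff.1 hl
  have h1 : ∀ k, vcoeff ((pencil x).mulVec (polyVec v d)) k ∈ Submodule.span K {l} := by
    intro k
    cases k with
    | zero =>
      rw [vcoeff_pencil_zero, vcoeff_polyVec hd]
      exact (Submodule.Quotient.mk_eq_zero _).1 hv.1
    | succ k =>
      rw [vcoeff_pencil_succ, vcoeff_polyVec hd, vcoeff_polyVec hd]
      refine (Submodule.Quotient.mk_eq_zero _).1 ?_
      rw [Submodule.Quotient.mk_add]
      exact hv.2 k
  have h2 : (pencil x).mulVec (polyVec v d) =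
      (C (l i)⁻¹ * (pencil x).mulVec (polyVec v d) i) • cvec l := by
    refine vcoeff_ext fun k => ?_
    rw [vcoeff_smul_cvec, coeff_C_mul]
    obtain ⟨a, ha⟩ := Submodule.mem_span_singleton.1 (h1 k)
    have h3 : ((pencil x).mulVec (polyVec v d) i).coeff k = a * l i := (congrFun ha i).symm
    rw [h3, ← ha, mul_comm a, inv_mul_cancel_left₀ hi]
  refine ⟨C (l i)⁻¹ * (pencil x).mulVec (polyVec v d) i, ?_, h2⟩
  · rw [degree_lt_iff_coeff_zero]
    intro k hk
    rw [coeff_C_mul]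
    have h3 : vcoeff ((pencil x).mulVec (polyVec v d)) k = 0 := by
      obtain ⟨k, rfl⟩ : ∃ k', k = k' + 1 := ⟨k - 1, by omega⟩
      rw [vcoeff_pencil_succ, vcoeff_polyVec hd, vcoeff_polyVec hd, hd k (by omega),
        hd (k + 1) (by omega), Matrix.mulVec_zero, Matrix.mulVec_zero, add_zero]
    rw [show ((pencil x).mulVec (polyVec v d) i).coeff k = 0 from congrFun h3 i, mul_zero]

/-- A polynomial solution modulo `l` is a multiple of `adj (x 0 + X x 1) l`. -/
theorem exists_poly_of_chain_mod (x : Fin 2 → Matrix (Fin n) (Fin n) K) {l : Fin n → K}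
    (hl : l ≠ 0) {v : ℕ → Fin n → K} {d : ℕ} (hd : ∀ k, d ≤ k → v k = 0)
    (hv : PencilChain (fun j => (Submodule.span K {l}).mkQ ∘ₗ (x j).mulVecLin) v) :
    ∃ P' : K[X], P'.degree < (d + 1 : ℕ) ∧ (pencil x).det • polyVec v d =
      P' • (pencil x).adjugate.mulVec (cvec l) := by
  obtain ⟨P', h, hP'⟩ := exists_poly_smul_of_chain_mod x hl hd hv
  refine ⟨P', h, ?_⟩
  rw [← Matrix.mulVec_smul, ← hP', Matrix.mulVec_mulVec, Matrix.adjugate_mul, Matrix.smul_mulVec,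
    Matrix.one_mulVec]

theorem eq_zero_of_polyVec_eq_zero {v : ℕ → Fin n → K} {d : ℕ} (hd : ∀ k, d ≤ k → v k = 0)
    (h : polyVec v d = 0) (k : ℕ) : v k = 0 := by
  rw [← vcoeff_polyVec hd, h, vcoeff_zero]

/-- A chain v modulo l with n coefficients satisfies det • v = P' • adj l. Some c ≠ 0 kills these n
vectors, so P' (c · adj l) = 0, and goodness forces P' = 0. Conversely adj l is itself a chain
modulo l, of degree at most n, since the pencil sends it to det • l; by `PencilChain.independent`
its n + 1 coefficients form a basis. -/
theorem goodVec_iff (x : Fin 2 → Matrix (Fin (n + 1)) (Fin (n + 1)) K)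
    (hx : (pencil x).det ≠ 0) (l : Fin (n + 1) → K) : GoodVec x l ↔
      l ≠ 0 ∧ NoChain (fun j => (Submodule.span K {l}).mkQ ∘ₗ (x j).mulVecLin) n := by
  constructor
  · intro h
    have hl : l ≠ 0 := by
      rintro rfl
      have := h (Pi.single 0 1) (by rw [cvec_eq_zero_iff.2 rfl, Matrix.mulVec_zero,
        dotProduct_zero])
      simpa using congrFun this 0
    refine ⟨hl, fun v hv hd => ?_⟩
    obtain ⟨P', -, hP'⟩ := exists_poly_of_chain_mod x hl hd hv
    obtain ⟨c, hc0, hc⟩ := exists_dotProduct_eq_zero v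
    have h1 : cvec c ⬝ᵥ polyVec v n = 0 := by
      ext k
      rw [coeff_cvec_dotProduct, vcoeff_polyVec hd, coeff_zero]
      by_cases hk : k < n
      · exact hc k hk
      · rw [hd k (by omega), dotProduct_zero]
    have h2 := congrArg (cvec c ⬝ᵥ ·) hP'
    simp only [dotProduct_smul, h1, smul_zero] at h2
    rcases smul_eq_zero.1 h2.symm with h3 | h3
    · rw [h3, zero_smul] at hP'
      exact eq_zero_of_polyVec_eq_zero hd ((smul_eq_zero.1 hP').resolve_left hx)
    · exact absurd (h c h3) hc0
  · rintro ⟨hl, h⟩ c hc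
    set w := (pencil x).adjugate.mulVec (cvec l) with hw
    have hpw : (pencil x).mulVec w = (pencil x).det • cvec l := by
      rw [hw, Matrix.mulVec_mulVec, Matrix.mul_adjugate, Matrix.smul_mulVec, Matrix.one_mulVec]
    have hmem : ∀ k, vcoeff ((pencil x).mulVec w) k ∈ Submodule.span K {l} := fun k => by
      rw [hpw, vcoeff_smul_cvec]
      exact Submodule.smul_mem _ _ (Submodule.mem_span_singleton_self l)
    have hch : PencilChain (fun j => (Submodule.span K {l}).mkQ ∘ₗ (x j).mulVecLin)
        (vcoeff w) := by
      refine ⟨?_, fun k => ?_⟩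
      · refine (Submodule.Quotient.mk_eq_zero _).2 ?_
        rw [Matrix.mulVecLin_apply, ← vcoeff_pencil_zero]
        exact hmem 0
      · simp only [LinearMap.comp_apply, ← map_add]
        refine (Submodule.Quotient.mk_eq_zero _).2 ?_
        rw [Matrix.mulVecLin_apply, Matrix.mulVecLin_apply, ← vcoeff_pencil_succ]
        exact hmem _
    have hne : ∃ k, vcoeff w k ≠ 0 := by
      by_contra hc
      push Not at hc
      have hw0 : w = 0 := vcoeff_ext fun k => by rw [hc, vcoeff_zero]
      rw [hw0, Matrix.mulVec_zero] at hpw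
      exact hl (cvec_eq_zero_iff.1 ((smul_eq_zero.1 hpw.symm).resolve_left hx))
    obtain ⟨hind, -⟩ := hch.independent h (fun k hk => funext fun i =>
      coeff_eq_zero_of_natDegree_lt ((natDegree_adjugate_mulVec_le x l i).trans_lt hk)) hne
    let b := basisOfLinearIndependentOfCardEqFinrank hind (by simp)
    have hb : (Matrix.of fun _ : Fin 1 => c).mulVecLin = 0 := by
      refine b.ext fun k => ?_
      funext i
      simp only [b, coe_basisOfLinearIndependentOfCardEqFinrank, Matrix.mulVecLin_apply]
      change c ⬝ᵥ vcoeff w k = 0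
      rw [← coeff_cvec_dotProduct, hc, coeff_zero]
    funext i
    have := congrFun (LinearMap.congr_fun hb (Pi.single i 1)) 0
    simpa using this

/-- A form of degree `n` prime to the determinant of a pencil of size `n + 1`, considered as a
form of degree `n + 1`. -/
theorem exists_coprime {P : K[X]} (hP0 : P ≠ 0) (hP : P.natDegree ≤ n + 1) :
    ∃ H : K[X], H.degree < (n + 1 : ℕ) ∧ ∀ P' R : K[X], P'.degree < (n + 1 : ℕ) →
      R.degree < (n : ℕ) → P * R = P' * H → P' = 0 := by
  rcases hP.eq_or_lt with hd | hd
  -- Here P has no zero at infinity, and 1, as a form of degree n, can vanish only there.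
  · refine ⟨1, by rw [degree_one]; exact_mod_cast Nat.succ_pos n, fun P' R hP' _ h => ?_⟩
    rw [mul_one] at h
    subst h
    by_contra h
    have hR : R ≠ 0 := right_ne_zero_of_mul h
    rw [degree_eq_natDegree h, natDegree_mul hP0 hR] at hP'
    norm_cast at hP'
    omega
  -- Here P, as a form of degree n + 1, vanishes at infinity, so H needs exact degree n besides
  -- being prime to P. A constant P is separated because P X ^ n + 1 need not have degree n when n =
  -- 0.
  · obtain ⟨H, hco, hH⟩ : ∃ H : K[X], IsCoprime P H ∧ H.natDegree = n ∧ H ≠ 0 := by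
      rcases Nat.eq_zero_or_pos P.natDegree with h0 | h0
      · refine ⟨X ^ n, ?_, natDegree_X_pow n, pow_ne_zero _ X_ne_zero⟩
        have hu : IsUnit P := isUnit_iff_degree_eq_zero.2 (by rw [degree_eq_natDegree hP0, h0]; rfl)
        obtain ⟨Q, hQ⟩ := hu.exists_left_inv
        exact ⟨Q, 0, by rw [hQ, zero_mul, add_zero]⟩
      · have hdeg : (P * X ^ (n - P.natDegree) + 1).natDegree = n := by
          have h1 : (P * X ^ (n - P.natDegree)).natDegree = n := by
            rw [natDegree_mul_X_pow _ hP0]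
            omega
          rw [natDegree_add_eq_left_of_natDegree_lt, h1]
          rw [h1, natDegree_one]
          omega
        refine ⟨P * X ^ (n - P.natDegree) + 1, ⟨-X ^ (n - P.natDegree), 1, by ring⟩, hdeg, ?_⟩
        intro h
        rw [h, natDegree_zero] at hdeg
        omega
    refine ⟨H, ?_, fun P' R _ hR h => ?_⟩
    · rw [degree_eq_natDegree hH.2, hH.1]
      exact_mod_cast Nat.lt_succ_self n
    · obtain ⟨Q, rfl⟩ := hco.dvd_of_dvd_mul_right ⟨R, h.symm⟩
      rw [mul_assoc] at h
      have hRQ := mul_left_cancel₀ hP0 h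
      by_contra hc
      have hQ : Q ≠ 0 := right_ne_zero_of_mul hc
      rw [hRQ, degree_eq_natDegree (mul_ne_zero hQ hH.2), natDegree_mul hQ hH.2, hH.1] at hR
      norm_cast at hR
      omega

theorem dotProduct_adjugate_transpose (x : Fin 2 → Matrix (Fin n) (Fin n) K) (f l : Fin n → K) :
    cvec l ⬝ᵥ (pencil fun j => (x j).transpose).adjugate.mulVec (cvec f) =
      cvec f ⬝ᵥ (pencil x).adjugate.mulVec (cvec l) := by
  rw [pencil_transpose, ← Matrix.adjugate_transpose, Matrix.mulVec_transpose,
    Matrix.dotProduct_mulVec, dotProduct_comm]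

/-- Pairing a chain modulo l with f gives det · R = P' · H with R of degree less than n, which is
what the choice of H excludes unless P' = 0. -/
theorem goodVec_of_dotProduct_eq {x : Fin 2 → Matrix (Fin (n + 1)) (Fin (n + 1)) K}
    (hx : (pencil x).det ≠ 0) {H : K[X]} (hH : ∀ P' R : K[X], P'.degree < (n + 1 : ℕ) →
      R.degree < (n : ℕ) → (pencil x).det * R = P' * H → P' = 0) {f l : Fin (n + 1) → K}
    (h : cvec f ⬝ᵥ (pencil x).adjugate.mulVec (cvec l) = H) : GoodVec x l := by
  have hl : l ≠ 0 := by
    rintro rfl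
    rw [cvec_eq_zero_iff.2 rfl, Matrix.mulVec_zero, dotProduct_zero] at h
    have := hH 1 0 (by rw [degree_one]; exact_mod_cast Nat.succ_pos n)
      (by rw [degree_zero]; exact WithBot.bot_lt_coe _) (by rw [← h]; simp)
    exact one_ne_zero this
  rw [goodVec_iff x hx]
  refine ⟨hl, fun v hv hd => ?_⟩
  obtain ⟨P', hdeg, hP'⟩ := exists_poly_of_chain_mod x hl hd hv
  have h2 := congrArg (cvec f ⬝ᵥ ·) hP'
  simp only [dotProduct_smul, h, smul_eq_mul] at h2
  have h3 := hH P' _ hdeg ?_ h2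
  · rw [h3, zero_smul] at hP'
    exact eq_zero_of_polyVec_eq_zero hd ((smul_eq_zero.1 hP').resolve_left hx)
  · rw [degree_lt_iff_coeff_zero]
    intro k hk
    rw [coeff_cvec_dotProduct, vcoeff_polyVec hd, hd k hk, dotProduct_zero]

/-- The matrix of coefficients of adj l is square and injective, so f ↦ f · adj l is a bijection
onto the polynomials of degree at most n. -/
theorem GoodVec.existsUnique {x : Fin 2 → Matrix (Fin (n + 1)) (Fin (n + 1)) K}
    {l : Fin (n + 1) → K} (h : GoodVec x l) {H : K[X]} (hH : H.degree < (n + 1 : ℕ)) :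
    ∃! f, cvec f ⬝ᵥ (pencil x).adjugate.mulVec (cvec l) = H := by
  set w := (pencil x).adjugate.mulVec (cvec l) with hw
  let M : Matrix (Fin (n + 1)) (Fin (n + 1)) K := Matrix.of fun k => vcoeff w k
  have hM : ∀ f, M.mulVec f = (fun k : Fin (n + 1) => H.coeff k) ↔ cvec f ⬝ᵥ w = H := by
    intro f
    constructor
    · intro h1
      ext k
      by_cases hk : k < n + 1
      · rw [coeff_cvec_dotProduct, dotProduct_comm]
        exact congrFun h1 ⟨k, hk⟩
      · rw [coeff_cvec_dotProduct, (degree_lt_iff_coeff_zero _ _).1 hH k (by omega)]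
        rw [show vcoeff w k = 0 from funext fun i => coeff_eq_zero_of_natDegree_lt
          ((natDegree_adjugate_mulVec_le x l i).trans_lt (by omega)), dotProduct_zero]
    · rintro rfl
      funext k
      rw [coeff_cvec_dotProduct, dotProduct_comm]
      rfl
  have hinj : Function.Injective M.mulVecLin := by
    rw [← LinearMap.ker_eq_bot, LinearMap.ker_eq_bot']
    intro c hc
    apply h c
    ext k
    by_cases hk : k < n + 1
    · rw [coeff_cvec_dotProduct, dotProduct_comm]
      exact congrFun hc ⟨k, hk⟩
    · rw [coeff_cvec_dotProduct, coeff_zero]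
      rw [show vcoeff w k = 0 from funext fun i => coeff_eq_zero_of_natDegree_lt
        ((natDegree_adjugate_mulVec_le x l i).trans_lt (by omega)), dotProduct_zero]
  obtain ⟨f, hf⟩ := (LinearMap.injective_iff_surjective.1 hinj) (fun k => H.coeff k)
  refine ⟨f, (hM f).1 hf, fun f' hf' => hinj ?_⟩
  rw [hf]
  exact (hM f').2 hf'

theorem card_goodVec_eq_card_pairs {x : Fin 2 → Matrix (Fin (n + 1)) (Fin (n + 1)) K}
    (hx : (pencil x).det ≠ 0) {H : K[X]} (hd : H.degree < (n + 1 : ℕ))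
    (hH : ∀ P' R : K[X], P'.degree < (n + 1 : ℕ) →
      R.degree < (n : ℕ) → (pencil x).det * R = P' * H → P' = 0) :
    Nat.card {l // GoodVec x l} = Nat.card {p : (Fin (n + 1) → K) × (Fin (n + 1) → K) //
      cvec p.2 ⬝ᵥ (pencil x).adjugate.mulVec (cvec p.1) = H} := by
  refine (Nat.card_congr (Equiv.ofBijective (fun p => ⟨p.1.1, goodVec_of_dotProduct_eq hx hH p.2⟩)
    ⟨?_, ?_⟩)).symm
  · rintro ⟨⟨l, f⟩, h⟩ ⟨⟨l', f'⟩, h'⟩ hll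
    simp only [Subtype.mk.injEq] at hll
    subst hll
    have := (goodVec_of_dotProduct_eq hx hH h).existsUnique hd
    exact Subtype.ext (Prod.ext rfl (this.unique h h'))
  · rintro ⟨l, hl⟩
    obtain ⟨f, hf, -⟩ := hl.existsUnique hd
    exact ⟨⟨(l, f), hf⟩, rfl⟩

/-- A good l has exactly one partner f with f · adj l = H, and l is good whenever a partner exists.
The equation is symmetric under transposition, and the determinant, hence the admissible H, is the
same for the transpose. -/
theorem card_goodVec_transpose (x : Fin 2 → Matrix (Fin n) (Fin n) K)
    (hx : (pencil x).det ≠ 0) :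
    Nat.card {l // GoodVec x l} = Nat.card {f // GoodVec (fun j => (x j).transpose) f} := by
  cases n with
  | zero =>
    refine Nat.card_congr (Equiv.subtypeEquivRight fun l => ?_)
    exact ⟨fun _ _ _ => Subsingleton.elim _ _, fun _ _ _ => Subsingleton.elim _ _⟩
  | succ n =>
    obtain ⟨H, hd, hH⟩ := exists_coprime hx (natDegree_det_pencil_le x)
    have hdet : (pencil fun j => (x j).transpose).det = (pencil x).det := by
      rw [pencil_transpose, Matrix.det_transpose]
    rw [card_goodVec_eq_card_pairs hx hd hH,
      card_goodVec_eq_card_pairs (by rwa [hdet]) hd (by rwa [hdet])]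
    exact Nat.card_congr ((Equiv.prodComm _ _).subtypeEquiv fun p => by
      rw [Equiv.prodComm_apply, Prod.fst_swap, Prod.snd_swap, dotProduct_adjugate_transpose])

end GoodVec

namespace KRep

open Polynomial

/-! ### Subrepresentations and quotients of representations given by matrices -/

section Frames

variable {K : Type u} [Field K] {n : ℕ}

/-- Coordinates on a subrepresentation: the inclusions become matrices with left inverses, so that
the identities can be used over K[X]. `Sub.exists_quot_matrix` does the same for quotients, with
right inverses of the projections. -/
theorem Sub.exists_rep_matrix {x : Fin 2 → Matrix (Fin n) (Fin n) K} (W : Sub (matRep x))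
    {m₀ m₁ : ℕ} (h : W.rep.dim = (m₀, m₁)) :
    ∃ (x' : Fin 2 → Matrix (Fin m₁) (Fin m₀) K) (a : (Fin m₀ → K) ≃ₗ[K] W.W₀)
      (b : (Fin m₁ → K) ≃ₗ[K] W.W₁) (i₀ : Matrix (Fin n) (Fin m₀) K)
      (r₀ : Matrix (Fin m₀) (Fin n) K) (i₁ : Matrix (Fin n) (Fin m₁) K)
      (r₁ : Matrix (Fin m₁) (Fin n) K),
      (∀ j v, b ((x' j).mulVec v) = W.rep.x j (a v)) ∧
      (∀ v, (a v : Fin n → K) = i₀.mulVec v) ∧ (∀ v, (b v : Fin n → K) = i₁.mulVec v) ∧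
      r₀ * i₀ = 1 ∧ r₁ * i₁ = 1 ∧ ∀ j, x j * i₀ = i₁ * x' j := by
  obtain ⟨x', a, b, hab⟩ := W.rep.exists_iso_matRep h
  have aux : ∀ {m : ℕ} (S : Submodule K (Fin n → K)) (e : (Fin m → K) ≃ₗ[K] S),
      ∃ (i : Matrix (Fin n) (Fin m) K) (r : Matrix (Fin m) (Fin n) K),
        (∀ v, (e v : Fin n → K) = i.mulVec v) ∧ r * i = 1 := by
    intro m S e
    obtain ⟨g, hg⟩ := (S.subtype ∘ₗ e.toLinearMap).exists_leftInverse_of_injective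
      (LinearMap.ker_eq_bot.2 (S.injective_subtype.comp e.injective))
    refine ⟨LinearMap.toMatrix' (S.subtype ∘ₗ e.toLinearMap), LinearMap.toMatrix' g,
      fun v => ?_, ?_⟩
    · rw [LinearMap.toMatrix'_mulVec]
      rfl
    · rw [← LinearMap.toMatrix'_comp, hg, LinearMap.toMatrix'_id]
  obtain ⟨i₀, r₀, hi₀, hr₀⟩ := aux W.W₀ a
  obtain ⟨i₁, r₁, hi₁, hr₁⟩ := aux W.W₁ b
  refine ⟨x', a, b, i₀, r₀, i₁, r₁, hab, hi₀, hi₁, hr₀, hr₁, fun j => ?_⟩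
  refine Matrix.mulVec_injective (funext fun v => ?_)
  rw [← Matrix.mulVec_mulVec, ← Matrix.mulVec_mulVec, ← hi₀, ← hi₁]
  exact (congrArg Subtype.val (hab j v)).symm

theorem Sub.exists_quot_matrix {x : Fin 2 → Matrix (Fin n) (Fin n) K} (W : Sub (matRep x))
    {m₀ m₁ : ℕ} (h : W.quot.dim = (m₀, m₁)) :
    ∃ (x' : Fin 2 → Matrix (Fin m₁) (Fin m₀) K) (p₀ : Matrix (Fin m₀) (Fin n) K)
      (s₀ : Matrix (Fin n) (Fin m₀) K) (p₁ : Matrix (Fin m₁) (Fin n) K)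
      (s₁ : Matrix (Fin n) (Fin m₁) K), Iso (matRep x') W.quot ∧
      (∀ v, p₀.mulVec v = 0 ↔ v ∈ W.W₀) ∧ (∀ v, p₁.mulVec v = 0 ↔ v ∈ W.W₁) ∧
      p₀ * s₀ = 1 ∧ p₁ * s₁ = 1 ∧ ∀ j, p₁ * x j = x' j * p₀ := by
  obtain ⟨x', a, b, hab⟩ := W.quot.exists_iso_matRep h
  have aux : ∀ {m : ℕ} (S : Submodule K (Fin n → K)) (e : (Fin m → K) ≃ₗ[K] ((Fin n → K) ⧸ S)),
      ∃ (p : Matrix (Fin m) (Fin n) K) (s : Matrix (Fin n) (Fin m) K),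
        (∀ v, e (p.mulVec v) = S.mkQ v) ∧ p * s = 1 := by
    intro m S e
    obtain ⟨g, hg⟩ := (e.symm.toLinearMap ∘ₗ S.mkQ).exists_rightInverse_of_surjective
      (LinearMap.range_eq_top.2 (e.symm.surjective.comp S.mkQ_surjective))
    refine ⟨LinearMap.toMatrix' (e.symm.toLinearMap ∘ₗ S.mkQ), LinearMap.toMatrix' g,
      fun v => ?_, ?_⟩
    · rw [LinearMap.toMatrix'_mulVec]
      exact e.apply_symm_apply _
    · rw [← LinearMap.toMatrix'_comp, hg, LinearMap.toMatrix'_id]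
  obtain ⟨p₀, s₀, hp₀, hs₀⟩ := aux W.W₀ a
  obtain ⟨p₁, s₁, hp₁, hs₁⟩ := aux W.W₁ b
  refine ⟨x', p₀, s₀, p₁, s₁, ⟨a, b, hab⟩, fun v => ?_, fun v => ?_, hs₀, hs₁, fun j => ?_⟩
  · rw [← Submodule.Quotient.mk_eq_zero, ← a.map_eq_zero_iff]
    exact Eq.congr_left (hp₀ v)
  · rw [← Submodule.Quotient.mk_eq_zero, ← b.map_eq_zero_iff]
    exact Eq.congr_left (hp₁ v)
  · refine Matrix.mulVec_injective (funext fun v => ?_)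
    rw [← Matrix.mulVec_mulVec, ← Matrix.mulVec_mulVec]
    apply b.injective
    refine (hp₁ _).trans (Eq.trans ?_ (hab j (p₀.mulVec v)).symm)
    exact (congrArg (W.quot.x j) (hp₀ v)).symm

theorem map_C_mul_eq_one {m l : ℕ} {r : Matrix (Fin m) (Fin l) K} {i : Matrix (Fin l) (Fin m) K}
    (h : r * i = 1) : r.map C * i.map C = 1 := by
  rw [← Matrix.map_mul, h, Matrix.map_one _ C_0 C_1]

/-- A kernel vector of the smaller pencil over K[X] is carried by the injective i₀ to a kernel
vector of the larger one. -/
theorem det_pencil_ne_zero_of_rep {m : ℕ} {x : Fin 2 → Matrix (Fin n) (Fin n) K}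
    (hx : (pencil x).det ≠ 0) {x' : Fin 2 → Matrix (Fin m) (Fin m) K}
    {i₀ i₁ : Matrix (Fin n) (Fin m) K} {r₀ : Matrix (Fin m) (Fin n) K} (hr₀ : r₀ * i₀ = 1)
    (h : ∀ j, x j * i₀ = i₁ * x' j) : (pencil x').det ≠ 0 := by
  intro h0
  obtain ⟨w, hw, hw0⟩ := Matrix.exists_mulVec_eq_zero_iff.2 h0
  apply hw
  have h1 : (pencil x).mulVec ((i₀.map C).mulVec w) = 0 := by
    rw [Matrix.mulVec_mulVec, pencil_mul_map]
    simp only [h]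
    rw [← map_mul_pencil, ← Matrix.mulVec_mulVec, hw0, Matrix.mulVec_zero]
  have h2 := congrArg (r₀.map C).mulVec (Matrix.eq_zero_of_mulVec_eq_zero hx h1)
  rwa [Matrix.mulVec_mulVec, map_C_mul_eq_one hr₀, Matrix.one_mulVec, Matrix.mulVec_zero] at h2

theorem det_pencil_transpose (x : Fin 2 → Matrix (Fin n) (Fin n) K) :
    (pencil fun j => (x j).transpose).det = (pencil x).det := by
  rw [pencil_transpose, Matrix.det_transpose]

theorem det_pencil_ne_zero_of_quot {m : ℕ} {x : Fin 2 → Matrix (Fin n) (Fin n) K}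
    (hx : (pencil x).det ≠ 0) {x' : Fin 2 → Matrix (Fin m) (Fin m) K}
    {p₀ p₁ : Matrix (Fin m) (Fin n) K} {s₁ : Matrix (Fin n) (Fin m) K} (hs₁ : p₁ * s₁ = 1)
    (h : ∀ j, p₁ * x j = x' j * p₀) : (pencil x').det ≠ 0 := by
  rw [← det_pencil_transpose] at hx ⊢
  refine det_pencil_ne_zero_of_rep (i₀ := p₁.transpose) (i₁ := p₀.transpose)
    (r₀ := s₁.transpose) hx ?_ fun j => ?_
  · rw [← Matrix.transpose_mul, hs₁, Matrix.transpose_one]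
  · rw [← Matrix.transpose_mul, h, Matrix.transpose_mul]

variable {x : Fin 2 → Matrix (Fin n) (Fin n) K}

theorem Sub.rep_isRegular (W : Sub (matRep x)) (hx : (pencil x).det ≠ 0)
    (h : W.rep.dim.1 = W.rep.dim.2) : W.rep.IsRegular := by
  obtain ⟨x', a, b, i₀, r₀, i₁, r₁, hab, -, -, hr₀, -, hxi⟩ :=
    W.exists_rep_matrix (Prod.ext rfl h.symm : W.rep.dim = (W.rep.dim.1, W.rep.dim.1))
  have hi : Iso (matRep x') W.rep := ⟨a, b, hab⟩
  exact hi.isRegular.1 ((isRegular_matRep_iff x').2 (det_pencil_ne_zero_of_rep hx hr₀ hxi))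

theorem Sub.quot_isRegular (W : Sub (matRep x)) (hx : (pencil x).det ≠ 0)
    (h : W.quot.dim.1 = W.quot.dim.2) : W.quot.IsRegular := by
  obtain ⟨x', p₀, s₀, p₁, s₁, hi, -, -, -, hs₁, hxp⟩ :=
    W.exists_quot_matrix (Prod.ext rfl h.symm : W.quot.dim = (W.quot.dim.1, W.quot.dim.1))
  exact hi.isRegular.1 ((isRegular_matRep_iff x').2 (det_pencil_ne_zero_of_quot hx hs₁ hxp))

/-- An extension of regular representations is regular: a kernel vector over K[X] dies in the
quotient, so its coefficients lie in W₀, and it then comes from a kernel vector of the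
subrepresentation. -/
theorem Sub.det_pencil_ne_zero (W : Sub (matRep x)) (h : W.rep.IsRegular)
    (h' : W.quot.IsRegular) : (pencil x).det ≠ 0 := by
  obtain ⟨y, a, b, i₀, r₀, i₁, r₁, hab, ha, -, hr₀, hr₁, hxi⟩ :=
    W.exists_rep_matrix (Prod.ext rfl h.dim_eq.symm : W.rep.dim = (W.rep.dim.1, W.rep.dim.1))
  obtain ⟨z, p₀, s₀, p₁, s₁, hi', hp₀, -, -, -, hxp⟩ :=
    W.exists_quot_matrix (Prod.ext rfl h'.dim_eq.symm : W.quot.dim = (W.quot.dim.1, W.quot.dim.1))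
  have hi : Iso (matRep y) W.rep := ⟨a, b, hab⟩
  replace h := (isRegular_matRep_iff y).1 (hi.isRegular.2 h)
  replace h' := (isRegular_matRep_iff z).1 (hi'.isRegular.2 h')
  intro h0
  obtain ⟨w, hw, hw0⟩ := Matrix.exists_mulVec_eq_zero_iff.2 h0
  have h1 : (p₀.map C).mulVec w = 0 := by
    refine Matrix.eq_zero_of_mulVec_eq_zero h' ?_
    rw [Matrix.mulVec_mulVec, pencil_mul_map]
    simp only [← hxp]
    rw [← map_mul_pencil, ← Matrix.mulVec_mulVec, hw0, Matrix.mulVec_zero]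
  have h2 : (i₀.map C).mulVec ((r₀.map C).mulVec w) = w := by
    refine vcoeff_ext fun k => ?_
    rw [vcoeff_map_mulVec, vcoeff_map_mulVec]
    have hk : vcoeff w k ∈ W.W₀ := by
      rw [← hp₀, ← vcoeff_map_mulVec, h1, vcoeff_zero]
    obtain ⟨u, hu⟩ := a.surjective ⟨_, hk⟩
    have hu' : i₀.mulVec u = vcoeff w k := (ha u).symm.trans (congrArg Subtype.val hu)
    rw [← hu', Matrix.mulVec_mulVec, Matrix.mulVec_mulVec, Matrix.mul_assoc,
      hr₀, Matrix.mul_one]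
  have h3 : (r₀.map C).mulVec w = 0 := by
    refine Matrix.eq_zero_of_mulVec_eq_zero h ?_
    have h4 : (i₁.map C).mulVec ((pencil y).mulVec ((r₀.map C).mulVec w)) = 0 := by
      rw [Matrix.mulVec_mulVec, map_mul_pencil]
      simp only [← hxi]
      rw [← pencil_mul_map, ← Matrix.mulVec_mulVec, h2, hw0]
    have h5 := congrArg (r₁.map C).mulVec h4
    rwa [Matrix.mulVec_mulVec, map_C_mul_eq_one hr₁, Matrix.one_mulVec, Matrix.mulVec_zero] at h5
  rw [h3, Matrix.mulVec_zero] at h2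
  exact hw h2.symm

end Frames

/-! ### Cyclic vectors of a representation -/

section Good

variable {K : Type u} [Field K]

/-- The quotient of the representation by the line spanned by `l` has the generic form. -/
def Good (M : KRep K) (l : M.V₁) : Prop :=
  l ≠ 0 ∧ NoChain (fun j => (Submodule.span K {l}).mkQ ∘ₗ M.x j) (M.dim.2 - 1)

theorem Good.map {M N : KRep K} (a : M.V₀ ≃ₗ[K] N.V₀) (b : M.V₁ ≃ₗ[K] N.V₁)
    (h : ∀ j v, b (M.x j v) = N.x j (a v)) {l : M.V₁} (hl : M.Good l) : N.Good (b l) := by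
  refine ⟨fun h0 => hl.1 (b.map_eq_zero_iff.1 h0), ?_⟩
  have hs : (Submodule.span K {l}).map b.toLinearMap = Submodule.span K {b l} := by
    rw [Submodule.map_span, Set.image_singleton]
    rfl
  have hd : N.dim.2 = M.dim.2 := by rw [Iso.dim_eq ⟨a, b, h⟩]
  rw [hd]
  refine hl.2.comp_injective a.symm.toLinearMap
    (Submodule.Quotient.equiv _ _ b hs).symm.toLinearMap a.symm.injective fun j u => ?_
  rw [LinearEquiv.coe_coe, LinearEquiv.symm_apply_eq]
  refine congrArg (Submodule.mkQ _) (?_ : N.x j u = b (M.x j (a.symm u)))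
  rw [h, LinearEquiv.apply_symm_apply]

theorem good_map_iff {M N : KRep K} (a : M.V₀ ≃ₗ[K] N.V₀) (b : M.V₁ ≃ₗ[K] N.V₁)
    (h : ∀ j v, b (M.x j v) = N.x j (a v)) {l : M.V₁} : N.Good (b l) ↔ M.Good l := by
  refine ⟨fun hl => ?_, fun hl => hl.map a b h⟩
  have := hl.map a.symm b.symm fun j v => by
    rw [LinearEquiv.symm_apply_eq, h, LinearEquiv.apply_symm_apply]
  rwa [LinearEquiv.symm_apply_apply] at this

/-- The number of cyclic vectors. -/
def goodCard (M : KRep K) : ℕ := Nat.card {l : M.V₁ // M.Good l}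

theorem Iso.goodCard_eq {M N : KRep K} (h : Iso M N) : M.goodCard = N.goodCard := by
  obtain ⟨a, b, h⟩ := h
  exact Nat.card_congr (b.toEquiv.subtypeEquiv fun l => (good_map_iff a b h).symm)

theorem good_matRep_iff {n : ℕ} {x : Fin 2 → Matrix (Fin (n + 1)) (Fin (n + 1)) K}
    (hx : (pencil x).det ≠ 0) (l : Fin (n + 1) → K) : (matRep x).Good l ↔ GoodVec x l := by
  rw [goodVec_iff x hx, Good, matRep_dim, Nat.add_sub_cancel]

theorem goodCard_matRep_transpose {n : ℕ} (x : Fin 2 → Matrix (Fin n) (Fin n) K)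
    (hx : (pencil x).det ≠ 0) :
    (matRep x).goodCard = (matRep fun j => (x j).transpose).goodCard := by
  cases n with
  | zero =>
    exact Nat.card_congr (Equiv.subtypeEquivRight fun l =>
      ⟨fun h => absurd (Subsingleton.elim l 0) h.1, fun h => absurd (Subsingleton.elim l 0) h.1⟩)
  | succ n =>
    have h := card_goodVec_transpose x hx
    rw [← Nat.card_congr (Equiv.subtypeEquivRight fun l => good_matRep_iff hx l),
      ← Nat.card_congr (Equiv.subtypeEquivRight fun l =>
        good_matRep_iff (by rwa [det_pencil_transpose]) l)] at h
    exact h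

end Good

end KRep

/-! ### The subrepresentation generated by a vector. -/

namespace KRep

open Polynomial

section Gen

variable {K : Type u} [Field K] {n : ℕ}

/-- A subspace of `K ^ n` is cut out by linear forms. -/
theorem le_of_dotProduct {S T : Submodule K (Fin n → K)}
    (h : ∀ d : Fin n → K, (∀ t ∈ T, d ⬝ᵥ t = 0) → ∀ s ∈ S, d ⬝ᵥ s = 0) : S ≤ T := by
  intro s hs
  by_contra hsT
  obtain ⟨f, hf, hT⟩ := T.exists_le_ker_of_notMem hsT
  have key : ∀ v, (fun i => f (Pi.single i 1)) ⬝ᵥ v = f v := by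
    intro v
    rw [LinearMap.pi_apply_eq_sum_univ f v]
    refine Finset.sum_congr rfl fun i _ => ?_
    rw [smul_eq_mul, mul_comm]
    refine congrArg (v i * ·) (congrArg f (funext fun j => ?_))
    simp [Pi.single_apply, eq_comm]
  refine hf ?_
  rw [← key]
  exact h _ (fun t ht => (key t).trans (hT ht)) s hs

theorem exists_frame (S : Submodule K (Fin n → K)) :
    ∃ (i : Matrix (Fin n) (Fin (Module.finrank K S)) K)
      (r : Matrix (Fin (Module.finrank K S)) (Fin n) K),
      r * i = 1 ∧ (∀ v, i.mulVec v ∈ S) ∧ ∀ s ∈ S, i.mulVec (r.mulVec s) = s := by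
  let e := (Module.finBasis K S).equivFun.symm
  obtain ⟨g, hg⟩ := (S.subtype ∘ₗ e.toLinearMap).exists_leftInverse_of_injective
    (LinearMap.ker_eq_bot.2 (S.injective_subtype.comp e.injective))
  have hi : ∀ v, (LinearMap.toMatrix' (S.subtype ∘ₗ e.toLinearMap)).mulVec v = e v := fun v => by
    rw [LinearMap.toMatrix'_mulVec]
    rfl
  refine ⟨LinearMap.toMatrix' (S.subtype ∘ₗ e.toLinearMap), LinearMap.toMatrix' g, ?_,
    fun v => ?_, fun s hs => ?_⟩
  · rw [← LinearMap.toMatrix'_comp, hg, LinearMap.toMatrix'_id]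
  · rw [hi]
    exact (e v).2
  · obtain ⟨v, hv⟩ := e.surjective ⟨s, hs⟩
    have hs' : (S.subtype ∘ₗ e.toLinearMap) v = s := congrArg Subtype.val hv
    have h1 : g s = v := by
      rw [← hs']
      exact LinearMap.congr_fun hg v
    rw [hi, LinearMap.toMatrix'_mulVec, h1, hv]

/-- A polynomial family of injective maps that sends `S` into `T`. -/
theorem finrank_le_of_vcoeff_mem {B : Matrix (Fin n) (Fin n) K[X]} (hB : B.det ≠ 0)
    {S T : Submodule K (Fin n → K)} (h : ∀ s ∈ S, ∀ k, vcoeff (B.mulVec (cvec s)) k ∈ T) :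
    Module.finrank K S ≤ Module.finrank K T := by
  obtain ⟨i, r, hr, hi, -⟩ := exists_frame S
  obtain ⟨i', r', hr', -, hi'⟩ := exists_frame T
  have hT : ∀ w : Fin n → K[X], (∀ k, vcoeff w k ∈ T) →
      (i'.map C).mulVec ((r'.map C).mulVec w) = w := fun w hw => vcoeff_ext fun k => by
    rw [vcoeff_map_mulVec, vcoeff_map_mulVec, hi' _ (hw k)]
  have hmem : ∀ (w : Fin (Module.finrank K S) → K[X]) (k),
      vcoeff (B.mulVec ((i.map C).mulVec w)) k ∈ T := by
    intro w k
    have hw : (i.map C).mulVec w = ∑ j, w j • cvec (fun a => i a j) := by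
      funext a
      simp [cvec, Matrix.mulVec, dotProduct, mul_comm]
    have hcol : ∀ j, (fun a => i a j) ∈ S := fun j => by
      have := hi (Pi.single j 1)
      rwa [Matrix.mulVec_single_one] at this
    rw [hw, Matrix.mulVec_sum]
    have hk : vcoeff (∑ j, B.mulVec (w j • cvec fun a => i a j)) k =
        ∑ j, vcoeff (B.mulVec (w j • cvec fun a => i a j)) k := by
      funext a
      simp [vcoeff, finsetSum_coeff]
    rw [hk]
    refine sum_mem fun j _ => ?_
    have hj : vcoeff (B.mulVec (w j • cvec fun a => i a j)) k =
        ∑ ab ∈ Finset.HasAntidiagonal.antidiagonal k, (w j).coeff ab.1 •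
          vcoeff (B.mulVec (cvec fun a => i a j)) ab.2 := by
      funext a
      simp [vcoeff, coeff_mul, Matrix.mulVec_smul]
    rw [hj]
    exact sum_mem fun ab _ => Submodule.smul_mem _ _ (h _ (hcol j) _)
  -- B restricted to S[X] → T[X], in coordinates; it is injective over K[X], which bounds the rank.
  let G : Matrix (Fin (Module.finrank K T)) (Fin (Module.finrank K S)) K[X] :=
    r'.map C * B * i.map C
  have hG : Function.Injective G.mulVecLin := by
    rw [← LinearMap.ker_eq_bot, LinearMap.ker_eq_bot']
    intro w hw
    have h1 : (r'.map C).mulVec (B.mulVec ((i.map C).mulVec w)) = 0 := by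
      rw [Matrix.mulVec_mulVec, Matrix.mulVec_mulVec]
      exact hw
    have h2 := hT _ (hmem w)
    rw [h1, Matrix.mulVec_zero] at h2
    have h3 := Matrix.eq_zero_of_mulVec_eq_zero hB h2.symm
    have h4 := congrArg (r.map C).mulVec h3
    rwa [Matrix.mulVec_mulVec, map_C_mul_eq_one hr, Matrix.one_mulVec, Matrix.mulVec_zero] at h4
  simpa using LinearMap.finrank_le_finrank_of_injective hG

variable (x : Fin 2 → Matrix (Fin n) (Fin n) K) (l : Fin n → K)

/-- The coefficients of `adj (x 0 + X x 1) l`. -/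
def adjCoeff (k : ℕ) : Fin n → K := vcoeff ((pencil x).adjugate.mulVec (cvec l)) k

/-- The subrepresentation generated by a vector, of a representation given by square matrices. -/
def genSub : Sub (matRep x) where
  W₀ := Submodule.span K (Set.range (adjCoeff x l))
  W₁ := Submodule.span K {l} ⊔ ⨆ j, (Submodule.span K (Set.range (adjCoeff x l))).map
    (x j).mulVecLin
  stable j := by
    rw [← Submodule.map_le_iff_le_comap]
    exact (le_iSup (fun j => (Submodule.span K (Set.range (adjCoeff x l))).map
      (x j).mulVecLin) j).trans le_sup_right

theorem adjugate_mulVec_pencil (w : Fin n → K[X]) :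
    (pencil x).adjugate.mulVec ((pencil x).mulVec w) = (pencil x).det • w := by
  rw [Matrix.mulVec_mulVec, Matrix.adjugate_mul, Matrix.smul_mulVec, Matrix.one_mulVec]

theorem pencil_mulVec_adjugate (w : Fin n → K[X]) :
    (pencil x).mulVec ((pencil x).adjugate.mulVec w) = (pencil x).det • w := by
  rw [Matrix.mulVec_mulVec, Matrix.mul_adjugate, Matrix.smul_mulVec, Matrix.one_mulVec]

theorem cvec_add (v w : Fin n → K) : cvec (v + w) = cvec v + cvec w :=
  funext fun _ => C_add

theorem cvec_smul (c : K) (v : Fin n → K) : cvec (c • v) = C c • cvec v :=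
  funext fun _ => C_mul

theorem adjCoeff_add (v w : Fin n → K) (k : ℕ) :
    adjCoeff x (v + w) k = adjCoeff x v k + adjCoeff x w k := by
  rw [adjCoeff, cvec_add, Matrix.mulVec_add, vcoeff_add]
  rfl

theorem adjCoeff_smul (c : K) (v : Fin n → K) (k : ℕ) :
    adjCoeff x (c • v) k = c • adjCoeff x v k := by
  rw [adjCoeff, cvec_smul, Matrix.mulVec_smul]
  funext i
  simp [vcoeff, adjCoeff]

theorem mulVec_adjCoeff_succ (k : ℕ) :
    (x 0).mulVec (adjCoeff x l (k + 1)) + (x 1).mulVec (adjCoeff x l k) =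
      (pencil x).det.coeff (k + 1) • l := by
  rw [adjCoeff, adjCoeff, ← vcoeff_pencil_succ, pencil_mulVec_adjugate, vcoeff_smul_cvec]

theorem adjCoeff_mulVec_zero (v : Fin n → K) :
    adjCoeff x ((x 0).mulVec v) 0 = (pencil x).det.coeff 0 • v := by
  rw [← vcoeff_smul_cvec, ← adjugate_mulVec_pencil, pencil_mulVec, map_mulVec_cvec,
    map_mulVec_cvec, Matrix.mulVec_add, Matrix.mulVec_smul, vcoeff_add]
  refine (add_eq_left.2 ?_).symm
  funext i
  simp [vcoeff]

theorem adjCoeff_mulVec_succ (v : Fin n → K) (k : ℕ) :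
    adjCoeff x ((x 0).mulVec v) (k + 1) + adjCoeff x ((x 1).mulVec v) k =
      (pencil x).det.coeff (k + 1) • v := by
  rw [← vcoeff_smul_cvec, ← adjugate_mulVec_pencil, pencil_mulVec, map_mulVec_cvec,
    map_mulVec_cvec, Matrix.mulVec_add, Matrix.mulVec_smul, vcoeff_add]
  congr 1
  funext i
  simp [vcoeff, adjCoeff]

/-- The two identities pencil · adj = det and adj · pencil = det trade x 1 for x 0 on either side of
the adjugate. Modulo the span this replaces (j + 1, k) by (j, k + 1), whence the induction on j for
all k. -/
theorem adjCoeff_mulVec_one_mem (j k : ℕ) :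
    adjCoeff x ((x 1).mulVec (adjCoeff x l k)) j ∈
      Submodule.span K (Set.range (adjCoeff x l)) := by
  have hv : ∀ k, adjCoeff x l k ∈ Submodule.span K (Set.range (adjCoeff x l)) := fun k =>
    Submodule.subset_span ⟨k, rfl⟩
  induction j generalizing k with
  | zero =>
    rw [eq_sub_of_add_eq' (mulVec_adjCoeff_succ x l k), sub_eq_add_neg, ← neg_one_smul K,
      adjCoeff_add, adjCoeff_smul, adjCoeff_smul, adjCoeff_mulVec_zero]
    exact add_mem (Submodule.smul_mem _ _ (hv _))
      (Submodule.smul_mem _ _ (Submodule.smul_mem _ _ (hv _)))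
  | succ j ih =>
    rw [eq_sub_of_add_eq' (mulVec_adjCoeff_succ x l k), sub_eq_add_neg, ← neg_one_smul K,
      adjCoeff_add, adjCoeff_smul, adjCoeff_smul,
      eq_sub_of_add_eq (adjCoeff_mulVec_succ x (adjCoeff x l (k + 1)) j)]
    exact add_mem (Submodule.smul_mem _ _ (hv _)) (Submodule.smul_mem _ _
      (sub_mem (Submodule.smul_mem _ _ (hv _)) (ih _)))

/-- The adjugate sends W₁ back into W₀[X]; this is the inequality of dimensions opposite to
`Sub.finrank_le`. -/
theorem adjCoeff_mem_of_mem {u : Fin n → K} (hu : u ∈ (genSub x l).W₁) (k : ℕ) :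
    adjCoeff x u k ∈ (genSub x l).W₀ := by
  let T : Submodule K (Fin n → K) :=
    { carrier := {u | ∀ k, adjCoeff x u k ∈ (genSub x l).W₀}
      add_mem' := fun {a b} ha hb k => by
        rw [adjCoeff_add]
        exact add_mem (ha k) (hb k)
      zero_mem' := fun k => by
        rw [← zero_smul K (0 : Fin n → K), adjCoeff_smul, zero_smul]
        exact zero_mem _
      smul_mem' := fun c a ha k => by
        rw [adjCoeff_smul]
        exact Submodule.smul_mem _ _ (ha k) }
  have hv : ∀ k, adjCoeff x l k ∈ (genSub x l).W₀ := fun k => Submodule.subset_span ⟨k, rfl⟩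
  suffices h : (genSub x l).W₁ ≤ T from h hu k
  refine sup_le ?_ (iSup_le fun j => ?_)
  · rw [Submodule.span_singleton_le_iff_mem]
    exact hv
  · rw [Submodule.map_span, Submodule.span_le]
    rintro _ ⟨_, ⟨k, rfl⟩, rfl⟩ i
    obtain rfl | rfl : j = 0 ∨ j = 1 := by omega
    · cases i with
      | zero =>
        rw [Matrix.mulVecLin_apply, adjCoeff_mulVec_zero]
        exact Submodule.smul_mem _ _ (hv k)
      | succ i =>
        rw [Matrix.mulVecLin_apply, eq_sub_of_add_eq (adjCoeff_mulVec_succ x (adjCoeff x l k) i)]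
        exact sub_mem (Submodule.smul_mem _ _ (hv _)) (adjCoeff_mulVec_one_mem x l i k)
    · exact adjCoeff_mulVec_one_mem x l i k

variable {x}

/-- The pencil itself is an injective map from W₀[X] to W₁[X]. -/
theorem Sub.finrank_le (W : Sub (matRep x)) (hx : (pencil x).det ≠ 0) :
    Module.finrank K W.W₀ ≤ Module.finrank K W.W₁ := by
  refine finrank_le_of_vcoeff_mem (S := W.W₀) (T := W.W₁) hx fun s hs k => ?_
  rw [pencil_mulVec, vcoeff_add, map_mulVec_cvec, map_mulVec_cvec]
  have h0 : (x 0).mulVec s ∈ W.W₁ := W.stable 0 hs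
  have h1 : (x 1).mulVec s ∈ W.W₁ := W.stable 1 hs
  have key : ∀ (p : K[X]) (u : Fin n → K), u ∈ W.W₁ → vcoeff (p • cvec u) k ∈ W.W₁ := by
    intro p u hu
    rw [vcoeff_smul_cvec]
    exact Submodule.smul_mem _ _ hu
  have h2 := key 1 _ h0
  rw [one_smul] at h2
  exact add_mem h2 (key X _ h1)

theorem genSub_dim (hx : (pencil x).det ≠ 0) :
    (genSub x l).rep.dim.1 = (genSub x l).rep.dim.2 := by
  refine le_antisymm ((genSub x l).finrank_le hx) ?_
  refine finrank_le_of_vcoeff_mem (S := (genSub x l).W₁) (T := (genSub x l).W₀)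
    (B := (pencil x).adjugate) ?_ fun s hs k => adjCoeff_mem_of_mem x l hs k
  rw [Matrix.det_adjugate]
  exact pow_ne_zero _ hx

theorem mem_genSub : l ∈ (genSub x l).W₁ :=
  Submodule.mem_sup_left (Submodule.mem_span_singleton_self l)

variable {l}

/-- Cyclicity inside W says that the adjugate of the restricted pencil y, applied to l, has
coefficients spanning W₀. Up to non-zero scalar polynomials it is the same vector as adj l for x, so
the same linear forms annihilate both. -/
theorem Sub.good_iff (W : Sub (matRep x)) (hx : (pencil x).det ≠ 0)
    (hW : W.rep.dim.1 = W.rep.dim.2) (hl : l ≠ 0) (h : l ∈ W.W₁) :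
    W.rep.Good (⟨l, h⟩ : W.W₁) ↔ W.W₀ = (genSub x l).W₀ := by
  obtain ⟨m, hm⟩ : ∃ m, W.rep.dim.1 = m + 1 := by
    refine Nat.exists_eq_succ_of_ne_zero fun h0 => hl ?_
    rw [hW] at h0
    have : W.W₁ = ⊥ := Submodule.finrank_eq_zero.1 h0
    rw [this] at h
    exact h
  obtain ⟨y, a, b, i₀, r₀, i₁, r₁, hab, ha, hb, hr₀, -, hxi⟩ :=
    W.exists_rep_matrix (Prod.ext hm (hW.symm.trans hm) : W.rep.dim = (m + 1, m + 1))
  have hy := det_pencil_ne_zero_of_rep hx hr₀ hxi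
  obtain ⟨l', hl'⟩ := b.surjective ⟨l, h⟩
  have hil : i₁.mulVec l' = l := (hb l').symm.trans (congrArg Subtype.val hl')
  have hg : W.rep.Good (⟨l, h⟩ : W.W₁) ↔ GoodVec y l' := by
    rw [← good_matRep_iff hy, ← hl']
    exact good_map_iff (M := matRep y) (N := W.rep) a b hab
  -- Both sides have the image det x · det y · l under the pencil of x.
  have key : (pencil x).det • (i₀.map C).mulVec ((pencil y).adjugate.mulVec (cvec l')) =
      (pencil y).det • (pencil x).adjugate.mulVec (cvec l) := by
    rw [← adjugate_mulVec_pencil, Matrix.mulVec_mulVec _ (pencil x), pencil_mul_map]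
    simp only [hxi]
    rw [← map_mul_pencil, ← Matrix.mulVec_mulVec, pencil_mulVec_adjugate, Matrix.mulVec_smul,
      map_mulVec_cvec, hil, Matrix.mulVec_smul]
  have keyd : ∀ d : Fin n → K, (pencil x).det *
      (cvec (i₀.transpose.mulVec d) ⬝ᵥ (pencil y).adjugate.mulVec (cvec l')) =
      (pencil y).det * (cvec d ⬝ᵥ (pencil x).adjugate.mulVec (cvec l)) := by
    intro d
    have := congrArg (cvec d ⬝ᵥ ·) key
    simp only [dotProduct_smul, smul_eq_mul] at this
    rw [← this, ← map_mulVec_cvec, Matrix.transpose_map, Matrix.mulVec_transpose,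
      ← Matrix.dotProduct_mulVec]
  have hW₀ : ∀ d : Fin n → K, i₀.transpose.mulVec d = 0 ↔ ∀ t ∈ W.W₀, d ⬝ᵥ t = 0 := by
    intro d
    constructor
    · intro hd t ht
      obtain ⟨v, hv⟩ := a.surjective ⟨t, ht⟩
      have hv' : i₀.mulVec v = t := (ha v).symm.trans (congrArg Subtype.val hv)
      rw [← hv', Matrix.dotProduct_mulVec, ← Matrix.mulVec_transpose, hd, zero_dotProduct]
    · intro hd
      refine dotProduct_eq_zero _ fun v => ?_
      rw [Matrix.mulVec_transpose, ← Matrix.dotProduct_mulVec]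
      refine hd _ ?_
      have := (a v).2
      rwa [ha] at this
  have hgen : ∀ d : Fin n → K, cvec d ⬝ᵥ (pencil x).adjugate.mulVec (cvec l) = 0 ↔
      ∀ t ∈ (genSub x l).W₀, d ⬝ᵥ t = 0 := by
    intro d
    constructor
    · intro hd t ht
      induction ht using Submodule.span_induction with
      | mem t ht =>
        obtain ⟨k, rfl⟩ := ht
        rw [adjCoeff, ← coeff_cvec_dotProduct, hd, coeff_zero]
      | zero => exact dotProduct_zero _
      | add s t _ _ hs ht => rw [dotProduct_add, hs, ht, add_zero]
      | smul c s _ hs => rw [dotProduct_smul, hs, smul_zero]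
    · intro hd
      ext k
      rw [coeff_cvec_dotProduct, coeff_zero]
      exact hd _ (Submodule.subset_span ⟨k, rfl⟩)
  rw [hg]
  constructor
  · intro hgood
    refine le_antisymm (le_of_dotProduct fun d hd => ?_) (le_of_dotProduct fun d hd => ?_)
    · rw [← hW₀]
      have h1 := keyd d
      rw [(hgen d).2 hd, mul_zero] at h1
      exact hgood _ ((mul_eq_zero.1 h1).resolve_left hx)
    · rw [← hgen]
      have h1 := keyd d
      rw [(hW₀ d).2 hd, cvec_eq_zero_iff.2 rfl, zero_dotProduct, mul_zero] at h1
      exact (mul_eq_zero.1 h1.symm).resolve_left hy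
  · intro hW0 c hc
    have hcr : i₀.transpose.mulVec (r₀.transpose.mulVec c) = c := by
      rw [Matrix.mulVec_mulVec, ← Matrix.transpose_mul, hr₀, Matrix.transpose_one,
        Matrix.one_mulVec]
    rw [← hcr, hW₀, hW0, ← hgen]
    have h1 := keyd (r₀.transpose.mulVec c)
    rw [hcr, hc, mul_zero] at h1
    exact (mul_eq_zero.1 h1.symm).resolve_left hy

/-- W₁ contains l and the images of W₀, which span the second component of `genSub`; equality
follows from equality of dimensions. -/
theorem Sub.eq_genSub (W : Sub (matRep x)) (hx : (pencil x).det ≠ 0)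
    (hW : W.rep.dim.1 = W.rep.dim.2) (h : l ∈ W.W₁) (h0 : W.W₀ = (genSub x l).W₀) :
    W = genSub x l := by
  have hle : (genSub x l).W₁ ≤ W.W₁ := by
    refine sup_le ?_ (iSup_le fun j => ?_)
    · rwa [Submodule.span_singleton_le_iff_mem]
    · rw [Submodule.map_le_iff_le_comap]
      exact h0.ge.trans (W.stable j)
  refine Sub.ext h0 (Submodule.eq_of_le_of_finrank_eq hle ?_).symm
  have h1 : Module.finrank K (genSub x l).W₀ = Module.finrank K (genSub x l).W₁ :=
    genSub_dim l hx
  have h2 : Module.finrank K W.W₀ = Module.finrank K W.W₁ := hW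
  rw [← h1, ← h2, h0]

open Classical in
/-- Each non-zero vector generates exactly one subrepresentation with equal dimensions. -/
theorem sum_goodCard_rep [Finite K] (hx : (pencil x).det ≠ 0) :
    ∑ W : Sub (matRep x), (if W.rep.dim.1 = W.rep.dim.2 then W.rep.goodCard else 0) =
      Nat.card K ^ n - 1 := by
  -- The pair (W, l) is recovered from l alone, since W must be `genSub x l`.
  have e : (Σ W : {W : Sub (matRep x) // W.rep.dim.1 = W.rep.dim.2},
      {l : W.1.W₁ // W.1.rep.Good l}) ≃ {l : Fin n → K // l ≠ 0} := by
    refine Equiv.ofBijective (fun p => ⟨p.2.1.1, fun h => p.2.2.1 (Subtype.ext h)⟩) ⟨?_, ?_⟩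
    · rintro ⟨⟨W, hW⟩, ⟨⟨l, hl⟩, hg⟩⟩ ⟨⟨W', hW'⟩, ⟨⟨l', hl'⟩, hg'⟩⟩ h
      obtain rfl : l = l' := congrArg Subtype.val h
      have hl0 : l ≠ 0 := fun h => hg.1 (Subtype.ext h)
      obtain rfl : W = W' := (W.eq_genSub hx hW hl ((W.good_iff hx hW hl0 hl).1 hg)).trans
        (W'.eq_genSub hx hW' hl' ((W'.good_iff hx hW' hl0 hl').1 hg')).symm
      rfl
    · rintro ⟨l, hl⟩
      exact ⟨⟨⟨genSub x l, genSub_dim l hx⟩, ⟨⟨l, mem_genSub l⟩,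
        ((genSub x l).good_iff hx (genSub_dim l hx) hl (mem_genSub l)).2 rfl⟩⟩, rfl⟩
  have hfin : ∀ W : {W : Sub (matRep x) // W.rep.dim.1 = W.rep.dim.2},
      Finite {l : W.1.W₁ // W.1.rep.Good l} := fun W => by
    have : Finite W.1.W₁ := Module.finite_of_finite K
    exact Subtype.finite (α := W.1.W₁)
  rw [← Finset.sum_filter, Finset.sum_subtype (p := fun W : Sub (matRep x) =>
    W.rep.dim.1 = W.rep.dim.2) _ (by simp)]
  refine (Nat.card_sigma.symm.trans (Nat.card_congr e)).trans ?_
  have : Fintype K := Fintype.ofFinite K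
  rw [Nat.card_eq_fintype_card, Fintype.card_subtype_compl, Fintype.card_subtype_eq]
  simp

end Gen

end KRep

/-! ### Duality between quotients and subrepresentations of the transpose. -/

namespace KRep

section Orth

variable {K : Type u} [Field K] {n : ℕ}

/-- The orthogonal complement for the standard bilinear form. -/
def orth (S : Submodule K (Fin n → K)) : Submodule K (Fin n → K) where
  carrier := {d | ∀ s ∈ S, d ⬝ᵥ s = 0}
  add_mem' ha hb s hs := by rw [add_dotProduct, ha s hs, hb s hs, add_zero]
  zero_mem' s _ := zero_dotProduct s
  smul_mem' c d hd s hs := by rw [smul_dotProduct, hd s hs, smul_zero]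

theorem orth_orth (S : Submodule K (Fin n → K)) : orth (orth S) = S := by
  refine le_antisymm (le_of_dotProduct fun d hd s hs => ?_) fun s hs d hd => ?_
  · rw [dotProduct_comm]
    exact hs d hd
  · rw [dotProduct_comm]
    exact hd s hs

/-- The orthogonal complement of a subrepresentation, inside the transposed representation. -/
def Sub.orth {x y : Fin 2 → Matrix (Fin n) (Fin n) K} (h : ∀ j, y j = (x j).transpose)
    (W : Sub (matRep x)) : Sub (matRep y) where
  W₀ := KRep.orth W.W₁
  W₁ := KRep.orth W.W₀
  stable j d hd s hs := by
    change (y j).mulVec d ⬝ᵥ s = 0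
    rw [h, Matrix.mulVec_transpose, ← Matrix.dotProduct_mulVec]
    exact hd _ (W.stable j hs)

/-- Orthogonal complements exchange the subrepresentations of a representation and those of its
transpose. -/
def Sub.orthEquiv (x : Fin 2 → Matrix (Fin n) (Fin n) K) :
    Sub (matRep x) ≃ Sub (matRep fun j => (x j).transpose) where
  toFun := Sub.orth fun _ => rfl
  invFun := Sub.orth fun _ => (Matrix.transpose_transpose _).symm
  left_inv W := Sub.ext (orth_orth W.W₀) (orth_orth W.W₁)
  right_inv W := Sub.ext (orth_orth W.W₀) (orth_orth W.W₁)

/-- The transpose of a surjective matrix identifies the dual of the quotient with the orthogonal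
complement of the kernel. -/
theorem exists_equiv_orth {m : ℕ} {S : Submodule K (Fin n → K)} {p : Matrix (Fin m) (Fin n) K}
    {s : Matrix (Fin n) (Fin m) K} (hp : ∀ v, p.mulVec v = 0 ↔ v ∈ S) (hs : p * s = 1) :
    ∃ e : (Fin m → K) ≃ₗ[K] orth S, ∀ v, (e v : Fin n → K) = p.transpose.mulVec v := by
  have hmem : ∀ v, p.transpose.mulVec v ∈ orth S := fun v t ht => by
    rw [Matrix.mulVec_transpose, ← Matrix.dotProduct_mulVec, (hp t).2 ht, dotProduct_zero]
  refine ⟨LinearEquiv.ofBijective (p.transpose.mulVecLin.codRestrict _ hmem) ⟨?_, ?_⟩,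
    fun v => rfl⟩
  · intro v w h
    have h1 := congrArg (s.transpose.mulVec) (congrArg Subtype.val h)
    change s.transpose.mulVec (p.transpose.mulVec v) = s.transpose.mulVec (p.transpose.mulVec w)
      at h1
    rwa [Matrix.mulVec_mulVec, Matrix.mulVec_mulVec, ← Matrix.transpose_mul, hs,
      Matrix.transpose_one, Matrix.one_mulVec, Matrix.one_mulVec] at h1
  · rintro ⟨d, hd⟩
    refine ⟨s.transpose.mulVec d, Subtype.ext ?_⟩
    change p.transpose.mulVec (s.transpose.mulVec d) = d
    rw [← sub_eq_zero]
    refine dotProduct_eq_zero _ fun v => ?_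
    rw [sub_dotProduct, Matrix.mulVec_mulVec, ← Matrix.transpose_mul, Matrix.mulVec_transpose,
      ← Matrix.dotProduct_mulVec, ← dotProduct_sub]
    refine hd _ ((hp _).1 ?_)
    rw [Matrix.mulVec_sub, Matrix.mulVec_mulVec, ← Matrix.mul_assoc, hs, Matrix.one_mul, sub_self]

theorem Sub.orth_rep_iso {x : Fin 2 → Matrix (Fin n) (Fin n) K} (W : Sub (matRep x)) {m₀ m₁ : ℕ}
    {z : Fin 2 → Matrix (Fin m₁) (Fin m₀) K}
    {p₀ : Matrix (Fin m₀) (Fin n) K} {s₀ : Matrix (Fin n) (Fin m₀) K}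
    {p₁ : Matrix (Fin m₁) (Fin n) K} {s₁ : Matrix (Fin n) (Fin m₁) K}
    (hp₀ : ∀ v, p₀.mulVec v = 0 ↔ v ∈ W.W₀) (hp₁ : ∀ v, p₁.mulVec v = 0 ↔ v ∈ W.W₁)
    (hs₀ : p₀ * s₀ = 1) (hs₁ : p₁ * s₁ = 1) (h : ∀ j, p₁ * x j = z j * p₀) :
    Iso (matRep fun j => (z j).transpose) (Sub.orthEquiv x W).rep := by
  obtain ⟨b, hb⟩ := exists_equiv_orth hp₀ hs₀
  obtain ⟨a, ha⟩ := exists_equiv_orth hp₁ hs₁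
  refine ⟨a, b, fun j v => Subtype.ext ((hb _).trans ?_)⟩
  change p₀.transpose.mulVec ((z j).transpose.mulVec v) =
    (x j).transpose.mulVec ((a v : KRep.orth W.W₁) : Fin n → K)
  rw [ha, Matrix.mulVec_mulVec, Matrix.mulVec_mulVec, ← Matrix.transpose_mul,
    ← Matrix.transpose_mul, h]

open Classical in
/-- The sum over all quotients with equal dimensions of the numbers of cyclic vectors. -/
theorem sum_goodCard_quot [Finite K] {x : Fin 2 → Matrix (Fin n) (Fin n) K}
    (hx : (pencil x).det ≠ 0) :
    ∑ W : Sub (matRep x), (if W.quot.dim.1 = W.quot.dim.2 then W.quot.goodCard else 0) =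
      Nat.card K ^ n - 1 := by
  rw [← sum_goodCard_rep (x := fun j => (x j).transpose) (by rwa [det_pencil_transpose])]
  refine Fintype.sum_equiv (Sub.orthEquiv x) _ _ fun W => ?_
  by_cases hd : W.quot.dim.1 = W.quot.dim.2
  · obtain ⟨z, p₀, s₀, p₁, s₁, hi, hp₀, hp₁, hs₀, hs₁, h⟩ := W.exists_quot_matrix
      (Prod.ext rfl hd.symm : W.quot.dim = (W.quot.dim.1, W.quot.dim.1))
    have hi' := W.orth_rep_iso hp₀ hp₁ hs₀ hs₁ h
    rw [if_pos hd, ← hi'.dim_eq, matRep_dim, if_pos rfl, ← hi'.goodCard_eq, ← hi.goodCard_eq]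
    -- The orthogonal of W is the transpose of the quotient, so equality of the two counts of cyclic
    -- vectors is what remains.
    exact goodCard_matRep_transpose z (det_pencil_ne_zero_of_quot hx hs₁ h)
  · obtain ⟨z, p₀, s₀, p₁, s₁, hi, hp₀, hp₁, hs₀, hs₁, h⟩ := W.exists_quot_matrix
      (rfl : W.quot.dim = (W.quot.dim.1, W.quot.dim.2))
    have hi' := W.orth_rep_iso hp₀ hp₁ hs₀ hs₁ h
    rw [if_neg hd, ← hi'.dim_eq, matRep_dim, if_neg fun h => hd h.symm]

end Orth

end KRep

namespace KRep

open Polynomial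

/-! ### Counting lines with generic quotient -/

section Lines

variable {K : Type u} [Field K]

/-- The subrepresentation spanned by a vector of `V₁`. -/
def lineSub (M : KRep K) (l : M.V₁) : Sub M := ⟨⊥, Submodule.span K {l}, fun _ => bot_le⟩

variable {M : KRep K} {n : ℕ}

theorem lineSub_dim {l : M.V₁} (hl : l ≠ 0) : (M.lineSub l).rep.dim = (0, 1) :=
  Prod.ext (finrank_bot K M.V₀) (finrank_span_singleton hl)

theorem Sub.eq_lineSub {W : Sub M} (hW : W.rep.dim = (0, 1)) {l : M.V₁} (hl : l ∈ W.W₁)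
    (h0 : l ≠ 0) : W = M.lineSub l := by
  refine Sub.ext (Submodule.finrank_eq_zero.1 (congrArg Prod.fst hW)) ?_
  refine (Submodule.eq_of_le_of_finrank_eq
    ((Submodule.span_singleton_le_iff_mem _ _).2 hl) ?_).symm
  exact (finrank_span_singleton h0).trans (congrArg Prod.snd hW).symm

theorem Sub.quot_dim {W : Sub M} {d e : ℕ × ℕ} (hM : M.dim = d + e) (hW : W.rep.dim = e) :
    W.quot.dim = d := by
  have := W.dim_add
  rw [hW, hM] at this
  exact add_right_cancel this

theorem lineSub_isGeneric_iff (hM : M.dim = (n + 1, n + 1)) {l : M.V₁} (hl : l ≠ 0) :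
    (M.lineSub l).quot.IsGeneric ↔ M.Good l := by
  rw [isGeneric_iff (m := n) (Sub.quot_dim (by rw [hM]; rfl) (lineSub_dim hl)), Good, hM,
    and_iff_right hl, Nat.add_sub_cancel]
  let a : (M.V₀ ⧸ (⊥ : Submodule K M.V₀)) ≃ₗ[K] M.V₀ := Submodule.quotEquivOfEqBot _ rfl
  constructor
  · intro h
    exact h.comp_injective a.symm.toLinearMap LinearMap.id a.symm.injective fun _ _ => rfl
  · intro h
    refine h.comp_injective a.toLinearMap LinearMap.id a.injective fun j u => ?_
    obtain ⟨u, rfl⟩ := Submodule.mkQ_surjective _ u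
    rfl

/-- A line with generic quotient consists of zero and q - 1 cyclic vectors. -/
theorem card_lines_mul [Finite K] (hM : M.dim = (n + 1, n + 1)) :
    Nat.card {W : Sub M // W.rep.dim = (0, 1) ∧ W.quot.IsGeneric} * (Nat.card K - 1) =
      M.goodCard := by
  have e : (Σ W : {W : Sub M // W.rep.dim = (0, 1) ∧ W.quot.IsGeneric},
      {l : W.1.W₁ // l ≠ 0}) ≃ {l : M.V₁ // M.Good l} := by
    have h0 : ∀ {W : Sub M} (l : W.W₁), l ≠ 0 → (l : M.V₁) ≠ 0 := fun l hl h =>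
      hl (Subtype.ext h)
    refine Equiv.ofBijective (fun p => ⟨p.2.1.1, ?_⟩) ⟨?_, ?_⟩
    · rw [← lineSub_isGeneric_iff hM (h0 _ p.2.2), ← p.1.1.eq_lineSub p.1.2.1 p.2.1.2 (h0 _ p.2.2)]
      exact p.1.2.2
    · rintro ⟨⟨W, hW⟩, ⟨⟨l, hl⟩, hl0⟩⟩ ⟨⟨W', hW'⟩, ⟨⟨l', hl'⟩, hl0'⟩⟩ h
      obtain rfl : l = l' := congrArg Subtype.val h
      obtain rfl : W = W' := (W.eq_lineSub hW.1 hl (h0 _ hl0)).trans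
        (W'.eq_lineSub hW'.1 hl' (h0 _ hl0')).symm
      rfl
    · rintro ⟨l, hl⟩
      exact ⟨⟨⟨M.lineSub l, lineSub_dim hl.1, (lineSub_isGeneric_iff hM hl.1).2 hl⟩,
        ⟨⟨l, Submodule.mem_span_singleton_self l⟩, fun h => hl.1 (congrArg Subtype.val h)⟩⟩, rfl⟩
  have hfin : ∀ W : {W : Sub M // W.rep.dim = (0, 1) ∧ W.quot.IsGeneric}, Finite W.1.W₁ :=
    fun W => Module.finite_of_finite K
  have : Fintype {W : Sub M // W.rep.dim = (0, 1) ∧ W.quot.IsGeneric} := Fintype.ofFinite _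
  rw [goodCard, ← Nat.card_congr e, Nat.card_sigma, Nat.card_eq_fintype_card,
    ← Finset.card_univ, ← smul_eq_mul, ← Finset.sum_const]
  refine Finset.sum_congr rfl fun W _ => ?_
  have h1 : Nat.card W.1.W₁ = Nat.card K := by
    rw [Module.natCard_eq_pow_finrank (K := K),
      show Module.finrank K W.1.W₁ = 1 from congrArg Prod.snd W.2.1, pow_one]
  have : Fintype W.1.W₁ := Fintype.ofFinite _
  classical
  rw [Nat.card_eq_fintype_card (α := {l : W.1.W₁ // l ≠ 0}), Fintype.card_subtype_compl,
    Fintype.card_subtype_eq, ← Nat.card_eq_fintype_card, h1]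

/-- A subrepresentation of dimension `(n + 1, n)` in the generic orbit contains all images. -/
theorem Sub.good_iff_notMem (hM : M.dim = (n + 1, n + 1)) {W : Sub M} (hW : W.rep.dim = (n + 1, n))
    (hg : W.rep.IsGeneric) (l : M.V₁) : M.Good l ↔ l ∉ W.W₁ := by
  have hV₀ : Module.finrank K M.V₀ = n + 1 := congrArg Prod.fst hM
  have hV₁ : Module.finrank K M.V₁ = n + 1 := congrArg Prod.snd hM
  have hW₁ : Module.finrank K W.W₁ = n := congrArg Prod.snd hW
  have hW₀ : W.W₀ = ⊤ := Submodule.eq_top_of_finrank_eq ((congrArg Prod.fst hW).trans hV₀.symm)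
  rw [isGeneric_iff hW] at hg
  have hx : ∀ j u, M.x j u ∈ W.W₁ := fun j u => W.stable j (hW₀ ▸ Submodule.mem_top)
  rw [Good, hM, Nat.add_sub_cancel]
  constructor
  · rintro ⟨hl, h⟩ hmem
    have hq : Module.finrank K (M.V₁ ⧸ Submodule.span K {l}) = n := by
      have := Submodule.finrank_quotient_add_finrank (Submodule.span K {l})
      rw [finrank_span_singleton hl, hV₁] at this
      omega
    -- All images lie in W₁, so W₁ would fill the quotient by the line; as W₁ contains l, it would
    -- be everything.
    have h1 := h.range_sup_range hV₀ hq (W.W₁.map (Submodule.span K {l}).mkQ)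
      fun j u => Submodule.mem_map_of_mem (hx j u)
    have h2 := congrArg (Submodule.comap (Submodule.span K {l}).mkQ) h1
    rw [Submodule.comap_map_mkQ, Submodule.comap_top,
      sup_eq_right.2 ((Submodule.span_singleton_le_iff_mem _ _).2 hmem)] at h2
    rw [h2, finrank_top, hV₁] at hW₁
    omega
  · intro hmem
    refine ⟨fun h => hmem (h ▸ zero_mem _), fun v hv hd k => ?_⟩
    -- W₁ meets the line of l trivially, so a chain modulo l is a genuine chain in W.
    have key : ∀ w ∈ W.W₁, (Submodule.span K {l}).mkQ w = 0 → w = 0 := by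
      intro w hw h
      obtain ⟨c, rfl⟩ := Submodule.mem_span_singleton.1 ((Submodule.Quotient.mk_eq_zero _).1 h)
      by_cases hc : c = 0
      · rw [hc, zero_smul]
      · exact absurd ((Submodule.smul_mem_iff _ hc).1 hw) hmem
    have hch : PencilChain M.x v := ⟨key _ (hx _ _) hv.1, fun k =>
      key _ (add_mem (hx _ _) (hx _ _)) (by rw [map_add]; exact hv.2 k)⟩
    let v' : ℕ → W.W₀ := fun k => ⟨v k, hW₀ ▸ Submodule.mem_top⟩
    have := hg v' ⟨Subtype.ext hch.1, fun k => Subtype.ext (hch.2 k)⟩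
      (fun k hk => Subtype.ext (hd k hk)) k
    exact congrArg Subtype.val this

/-- Both first components are everything, and each second component is the set of vectors that are
not cyclic. -/
theorem Sub.eq_of_isGeneric (hM : M.dim = (n + 1, n + 1)) {W W' : Sub M}
    (hW : W.rep.dim = (n + 1, n)) (hg : W.rep.IsGeneric) (hW' : W'.rep.dim = (n + 1, n))
    (hg' : W'.rep.IsGeneric) : W = W' := by
  have hV₀ : Module.finrank K M.V₀ = n + 1 := congrArg Prod.fst hM
  have h0 : ∀ {W : Sub M}, W.rep.dim = (n + 1, n) → W.W₀ = ⊤ := fun hW =>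
    Submodule.eq_top_of_finrank_eq ((congrArg Prod.fst hW).trans hV₀.symm)
  refine Sub.ext ((h0 hW).trans (h0 hW').symm) (Submodule.ext fun l => ?_)
  rw [← not_iff_not, ← Sub.good_iff_notMem hM hW hg, ← Sub.good_iff_notMem hM hW' hg']

/-- A singular square pencil with a generic quotient by a line has a generic subrepresentation. -/
theorem exists_generic_sub {x : Fin 2 → Matrix (Fin (n + 1)) (Fin (n + 1)) K}
    (hx : (pencil x).det = 0) {l : Fin (n + 1) → K} (hl : (matRep x).Good l) :
    ∃ W : Sub (matRep x), W.rep.dim = (n + 1, n) ∧ W.rep.IsGeneric := by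
  obtain ⟨hl0, hN⟩ := hl
  rw [matRep_dim, Nat.add_sub_cancel] at hN
  have hV : Module.finrank K (Fin (n + 1) → K) = n + 1 := Module.finrank_fin_fun K
  have hq : Module.finrank K ((Fin (n + 1) → K) ⧸ Submodule.span K {l}) = n := by
    have := Submodule.finrank_quotient_add_finrank (Submodule.span K {l})
    rw [finrank_span_singleton hl0, hV] at this
    omega
  obtain ⟨v, hv, hm, a, b, ha, hb⟩ := hN.exists_bases hV hq
  have hd : ∀ k, n + 1 ≤ k → v k = 0 := fun k hk => hm k hk
  obtain ⟨p, -, hp⟩ := exists_poly_smul_of_chain_mod x hl0 hd hv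
  -- The chain modulo l is a genuine one. Take y ≠ 0 in the left kernel: it gives p (y · l) = 0, and
  -- p = 0 is the claim. If y · l = 0, each coefficient of y kills l; by induction on the degree it
  -- also kills the image of x 0, which together with l spans the space, so y = 0.
  have hvc : PencilChain (fun j => (x j).mulVecLin) v := by
    obtain ⟨y, hy, hy0⟩ := Matrix.exists_vecMul_eq_zero_iff.2 hx
    have h1 : p * (y ⬝ᵥ cvec l) = 0 := by
      rw [← smul_eq_mul, ← dotProduct_smul, ← hp, Matrix.dotProduct_mulVec, hy0, zero_dotProduct]
    rcases mul_eq_zero.1 h1 with h2 | h2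
    · rw [h2, zero_smul, pencil_mulVec_eq_zero_iff] at hp
      rwa [show vcoeff (polyVec v (n + 1)) = v from funext (vcoeff_polyVec hd)] at hp
    · exfalso
      apply hy
      rw [← Matrix.mulVec_transpose, ← pencil_transpose, pencil_mulVec_eq_zero_iff] at hy0
      have key : ∀ k, (x 0).transpose.mulVec (vcoeff y k) = 0 → vcoeff y k = 0 := by
        intro k hk
        have hlk : vcoeff y k ⬝ᵥ l = 0 := by
          rw [dotProduct_comm, ← coeff_cvec_dotProduct, dotProduct_comm, h2, coeff_zero]
        refine dotProduct_eq_zero _ fun u => ?_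
        have hu : (Submodule.span K {l}).mkQ u ∈ Submodule.span K (Set.range b) := by
          rw [b.span_eq]
          exact Submodule.mem_top
        obtain ⟨c, hc⟩ := (Submodule.mem_span_range_iff_exists_fun K).1 hu
        have hc' : u - ∑ j, c j • (x 0).mulVec (v (j + 1)) ∈ Submodule.span K {l} := by
          rw [← Submodule.Quotient.mk_eq_zero, ← Submodule.mkQ_apply, map_sub, ← hc, map_sum,
            sub_eq_zero]
          exact Finset.sum_congr rfl fun j _ => by rw [hb, map_smul]; rfl
        obtain ⟨e, he⟩ := Submodule.mem_span_singleton.1 hc'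
        rw [← sub_add_cancel u (∑ j, c j • (x 0).mulVec (v (j + 1))), ← he, dotProduct_add,
          dotProduct_smul, hlk, smul_zero, zero_add, dotProduct_sum]
        refine Finset.sum_eq_zero fun j _ => ?_
        rw [dotProduct_smul, Matrix.dotProduct_mulVec, ← Matrix.mulVec_transpose, hk,
          zero_dotProduct, smul_zero]
      have hy' : ∀ k, vcoeff y k = 0 := by
        intro k
        induction k with
        | zero => exact key 0 hy0.1
        | succ k ih =>
          refine key _ ?_
          have := hy0.2 k
          rwa [ih, map_zero, add_zero] at this
      exact vcoeff_ext fun k => by rw [hy', vcoeff_zero]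
  -- The span of all images of the pencil; its generators stay independent modulo l, so its
  -- dimension is n.
  let I : Submodule K (Fin (n + 1) → K) :=
    Submodule.span K (Set.range fun j : Fin n => (x 0).mulVec (v (j + 1)))
  have h0I : ∀ k, (x 0).mulVec (v k) ∈ I := by
    intro k
    cases k with
    | zero =>
      have : (x 0).mulVec (v 0) = 0 := hvc.1
      rw [this]
      exact zero_mem _
    | succ k =>
      by_cases hk : k < n
      · exact Submodule.subset_span ⟨⟨k, hk⟩, rfl⟩
      · rw [hd (k + 1) (by omega), Matrix.mulVec_zero]
        exact zero_mem _
  have h1I : ∀ k, (x 1).mulVec (v k) ∈ I := by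
    intro k
    have : (x 0).mulVec (v (k + 1)) + (x 1).mulVec (v k) = 0 := hvc.2 k
    rw [eq_neg_of_add_eq_zero_right this]
    exact neg_mem (h0I _)
  have hI : ∀ j, (⊤ : Submodule K (Fin (n + 1) → K)) ≤ I.comap (x j).mulVecLin := by
    intro j
    rw [← a.span_eq, Submodule.span_le]
    rintro _ ⟨k, rfl⟩
    rw [ha]
    obtain rfl | rfl : j = 0 ∨ j = 1 := by omega
    · exact h0I k
    · exact h1I k
  have hfin : Module.finrank K I = n := by
    have hli : LinearIndependent K (fun j : Fin n => (x 0).mulVec (v (j + 1))) := by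
      refine LinearIndependent.of_comp (Submodule.span K {l}).mkQ ?_
      convert! b.linearIndependent using 1
      exact funext fun j => (hb j).symm
    rw [finrank_span_eq_card hli, Fintype.card_fin]
  let W : Sub (matRep x) := ⟨⊤, I, hI⟩
  have hWd : W.rep.dim = (n + 1, n) := Prod.ext ((finrank_top K _).trans hV) hfin
  refine ⟨W, hWd, (isGeneric_iff hWd).2 ?_⟩
  exact hN.comp_injective W.W₀.subtype ((Submodule.span K {l}).mkQ ∘ₗ I.subtype)
    W.W₀.injective_subtype fun _ _ => rfl

theorem card_generic_sub_eq_zero {x : Fin 2 → Matrix (Fin (n + 1)) (Fin (n + 1)) K}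
    (hx : (pencil x).det ≠ 0) :
    Nat.card {W : Sub (matRep x) // W.rep.dim = (n + 1, n) ∧ W.rep.IsGeneric} = 0 := by
  have : IsEmpty {W : Sub (matRep x) // W.rep.dim = (n + 1, n) ∧ W.rep.IsGeneric} := by
    refine ⟨fun W => ?_⟩
    have h := W.1.finrank_le hx
    have h0 : Module.finrank K W.1.W₀ = n + 1 := congrArg Prod.fst W.2.1
    have h1 : Module.finrank K W.1.W₁ = n := congrArg Prod.snd W.2.1
    omega
  exact Nat.card_of_isEmpty

/-- With a generic subrepresentation, which is unique, the cyclic vectors are the complement of a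
hyperplane, and q^(n+1) - q^n = q^n (q - 1). Without one there is no cyclic vector. -/
theorem goodCard_of_det_eq_zero [Finite K] {x : Fin 2 → Matrix (Fin (n + 1)) (Fin (n + 1)) K}
    (hx : (pencil x).det = 0) : (matRep x).goodCard = (Nat.card K ^ n *
      Nat.card {W : Sub (matRep x) // W.rep.dim = (n + 1, n) ∧ W.rep.IsGeneric}) *
      (Nat.card K - 1) := by
  have hM := matRep_dim x
  by_cases hW : ∃ W : Sub (matRep x), W.rep.dim = (n + 1, n) ∧ W.rep.IsGeneric
  · obtain ⟨W, hW, hg⟩ := hW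
    have : Unique {W : Sub (matRep x) // W.rep.dim = (n + 1, n) ∧ W.rep.IsGeneric} :=
      { default := ⟨W, hW, hg⟩
        uniq := fun W' => Subtype.ext (Sub.eq_of_isGeneric hM W'.2.1 W'.2.2 hW hg) }
    rw [Nat.card_unique (α := {W : Sub (matRep x) // W.rep.dim = (n + 1, n) ∧ W.rep.IsGeneric}),
      mul_one, goodCard, Nat.card_congr (Equiv.subtypeEquivRight
      (Sub.good_iff_notMem hM hW hg))]
    have hW₁ : Module.finrank K W.W₁ = n := congrArg Prod.snd hW
    have hc : Nat.card W.W₁ = Nat.card K ^ n := by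
      rw [Module.natCard_eq_pow_finrank (K := K), hW₁]
    have hc' : Nat.card (matRep x).V₁ = Nat.card K ^ (n + 1) := by
      rw [Module.natCard_eq_pow_finrank (K := K),
        show Module.finrank K (matRep x).V₁ = n + 1 from congrArg Prod.snd hM]
    have : Finite (matRep x).V₁ := Module.finite_of_finite K
    have : Fintype (matRep x).V₁ := Fintype.ofFinite _
    have : Fintype W.W₁ := Fintype.ofFinite _
    classical
    rw [Nat.card_eq_fintype_card, Fintype.card_subtype_compl, ← Nat.card_eq_fintype_card, hc']
    refine (congrArg (Nat.card K ^ (n + 1) - ·) (?_ : _ = Nat.card K ^ n)).trans ?_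
    · rw [← hc, Nat.card_eq_fintype_card]
    · rw [Nat.mul_sub, pow_succ, mul_one]
  · have : IsEmpty {W : Sub (matRep x) // W.rep.dim = (n + 1, n) ∧ W.rep.IsGeneric} :=
      ⟨fun W => hW ⟨W.1, W.2⟩⟩
    rw [Nat.card_of_isEmpty
      (α := {W : Sub (matRep x) // W.rep.dim = (n + 1, n) ∧ W.rep.IsGeneric}), mul_zero, zero_mul]
    have : IsEmpty {l : (matRep x).V₁ // (matRep x).Good l} :=
      ⟨fun l => hW (exists_generic_sub hx l.2)⟩
    exact Nat.card_of_isEmpty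

end Lines

end KRep

/-! ### Evaluation of products in the Hall algebra -/

section Evaluation

open KRep

variable {K : Type u} [Field K] {C : Type v} [Field C] {ε : C}

theorem Hall.sub_apply (f g : Hall K ε) (M : KRep K) : (f - g) M = f M - g M := rfl

theorem Hall.sum_apply {ι : Type*} (s : Finset ι) (f : ι → Hall K ε) (M : KRep K) :
    (∑ i ∈ s, f i) M = ∑ i ∈ s, f i M :=
  map_sum ({ toFun := fun f : Hall K ε => f M, map_zero' := rfl, map_add' := fun _ _ => rfl } :
    Hall K ε →+ C) f s

open Classical in
theorem Hall.r_apply (f : Hall K ε) (M : KRep K) :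
    Hall.r f M = if M.IsRegular then f M else 0 := rfl

open Classical in
theorem theta₁_apply (M : KRep K) : theta₁ K ε M = if M.dim = (0, 1) then 1 else 0 := by
  rw [theta₁, Hall.char_apply]
  simp only [and_true]

open Classical in
theorem gam_apply (n : ℕ) (M : KRep K) : gam K ε n M =
    ε⁻¹ ^ (2 * (n + 1) * n) * if M.dim = (n + 1, n) ∧ M.IsGeneric then 1 else 0 := by
  rw [gam, Hall.smul_apply, Hall.char_apply]
  rfl

open Classical in
theorem rho_apply (n : ℕ) (M : KRep K) : rho K ε n M =
    ε⁻¹ ^ (2 * n * n) * if M.dim = (n, n) ∧ M.IsRegular then 1 else 0 := by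
  rw [rho, Hall.smul_apply, Hall.char_apply]
  rfl

theorem goodCard_eq_zero {M : KRep K} (h : M.dim.2 = 0) : M.goodCard = 0 := by
  have : Subsingleton M.V₁ := Module.finrank_zero_iff.1 h
  have : IsEmpty {l : M.V₁ // M.Good l} := ⟨fun l => l.2.1 (Subsingleton.elim _ _)⟩
  exact Nat.card_of_isEmpty

theorem of_rho_apply_ne_zero {n : ℕ} {M : KRep K} (h : rho K ε n M ≠ 0) :
    M.dim = (n, n) ∧ M.IsRegular := by
  classical
  by_contra hM
  rw [rho_apply, if_neg hM, mul_zero] at h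
  exact h rfl

theorem Hall.eq_of_matRep {f g : Hall K ε} {n : ℕ} (h : ∀ M : KRep K, M.dim ≠ (n, n) → f M = g M)
    (h' : ∀ x : Fin 2 → Matrix (Fin n) (Fin n) K, f (matRep x) = g (matRep x)) : f = g := by
  ext M
  by_cases hM : M.dim = (n, n)
  · obtain ⟨x, hx⟩ := M.exists_iso_matRep hM
    rw [← f.iso hx, ← g.iso hx, h']
  · exact h M hM

theorem rho_apply_matRep (n : ℕ) {x : Fin 2 → Matrix (Fin n) (Fin n) K}
    (hx : (pencil x).det ≠ 0) : rho K ε n (matRep x) = ε⁻¹ ^ (2 * n * n) := by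
  rw [rho_apply, if_pos ⟨matRep_dim x, (isRegular_matRep_iff x).2 hx⟩, mul_one]

variable [Finite K]

theorem Hall.mul_apply_eq_zero {f g : Hall K ε} {M : KRep K}
    (h : ∀ W : Sub M, f W.quot = 0 ∨ g W.rep = 0) : (f * g) M = 0 := by
  rw [Hall.mul_apply]
  refine Finset.sum_eq_zero fun W _ => ?_
  rcases h W with h | h
  · rw [h, mul_zero, zero_mul]
  · rw [h, mul_zero]

theorem gam_mul_theta₁_apply {n : ℕ} {M : KRep K} (hM : M.dim = (n + 1, n + 1)) :
    (gam K ε n * theta₁ K ε) M = ε⁻¹ ^ (3 * n + 2 + 2 * (n + 1) * n) *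
      (Nat.card {W : Sub M // W.rep.dim = (0, 1) ∧ W.quot.IsGeneric} : C) := by
  classical
  rw [Hall.mul_apply, Nat.card_eq_fintype_card, Fintype.card_subtype, ← Finset.sum_boole,
    Finset.mul_sum]
  refine Finset.sum_congr rfl fun W _ => ?_
  rw [gam_apply, theta₁_apply]
  by_cases h : W.rep.dim = (0, 1)
  · have hq : W.quot.dim = (n + 1, n) := Sub.quot_dim (by rw [hM]; rfl) h
    rw [h, hq, show twist (n + 1, n) (0, 1) = 3 * n + 2 by simp only [twist]; ring]
    simp only [true_and, if_true, mul_one, pow_add, mul_assoc]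
  · simp only [h, false_and, if_false, mul_zero]

theorem theta₁_mul_gam_apply {n : ℕ} {M : KRep K} (hM : M.dim = (n + 1, n + 1)) :
    (theta₁ K ε * gam K ε n) M = ε⁻¹ ^ (n + 2 * (n + 1) * n) *
      (Nat.card {W : Sub M // W.rep.dim = (n + 1, n) ∧ W.rep.IsGeneric} : C) := by
  classical
  rw [Hall.mul_apply, Nat.card_eq_fintype_card, Fintype.card_subtype, ← Finset.sum_boole,
    Finset.mul_sum]
  refine Finset.sum_congr rfl fun W _ => ?_
  rw [gam_apply, theta₁_apply]
  by_cases h : W.rep.dim = (n + 1, n)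
  · have hq : W.quot.dim = (0, 1) := Sub.quot_dim (by rw [hM]; simp [add_comm]) h
    rw [h, hq, show twist (0, 1) (n + 1, n) = n by simp only [twist]; ring]
    simp only [true_and, if_true, mul_one, pow_add, mul_assoc]
  · simp only [h, false_and, if_false, mul_zero]

theorem dim_of_gam_mul_theta₁_ne_zero {n : ℕ} {M : KRep K} (h : (gam K ε n * theta₁ K ε) M ≠ 0) :
    M.dim = (n + 1, n + 1) := by
  classical
  by_contra hM
  refine h (Hall.mul_apply_eq_zero fun W => ?_)
  rw [gam_apply, theta₁_apply]
  by_cases hr : W.rep.dim = (0, 1)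
  · left
    rw [if_neg, mul_zero]
    rintro ⟨hq, -⟩
    exact hM (by rw [← W.dim_add, hr, hq]; rfl)
  · exact Or.inr (if_neg hr)

theorem dim_of_theta₁_mul_gam_ne_zero {n : ℕ} {M : KRep K} (h : (theta₁ K ε * gam K ε n) M ≠ 0) :
    M.dim = (n + 1, n + 1) := by
  classical
  by_contra hM
  refine h (Hall.mul_apply_eq_zero fun W => ?_)
  rw [gam_apply, theta₁_apply]
  by_cases hq : W.quot.dim = (0, 1)
  · right
    rw [if_neg, mul_zero]
    rintro ⟨hr, -⟩
    exact hM (by rw [← W.dim_add, hr, hq]; simp [add_comm])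
  · exact Or.inl (if_neg hq)

theorem card_sub_one_ne_zero [CharZero C] : ((Nat.card K - 1 : ℕ) : C) ≠ 0 := by
  have := Finite.one_lt_card (α := K)
  exact_mod_cast (by omega : Nat.card K - 1 ≠ 0)

theorem eps_ne_zero [CharZero C] (hε : ε ^ 2 = (Nat.card K : C)) : ε ≠ 0 := by
  rintro rfl
  have := Finite.card_pos (α := K)
  rw [zero_pow two_ne_zero] at hε
  exact this.ne (by exact_mod_cast hε)

/-- At a regular point θ₁ γ vanishes; at a singular point the two terms cancel by comparison of the
two counts. -/
theorem phi_eq_r [CharZero C] (hε : ε ^ 2 = (Nat.card K : C)) (n : ℕ) :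
    phi K ε (n + 1) = Hall.r (gam K ε n * theta₁ K ε) := by
  classical
  have hε0 := eps_ne_zero hε
  ext M
  rw [phi, Nat.add_sub_cancel, Hall.sub_apply, Hall.smul_apply, Hall.r_apply]
  by_cases hM : M.dim = (n + 1, n + 1)
  · obtain ⟨x, hx⟩ := M.exists_iso_matRep hM
    rw [← Hall.iso _ hx, ← Hall.iso _ hx, ← hx.isRegular, isRegular_matRep_iff]
    have hd := matRep_dim x
    split_ifs with h
    · rw [theta₁_mul_gam_apply hd, card_generic_sub_eq_zero h, Nat.cast_zero, mul_zero, mul_zero,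
        sub_zero]
    · rw [not_not] at h
      have h1 := card_lines_mul hd
      rw [goodCard_of_det_eq_zero h] at h1
      have h2 := Nat.eq_of_mul_eq_mul_right (by have := Finite.one_lt_card (α := K); omega) h1
      -- The twist 3n + 2 of the first product is the twist n of the second, plus 2 for the factor
      -- ε⁻² in φ, plus 2n absorbed by q^n = ε^(2n).
      rw [gam_mul_theta₁_apply hd, theta₁_mul_gam_apply hd, h2, Nat.cast_mul, Nat.cast_pow, ← hε,
        sub_eq_zero, ← pow_mul, show 3 * n + 2 + 2 * (n + 1) * n =
          2 + (n + 2 * (n + 1) * n) + 2 * n by ring, pow_add _ (2 + (n + 2 * (n + 1) * n)), pow_add]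
      have h3 : ε⁻¹ ^ (2 * n) * ε ^ (2 * n) = 1 := by
        rw [← mul_pow, inv_mul_cancel₀ hε0, one_pow]
      linear_combination (ε⁻¹ ^ 2 * ε⁻¹ ^ (n + 2 * (n + 1) * n) *
        (Nat.card {W : Sub (matRep x) // W.rep.dim = (n + 1, n) ∧ W.rep.IsGeneric} : C)) * h3
  · have h1 : (gam K ε n * theta₁ K ε) M = 0 := by
      by_contra h
      exact hM (dim_of_gam_mul_theta₁_ne_zero h)
    have h2 : (theta₁ K ε * gam K ε n) M = 0 := by
      by_contra h
      exact hM (dim_of_theta₁_mul_gam_ne_zero h)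
    rw [h1, h2]
    simp

-- Multiplying by q - 1 replaces lines by cyclic vectors and avoids divisions.
open Classical in
theorem card_sub_one_mul_phi_apply [CharZero C] (hε : ε ^ 2 = (Nat.card K : C)) {i : ℕ}
    (hi : 1 ≤ i) (M : KRep K) : ((Nat.card K - 1 : ℕ) : C) * phi K ε i M =
      if M.dim = (i, i) ∧ M.IsRegular then ε⁻¹ ^ (2 * i * i + i - 1) * (M.goodCard : C) else 0 := by
  obtain ⟨n, rfl⟩ : ∃ n, i = n + 1 := ⟨i - 1, by omega⟩
  rw [phi_eq_r hε, Hall.r_apply]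
  by_cases hM : M.dim = (n + 1, n + 1)
  · by_cases hr : M.IsRegular
    · rw [if_pos hr, if_pos ⟨hM, hr⟩, gam_mul_theta₁_apply hM, ← card_lines_mul hM, Nat.cast_mul,
        show 2 * (n + 1) * (n + 1) + (n + 1) - 1 = 3 * n + 2 + 2 * (n + 1) * n by
          rw [← add_assoc, Nat.add_sub_cancel]; ring]
      ring
    · rw [if_neg hr, if_neg fun h => hr h.2, mul_zero]
  · rw [if_neg (show ¬(M.dim = (n + 1, n + 1) ∧ M.IsRegular) from fun h => hM h.1)]
    split_ifs with hr
    · have h1 : (gam K ε n * theta₁ K ε) M = 0 := by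
        by_contra h
        exact hM (dim_of_gam_mul_theta₁_ne_zero h)
      rw [h1, mul_zero]
    · rw [mul_zero]

-- The contribution of one subrepresentation. At most one i matters, and the exponents (n - i) + 4ij
-- + (2i² + i - 1) + 2j² with i + j = n add up to 2n² + n - 1, independently of i. The twist 4ij is
-- symmetric, so M can be either the quotient or the subrepresentation.
open Classical in
theorem sum_phi_mul_rho [CharZero C] (hε : ε ^ 2 = (Nat.card K : C)) {n : ℕ} {M N : KRep K}
    (hMN : M.dim + N.dim = (n, n)) (hM : M.dim.1 = M.dim.2 → M.IsRegular)
    (hN : N.dim.1 = N.dim.2 → N.IsRegular) (t : ℕ)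
    (ht : ∀ i j, M.dim = (i, i) → N.dim = (j, j) → t = 4 * i * j) :
    ((Nat.card K - 1 : ℕ) : C) * ∑ i ∈ Finset.Icc 1 n, ε ^ ((i : ℤ) - (n : ℤ)) *
      (ε⁻¹ ^ t * phi K ε i M * rho K ε (n - i) N) =
    if M.dim.1 = M.dim.2 then ε⁻¹ ^ (2 * n * n + n - 1) * (M.goodCard : C) else 0 := by
  have hε0 := eps_ne_zero hε
  have hterm : ∀ i ∈ Finset.Icc 1 n, ((Nat.card K - 1 : ℕ) : C) * (ε ^ ((i : ℤ) - (n : ℤ)) *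
      (ε⁻¹ ^ t * phi K ε i M * rho K ε (n - i) N)) =
      if M.dim = (i, i) then ε⁻¹ ^ (2 * n * n + n - 1) * (M.goodCard : C) else 0 := by
    intro i hi
    obtain ⟨hi1, hin⟩ := Finset.mem_Icc.1 hi
    have h0 : ((Nat.card K - 1 : ℕ) : C) * (ε ^ ((i : ℤ) - (n : ℤ)) *
        (ε⁻¹ ^ t * phi K ε i M * rho K ε (n - i) N)) = ε ^ ((i : ℤ) - (n : ℤ)) * (ε⁻¹ ^ t *
        (((Nat.card K - 1 : ℕ) : C) * phi K ε i M) * rho K ε (n - i) N) := by ring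
    rw [h0, card_sub_one_mul_phi_apply hε hi1, rho_apply]
    by_cases hMi : M.dim = (i, i)
    · have hNi : N.dim = (n - i, n - i) := by
        have h1 := congrArg Prod.fst hMN
        have h2 := congrArg Prod.snd hMN
        rw [hMi] at h1 h2
        simp only [Prod.fst_add, Prod.snd_add] at h1 h2
        exact Prod.ext (by simp only; omega) (by simp only; omega)
      have hMr : M.IsRegular := hM (by rw [hMi])
      have hNr : N.IsRegular := hN (by rw [hNi])
      rw [if_pos ⟨hMi, hMr⟩, if_pos ⟨hNi, hNr⟩, if_pos hMi, ht _ _ hMi hNi]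
      obtain ⟨j, rfl⟩ : ∃ j, n = i + j := ⟨n - i, by omega⟩
      have hz : ε ^ (((i : ℕ) : ℤ) - ((i + j : ℕ) : ℤ)) = ε⁻¹ ^ j := by
        rw [show ((i : ℕ) : ℤ) - ((i + j : ℕ) : ℤ) = -(j : ℤ) by push_cast; ring, zpow_neg,
          zpow_natCast, inv_pow]
      rw [hz, Nat.add_sub_cancel_left]
      have he : 2 * (i + j) * (i + j) + (i + j) - 1 =
          j + 4 * i * j + (2 * i * i + i - 1) + 2 * j * j := by
        obtain ⟨i, rfl⟩ : ∃ i', i = i' + 1 := ⟨i - 1, by omega⟩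
        rw [show 2 * (i + 1 + j) * (i + 1 + j) + (i + 1 + j) =
          2 * (i + 1 + j) * (i + 1 + j) + (i + j) + 1 by ring, Nat.add_sub_cancel,
          ← add_assoc (2 * (i + 1) * (i + 1)), Nat.add_sub_cancel]
        ring
      rw [he, pow_add, pow_add, pow_add]
      ring
    · rw [if_neg fun h => hMi h.1, if_neg hMi, mul_zero, zero_mul, mul_zero]
  rw [Finset.mul_sum, Finset.sum_congr rfl hterm]
  by_cases hd : M.dim.1 = M.dim.2
  · rw [if_pos hd]
    by_cases h0 : M.dim.1 = 0
    -- The index 0 is outside the range of summation, but the zero representation has no cyclic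
    -- vector.
    · rw [goodCard_eq_zero (hd.symm.trans h0)]
      simp
    · have hmem : M.dim.1 ∈ Finset.Icc 1 n := by
        have h1 := congrArg Prod.fst hMN
        simp only [Prod.fst_add] at h1
        exact Finset.mem_Icc.2 ⟨by omega, by omega⟩
      rw [Finset.sum_eq_single_of_mem _ hmem, if_pos (Prod.ext rfl hd.symm : M.dim = (M.dim.1, M.dim.1))]
      intro i _ hi
      exact if_neg fun h => hi (congrArg Prod.fst h).symm
  · rw [if_neg hd]
    exact Finset.sum_eq_zero fun i _ => if_neg fun h => hd (by rw [h])

theorem qInt_mul [CharZero C] (hε : ε ^ 2 = (Nat.card K : C)) (n : ℕ) :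
    ((Nat.card K - 1 : ℕ) : C) * (qInt ε n * ε⁻¹ ^ (2 * n * n)) =
      ε⁻¹ ^ (2 * n * n + n - 1) * ((Nat.card K ^ n - 1 : ℕ) : C) := by
  have hε0 := eps_ne_zero hε
  have hq := Finite.one_lt_card (α := K)
  have h1 : ((Nat.card K - 1 : ℕ) : C) = ε ^ 2 - 1 := by
    rw [Nat.cast_sub hq.le, hε, Nat.cast_one]
  have h2 : ((Nat.card K ^ n - 1 : ℕ) : C) = ε ^ (2 * n) - 1 := by
    rw [Nat.cast_sub (Nat.one_le_pow _ _ (by omega)), Nat.cast_pow, ← hε, Nat.cast_one, pow_mul]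
  have h3 : ε ^ 2 - 1 ≠ 0 := h1 ▸ card_sub_one_ne_zero
  have h4 : ε - ε⁻¹ = ε⁻¹ * (ε ^ 2 - 1) := by
    field_simp
  rw [h1, h2, qInt, h4]
  cases n with
  -- The truncated exponent is harmless here because q^0 - 1 = 0.
  | zero => simp
  | succ n =>
    rw [← add_assoc, Nat.add_sub_cancel]
    simp only [inv_pow]
    field_simp
    ring

theorem of_phi_apply_ne_zero [CharZero C] (hε : ε ^ 2 = (Nat.card K : C)) {i : ℕ} (hi : 1 ≤ i)
    {M : KRep K} (h : phi K ε i M ≠ 0) : M.dim = (i, i) ∧ M.IsRegular := by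
  classical
  by_contra hM
  have := card_sub_one_mul_phi_apply hε hi M
  rw [if_neg hM] at this
  exact mul_ne_zero card_sub_one_ne_zero h this

/-- Off the regular locus both sides vanish, since extensions of regular representations are
regular. On it, φ is evaluated at quotients, and after multiplication by q - 1 the identity becomes
`sum_goodCard_quot`. -/
theorem qInt_smul_rho_left [CharZero C] (hε : ε ^ 2 = (Nat.card K : C)) (n : ℕ) :
    qInt ε n • rho K ε n =
      ∑ i ∈ Finset.Icc 1 n, ε ^ ((i : ℤ) - (n : ℤ)) • (phi K ε i * rho K ε (n - i)) := by
  classical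
  refine Hall.eq_of_matRep (n := n) (fun M hM => ?_) fun x => ?_
  · rw [Hall.smul_apply, Hall.sum_apply, rho_apply, if_neg fun h => hM h.1, mul_zero, mul_zero]
    refine (Finset.sum_eq_zero fun i hi => ?_).symm
    obtain ⟨hi1, hin⟩ := Finset.mem_Icc.1 hi
    rw [Hall.smul_apply, Hall.mul_apply_eq_zero, mul_zero]
    intro W
    by_contra h
    rw [not_or] at h
    apply hM
    rw [← W.dim_add, (of_phi_apply_ne_zero hε hi1 h.1).1, (of_rho_apply_ne_zero h.2).1,
      Prod.mk_add_mk, Nat.add_sub_cancel' hin]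
  · rw [Hall.smul_apply, Hall.sum_apply]
    by_cases hx : (pencil x).det = 0
    · have hr : ¬(matRep x).IsRegular := fun h => (isRegular_matRep_iff x).1 h hx
      rw [rho_apply, if_neg fun h => hr h.2, mul_zero, mul_zero]
      refine (Finset.sum_eq_zero fun i hi => ?_).symm
      rw [Hall.smul_apply, Hall.mul_apply_eq_zero, mul_zero]
      intro W
      by_contra h
      rw [not_or] at h
      exact W.det_pencil_ne_zero (of_rho_apply_ne_zero h.2).2
        (of_phi_apply_ne_zero hε (Finset.mem_Icc.1 hi).1 h.1).2 hx
    · refine mul_left_cancel₀ (card_sub_one_ne_zero (K := K)) ?_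
      rw [rho_apply_matRep n hx, qInt_mul hε, ← sum_goodCard_quot hx, Nat.cast_sum, Finset.mul_sum]
      simp only [Hall.smul_apply, Hall.mul_apply, Finset.mul_sum (ι := Sub (matRep x))]
      rw [Finset.sum_comm, Finset.mul_sum]
      refine Finset.sum_congr rfl fun W _ => ?_
      rw [sum_phi_mul_rho hε (W.dim_add.trans (matRep_dim x)) (W.quot_isRegular hx)
        (W.rep_isRegular hx) _ fun i j h h' => by rw [h, h', twist]; ring,
        Nat.cast_ite, Nat.cast_zero, mul_ite, mul_zero]

/-- Here φ is evaluated at subrepresentations, so the count needed is `sum_goodCard_rep`, without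
duality. -/
theorem qInt_smul_rho_right [CharZero C] (hε : ε ^ 2 = (Nat.card K : C)) (n : ℕ) :
    qInt ε n • rho K ε n =
      ∑ i ∈ Finset.Icc 1 n, ε ^ ((i : ℤ) - (n : ℤ)) • (rho K ε (n - i) * phi K ε i) := by
  classical
  refine Hall.eq_of_matRep (n := n) (fun M hM => ?_) fun x => ?_
  · rw [Hall.smul_apply, Hall.sum_apply, rho_apply, if_neg fun h => hM h.1, mul_zero, mul_zero]
    refine (Finset.sum_eq_zero fun i hi => ?_).symm
    obtain ⟨hi1, hin⟩ := Finset.mem_Icc.1 hi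
    rw [Hall.smul_apply, Hall.mul_apply_eq_zero, mul_zero]
    intro W
    by_contra h
    rw [not_or] at h
    apply hM
    rw [← W.dim_add, (of_phi_apply_ne_zero hε hi1 h.2).1, (of_rho_apply_ne_zero h.1).1,
      Prod.mk_add_mk, Nat.sub_add_cancel hin]
  · rw [Hall.smul_apply, Hall.sum_apply]
    by_cases hx : (pencil x).det = 0
    · have hr : ¬(matRep x).IsRegular := fun h => (isRegular_matRep_iff x).1 h hx
      rw [rho_apply, if_neg fun h => hr h.2, mul_zero, mul_zero]
      refine (Finset.sum_eq_zero fun i hi => ?_).symm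
      rw [Hall.smul_apply, Hall.mul_apply_eq_zero, mul_zero]
      intro W
      by_contra h
      rw [not_or] at h
      exact W.det_pencil_ne_zero (of_phi_apply_ne_zero hε (Finset.mem_Icc.1 hi).1 h.2).2
        (of_rho_apply_ne_zero h.1).2 hx
    · refine mul_left_cancel₀ (card_sub_one_ne_zero (K := K)) ?_
      rw [rho_apply_matRep n hx, qInt_mul hε, ← sum_goodCard_rep hx, Nat.cast_sum, Finset.mul_sum]
      simp only [Hall.smul_apply, Hall.mul_apply, Finset.mul_sum (ι := Sub (matRep x))]
      rw [Finset.sum_comm, Finset.mul_sum]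
      refine Finset.sum_congr rfl fun W _ => ?_
      simp only [mul_right_comm _ (rho K ε _ W.quot)]
      rw [sum_phi_mul_rho hε ((add_comm _ _).trans (W.dim_add.trans (matRep_dim x)))
        (W.rep_isRegular hx) (W.quot_isRegular hx) _ fun i j h h' => by rw [h, h', twist]; ring,
        Nat.cast_ite, Nat.cast_zero, mul_ite, mul_zero]

end Evaluation

/-! ### The generating series -/

section Series

open KRep

variable {K : Type u} [Field K] {C : Type v} [Field C] {ε : C}

theorem rho_zero : rho K ε 0 = 1 := by
  classical
  refine Hall.eq_of_matRep (n := 0) (fun M hM => ?_) fun x => ?_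
  · rw [rho_apply, if_neg fun h => hM h.1, mul_zero, Hall.one_apply, if_neg hM]
  · rw [rho_apply_matRep 0 (by rw [Matrix.det_isEmpty]; exact one_ne_zero), Hall.one_apply,
      if_pos (matRep_dim x), mul_zero, pow_zero]

variable [Finite K]

theorem isUnit_wp (c : C) : IsUnit (wp K ε c) := by
  have h : PowerSeries.constantCoeff (wp K ε c) = ((1 : (Hall K ε)ˣ) : Hall K ε) := by
    rw [← PowerSeries.coeff_zero_eq_constantCoeff_apply, wp, PowerSeries.coeff_mk, pow_zero,
      one_smul, rho_zero, Units.val_one]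
  exact ⟨⟨_, _, PowerSeries.mul_invOfUnit _ 1 h, PowerSeries.invOfUnit_mul _ 1 h⟩, rfl⟩

/-- Clearing the denominator of [n] gives the coefficient of u^n in the identity of series, for
either order of the factors. -/
theorem pow_smul_rho_eq {n : ℕ} (hε1 : ε - ε⁻¹ ≠ 0) {f : ℕ → Hall K ε}
    (hf : qInt ε n • rho K ε n = ∑ i ∈ Finset.Icc 1 n, ε ^ ((i : ℤ) - (n : ℤ)) • f i) :
    ε ^ n • rho K ε n = ε⁻¹ ^ n • rho K ε n +
      (ε - ε⁻¹) • ∑ i ∈ Finset.Icc 1 n, ε⁻¹ ^ (n - i) • f i := by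
  have h : ∑ i ∈ Finset.Icc 1 n, ε⁻¹ ^ (n - i) • f i = qInt ε n • rho K ε n := by
    rw [hf]
    refine Finset.sum_congr rfl fun i hi => ?_
    rw [inv_pow, ← zpow_natCast, ← zpow_neg, Nat.cast_sub (Finset.mem_Icc.1 hi).2, neg_sub]
  rw [h, smul_smul, qInt, mul_div_cancel₀ _ hε1, ← add_smul, add_sub_cancel]

theorem sum_antidiagonal_eq_sum_Icc {A : Type*} [AddCommMonoid A] (n : ℕ) (f : ℕ → ℕ → A)
    (h0 : ∀ j, f 0 j = 0) :
    ∑ p ∈ Finset.HasAntidiagonal.antidiagonal n, f p.1 p.2 = ∑ i ∈ Finset.Icc 1 n, f i (n - i) := by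
  rw [Finset.Nat.sum_antidiagonal_eq_sum_range_succ f, Finset.sum_range_succ', h0, add_zero,
    ← Finset.Ico_succ_right_eq_Icc, Order.succ_eq_add_one, Finset.sum_Ico_eq_sum_range,
    Nat.add_sub_cancel]
  exact Finset.sum_congr rfl fun i _ => by rw [add_comm]

variable [CharZero C]

theorem eps_sub_inv_ne_zero (hε : ε ^ 2 = (Nat.card K : C)) : ε - ε⁻¹ ≠ 0 := by
  have hε0 := eps_ne_zero hε
  intro h
  have h1 : ε ^ 2 = 1 := by
    rw [sub_eq_zero] at h
    rw [pow_two]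
    nth_rewrite 2 [h]
    exact mul_inv_cancel₀ hε0
  rw [hε] at h1
  exact Finite.one_lt_card.ne' (by exact_mod_cast h1 : Nat.card K = 1)

theorem wp_eq_mul_wp_inv (hε : ε ^ 2 = (Nat.card K : C)) :
    wp K ε ε = (1 + (ε - ε⁻¹) • Phi K ε) * wp K ε ε⁻¹ := by
  ext1 n
  rw [add_mul, one_mul, smul_mul_assoc, map_add, PowerSeries.coeff_smul, PowerSeries.coeff_mul,
    sum_antidiagonal_eq_sum_Icc n
      (fun i j => PowerSeries.coeff i (Phi K ε) * PowerSeries.coeff j (wp K ε ε⁻¹))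
      fun j => by rw [Phi, PowerSeries.coeff_mk, if_pos rfl, zero_mul]]
  simp only [wp, PowerSeries.coeff_mk]
  rw [pow_smul_rho_eq (eps_sub_inv_ne_zero hε) (qInt_smul_rho_left hε n)]
  congr 2
  refine Finset.sum_congr rfl fun i hi => ?_
  rw [Phi, PowerSeries.coeff_mk, if_neg (by have := (Finset.mem_Icc.1 hi).1; omega),
    mul_smul_comm]

theorem wp_eq_wp_inv_mul (hε : ε ^ 2 = (Nat.card K : C)) :
    wp K ε ε = wp K ε ε⁻¹ * (1 + (ε - ε⁻¹) • Phi K ε) := by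
  ext1 n
  rw [mul_add, mul_one, mul_smul_comm, map_add, PowerSeries.coeff_smul, PowerSeries.coeff_mul,
    ← Finset.Nat.sum_antidiagonal_swap]
  simp only [Prod.fst_swap, Prod.snd_swap]
  rw [sum_antidiagonal_eq_sum_Icc n
      (fun i j => PowerSeries.coeff j (wp K ε ε⁻¹) * PowerSeries.coeff i (Phi K ε))
      fun j => by rw [Phi, PowerSeries.coeff_mk, if_pos rfl, mul_zero]]
  simp only [wp, PowerSeries.coeff_mk]
  rw [pow_smul_rho_eq (eps_sub_inv_ne_zero hε) (qInt_smul_rho_right hε n)]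
  congr 2
  refine Finset.sum_congr rfl fun i hi => ?_
  rw [Phi, PowerSeries.coeff_mk, if_neg (by have := (Finset.mem_Icc.1 hi).1; omega),
    smul_mul_assoc]

end Series

end

theorem mainTheorem1 {K : Type u} [Field K] [Finite K] {C : Type v} [Field C] [CharZero C]
    (ε : C) (hε : ε ^ 2 = (Nat.card K : C)) :
    (∀ k : ℕ, 1 ≤ k → phi K ε k = Hall.r (gam K ε (k - 1) * theta₁ K ε)) ∧
    (∀ n : ℕ, qInt ε n • rho K ε n =
      ∑ i ∈ Finset.Icc 1 n, ε ^ ((i : ℤ) - (n : ℤ)) • (phi K ε i * rho K ε (n - i))) ∧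
    IsUnit (wp K ε ε⁻¹) ∧
    wp K ε ε * Ring.inverse (wp K ε ε⁻¹) = 1 + (ε - ε⁻¹) • Phi K ε ∧
    Ring.inverse (wp K ε ε⁻¹) * wp K ε ε = 1 + (ε - ε⁻¹) • Phi K ε := by
  refine ⟨fun k hk => ?_, qInt_smul_rho_left hε, isUnit_wp _, ?_, ?_⟩
  · obtain ⟨n, rfl⟩ : ∃ n, k = n + 1 := ⟨k - 1, by omega⟩
    exact phi_eq_r hε n
  · rw [wp_eq_mul_wp_inv hε, mul_assoc, Ring.mul_inverse_cancel _ (isUnit_wp _), mul_one]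
  · rw [wp_eq_wp_inv_mul hε, ← mul_assoc, Ring.inverse_mul_cancel _ (isUnit_wp _), one_mul]
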